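/- **Setting.** Let $f\in\mathbb C[x]$ and let $X=\{f\neq 0\}\subset\mathbb A^1_{\mathbb C}$, an open affine subset of $\mathbb A^1$. For a finite set $I$ with an equivalence relation $\sim$ let $U(I)=U(I,\sim)\subset X^I$ be the open affine subset of those $(x_i)$ with $x_i\ne x_{i'}$ whenever $i\not\sim i'$, and let $S_X(I)=\Gamma(U(I),\mathcal O)=\mathbb C[x_i]_{i\in I}\big[f(x_i)^{-1},(x_i-x_{i'})^{-1}\ (i\not\sim i')\big]$. Let $\mathrm{Fin}^{\not\equiv}$ be the category of such pairs $(I,\sim)$ and of the maps $\alpha:I\to J$ for which $\alpha(i)\sim\alpha(i')$ implies $i\sim i'$; the category $\mathrm{Fin}$ of finite sets is the full subcategory where all elements of $I$ are equivalent, and then $U(I)=X^I$. A morphism $\alpha:I\to J$ gives $\phi(\alpha):U(J)\to U(I)$, $(x_j)\mapsto(x_{\alpha(i)})_i$, and a ring map $\alpha_*:S_X(I)\to S_X(J)$, $x_i\mapsto x_{\alpha(i)}$. Put $T(I)=\mathbb C[\partial_i]_{i\in I}$, where $\partial_i$ acts on $S_X(I)$ as $\partial/\partial x_i$. A map $\alpha$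 gives $\alpha^*:T(J)\to T(I)$, $\partial_j\mapsto\sum_{\alpha(i)=j}\partial_i$. A left $\mathcal D$-module on the affine variety $U(I)$ is identified with its space of global sections, an $S_X(I)$-module with commuting operators $\partial_i$ that satisfy the Leibniz rule. Pullback along $\phi(\alpha)$ is $\phi(\alpha)^*M=S_X(J)\otimes_{S_X(I)}M$, with $\partial_j(s\otimes m)=\partial_j s\otimes m+s\otimes\alpha^*(\partial_j)m$. For a surjection $\alpha:I\to J$ we write $\Delta(\alpha)=\phi(\alpha):X^J\hookrightarrow X^I$, $I_j=\alpha^{-1}(j)$, and $j(\alpha):U(\alpha)\hookrightarrow X^I$ for the open subset $x_i\neq x_{i'}$ unless $\alpha(i)=\alpha(i')$. **Factorization algebras.** A *factorization algebra* on $X$ is a family $\mathcal B=\{\mathcal B_{X^I}\}$ of left $\mathcal D$-modules on $X^I$, for all non-empty finite sets $I$, with isomorphisms of $\mathcal D$-modules, for all surjections $\alpha:I\to J$ of non-empty finite sets, $$\nu_\alpha:\Delta(\alpha)^*\mathcal B_{X^I}\xrightarrow{\ \sim\ }\mathcal B_{X^J},\qquad d_\alpha:j(\alpha)^*\Big(\boxtimes_{j\in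 J}\mathcal B_{X^{I_j}}\Big)\xrightarrow{\ \sim\ }j(\alpha)^*\mathcal B_{X^I},$$ such that no $\mathcal B_{X^I}$ has non-zero sections supported on the diagonal divisor, and for all surjections $\alpha:I\to J$, $\beta:J\to K$, with induced maps $\alpha_k:I_k\to J_k$ of the fibres over $k\in K$, * $\nu_{\beta\alpha}=\nu_\beta\circ\Delta(\beta)^*\nu_\alpha$; * $d_\alpha=d_{\beta\alpha}\circ\boxtimes_k d_{\alpha_k}$ on $U(\alpha)$; * the restriction of $d_{\beta\alpha}$ along $\Delta(\alpha)$ corresponds to $d_\beta$ under $\nu_\alpha$ and the $\nu_{\alpha_k}$. The modules $\mathcal O_{X^I}$ form a factorization algebra $\mathcal O$. A *unital* factorization algebra is a factorization algebra $\mathcal B$ with a map $u:\mathcal O\to\mathcal B$, that is, maps of $\mathcal D$-modules $u_I:\mathcal O_{X^I}\to\mathcal B_{X^I}$ compatible with all $\nu_\alpha$ and $d_\alpha$, such that, with $1=u(1)\in\mathcal B_X$, for every section $b$ of $\mathcal B_X$ the section $d_{\mathrm{id}}(1\boxtimes b)$ of $j_*j^*\mathcal B_{X^2}$ belongs to $\mathcal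 B_{X^2}$ and restricts to $b$ on the diagonal. A morphism of unital factorization algebras is a family of maps of $\mathcal D$-modules $\mathcal B_{X^I}\to\mathcal C_{X^I}$ compatible with all $\nu_\alpha$, $d_\alpha$ and $u_I$. The category is denoted $\mathrm{FA}(X)$. **$(A,H,S_X)$-vertex algebras.** Here $A$ is the category of complex vector spaces. An object $V$ of $\mathrm{Fun}(\mathrm{Fin}^{\not\equiv},A,T,S_X)$ is a functor from $\mathrm{Fin}^{\not\equiv}$ to $A$ with actions of $S_X(I)$ and $T(I)$ on $V(I)$ that satisfy the Leibniz rule, such that $\alpha_*^V(sv)=\alpha_*(s)\,\alpha_*^V(v)$ for $s\in S_X(I)$ and $t\,\alpha_*^V(v)=\alpha_*^V(\alpha^*(t)v)$ for $t\in T(J)$. Objects of $\mathrm{Fun}(\mathrm{Fin},A,T,S_X)$ are defined in the same way. Such an object is extended to $\mathrm{Fin}^{\not\equiv}$ by $V(I,\sim)=S_X(I,\sim)\otimes_{S_X(I)}V(I)$. Let $I\sqcup J$ carry the disjoint union of the equivalence relations (elements of $I$ and of $J$ are inequivalent). An *$(A,H,S_X)$-vertex algebra* is an object $V$ of $\mathrm{Fun}(\mathrm{Fin},A,T,S_X)$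 with a singular multiplication, i.e. linear maps $$\mu_{I,J}:V(I)\otimes V(J)\to V(I\sqcup J)\qquad(I,J\in\mathrm{Fin}^{\not\equiv})$$ that are functorial in $I$ and $J$ and commute with the actions of $S_X(I),S_X(J),T(I),T(J)$, such that $\mu$ is commutative and associative, and with a unit $\mathbf 1\in V(\varnothing)$ such that $\mu_{\varnothing,J}(\mathbf 1,v)=v$ under $J\cong\varnothing\sqcup J$. A morphism $V\to W$ is a natural transformation compatible with the actions of $T$ and $S_X$, with $\mu$, and with $\mathbf 1$. The category is denoted $\mathrm{VA}(A,H,S_X)$. **Theorem.** There is a functor $\Gamma_X:\mathrm{FA}(X)\to\mathrm{VA}(A,H,S_X)$ which sends a unital factorization algebra $\mathcal B$ to an $(A,H,S_X)$-vertex algebra $\mathbb V$ with $\mathbb V(I)=\Gamma(X^I,\mathcal B_{X^I})$, with its actions of $S_X(I)$ and $T(I)$, for every non-empty finite set $I$. Precisely, there are isomorphisms of $\mathcal D$-modules identifying $\mathbb V(I)$ with $\Gamma(X^I,\mathcal B_{X^I})$ for all $\mathcal B$ and all non-empty $I$, under which the following hold for all non-empty finite sets $I,J$. 1. $\mathbb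 V(\varnothing)=\mathbb C\cdot\mathbf 1$ is one-dimensional. 2. For a surjection $\alpha:I\to J$ the map $\alpha_*:\mathbb V(I)\to\mathbb V(J)$ is $b\mapsto\nu_\alpha(1\otimes b)$. 3. For the map $\varnothing\to I$, the map $\mathbb V(\varnothing)\to\mathbb V(I)$ sends $\mathbf 1$ to $u_I(1)$. 4. For the inclusion $I\to I\sqcup J$, the image of $b\in\mathbb V(I)$ in $\mathbb V(I\sqcup J)=\Gamma(X^{I\sqcup J},\mathcal B_{X^{I\sqcup J}})$ restricts to $d_\alpha(b\boxtimes u_J(1))$ on $U(\alpha)$, where $\alpha:I\sqcup J\to\{1,2\}$ is the map with fibres $I$ and $J$. 5. With the same $\alpha$, the singular multiplication is $\mu_{I,J}(b,c)=d_\alpha(b\boxtimes c)$ for $b\in\mathbb V(I)$, $c\in\mathbb V(J)$. 6. For a morphism $\varphi:\mathcal B\to\mathcal C$, the map $\Gamma_X(\varphi)_I$ is the map $\Gamma(X^I,\mathcal B_{X^I})\to\Gamma(X^I,\mathcal C_{X^I})$ given by $\varphi$. -/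

import Mathlib

open CategoryTheory TensorProduct Polynomial

universe u

namespace AHS

/-! ## Finite sets -/

/-- The objects of `Fin`: finite sets, possibly empty. Morphisms are all functions. -/
structure FinSet where
  carrier : Type
  [finite : Finite carrier]

instance : CoeSort FinSet Type := ⟨FinSet.carrier⟩

attribute [instance] FinSet.finite

/-- The objects of `Fin^≢`: finite sets with an equivalence relation. -/
structure FinNEq where
  set : FinSet
  rel : Setoid set

instance : CoeSort FinNEq Type := ⟨fun I => I.set⟩

/-- The morphisms of `Fin^≢`: functions which preserve inequivalence. -/
@[ext]
structure FinNEq.Hom (I J : FinNEq) where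
  toFun : I → J
  map_rel : ∀ i i', J.rel (toFun i) (toFun i') → I.rel i i'

instance : Category FinNEq where
  Hom := FinNEq.Hom
  id I := ⟨id, fun _ _ h => h⟩
  comp α β := ⟨β.toFun ∘ α.toFun, fun _ _ h => α.map_rel _ _ (β.map_rel _ _ h)⟩

/-- `Fin` as a full subcategory of `Fin^≢`: all elements of `I` are equivalent. -/
abbrev FinSet.toNEq (I : FinSet) : FinNEq := ⟨I, ⊤⟩

/-- Any function from a set all of whose elements are equivalent is a morphism of `Fin^≢`. -/
def FinNEq.fromTop {I : FinSet} {J : FinNEq} (α : I → J) : I.toNEq ⟶ J :=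
  FinNEq.Hom.mk α (fun _ _ _ => trivial)

/-- A function of finite sets as a morphism of `Fin^≢`. -/
def FinNEq.ofFun {I J : FinSet} (α : I → J) : I.toNEq ⟶ J.toNEq :=
  FinNEq.Hom.mk α (fun _ _ _ => trivial)

/-- The identity function, from the underlying set of `I`, with all its elements equivalent, to `I`.
Geometrically, the open embedding `U(I) ⊆ X^I`. -/
def FinNEq.toSelf (I : FinNEq) : I.set.toNEq ⟶ I :=
  FinNEq.Hom.mk id (fun _ _ _ => trivial)

/-- The finite set `α⁻¹(j)`. -/
noncomputable def FinNEq.preim {I J : FinNEq} (α : I ⟶ J) (j : J) : Finset I :=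
  (Set.toFinite {i | α.toFun i = j}).toFinset

@[simp] theorem FinNEq.mem_preim {I J : FinNEq} (α : I ⟶ J) (j : J) (i : I) :
    i ∈ FinNEq.preim α j ↔ α.toFun i = j := by
  simp [FinNEq.preim]

/-! ## The rings `S_X(I)` -/

/-- The functions on affine space that are inverted on the open subset `U(I) ⊆ X^I`, where
`X = {f ≠ 0} ⊆ 𝔸¹`: the `f(x_i)`, and the `x_i - x_j` for inequivalent `i`, `j`. -/
noncomputable def denominators (f : ℂ[X]) (I : FinNEq) : Submonoid (MvPolynomial I ℂ) :=
  Submonoid.closure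
    ({p | ∃ i : I, p = Polynomial.aeval (MvPolynomial.X i) f} ∪
      {p | ∃ i j : I, ¬ I.rel i j ∧ p = MvPolynomial.X i - MvPolynomial.X j})

/-- `S_X(I) = Γ(U(I), 𝒪)`, for `X = {f ≠ 0} ⊆ 𝔸¹`. -/
def SX (f : ℂ[X]) (I : FinNEq) : Type := Localization (denominators f I)

variable {f : ℂ[X]}

noncomputable instance (I : FinNEq) : CommRing (SX f I) :=
  inferInstanceAs (CommRing (Localization (denominators f I)))

noncomputable instance (I : FinNEq) : Algebra (MvPolynomial I ℂ) (SX f I) :=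
  inferInstanceAs (Algebra (MvPolynomial I ℂ) (Localization (denominators f I)))

noncomputable instance (I : FinNEq) : Algebra ℂ (SX f I) :=
  inferInstanceAs (Algebra ℂ (Localization (denominators f I)))

instance (I : FinNEq) : IsScalarTower ℂ (MvPolynomial I ℂ) (SX f I) :=
  inferInstanceAs (IsScalarTower ℂ (MvPolynomial I ℂ) (Localization (denominators f I)))

instance (I : FinNEq) : IsLocalization (denominators f I) (SX f I) :=
  inferInstanceAs (IsLocalization (denominators f I) (Localization (denominators f I)))

/-- The coordinate `x_i` on `U(I)`. -/
noncomputable def SX.x {I : FinNEq} (i : I) : SX f I :=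
  algebraMap (MvPolynomial I ℂ) (SX f I) (MvPolynomial.X i)

theorem SX.isUnit_rename {I J : FinNEq} (α : I ⟶ J) (p : denominators f I) :
    IsUnit (((IsScalarTower.toAlgHom ℂ (MvPolynomial J ℂ) (SX f J)).comp
      (MvPolynomial.rename α.toFun)) p) := by
  have h : denominators f I ≤ (denominators f J).comap (MvPolynomial.rename (R := ℂ) α.toFun) := by
    refine Submonoid.closure_le.2 ?_
    rintro p (⟨i, rfl⟩ | ⟨i, j, hij, rfl⟩)
    · refine Submonoid.subset_closure (Or.inl ⟨α.toFun i, ?_⟩)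
      rw [← Polynomial.aeval_algHom_apply, MvPolynomial.rename_X]
    · refine Submonoid.subset_closure (Or.inr ⟨α.toFun i, α.toFun j, ?_, ?_⟩)
      · exact fun h => hij (α.map_rel _ _ h)
      · simp
  exact IsLocalization.map_units (SX f J) (⟨_, h p.2⟩ : denominators f J)

/-- Pullback of functions along `φ_U(α) : U(J) → U(I)`; it sends `x_i` to `x_{α(i)}`. -/
noncomputable def SX.map {I J : FinNEq} (α : I ⟶ J) : SX f I →ₐ[ℂ] SX f J :=
  IsLocalization.liftAlgHom (M := denominators f I) (SX.isUnit_rename α)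

@[simp] theorem SX.map_algebraMap {I J : FinNEq} (α : I ⟶ J) (p : MvPolynomial I ℂ) :
    SX.map α (algebraMap _ (SX f I) p) =
      algebraMap _ (SX f J) (MvPolynomial.rename α.toFun p) := by
  simp [SX.map]

theorem SX.algHom_ext {I : FinNEq} {A : Type*} [CommRing A] [Algebra ℂ A]
    {φ ψ : SX f I →ₐ[ℂ] A} (h : ∀ i, φ (SX.x i) = ψ (SX.x i)) : φ = ψ := by
  refine IsLocalization.algHom_ext (denominators f I) ?_
  exact MvPolynomial.algHom_ext h

@[simp] theorem SX.map_x {I J : FinNEq} (α : I ⟶ J) (i : I) :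
    SX.map α (SX.x i : SX f I) = SX.x (α.toFun i) := by
  simp [SX.x]

theorem SX.map_id (I : FinNEq) (s : SX f I) : SX.map (𝟙 I) s = s := by
  have : SX.map (𝟙 I) = AlgHom.id ℂ (SX f I) := SX.algHom_ext (fun i => SX.map_x _ _)
  simp [this]

theorem SX.map_comp {I J K : FinNEq} (α : I ⟶ J) (β : J ⟶ K) (s : SX f I) :
    SX.map (α ≫ β) s = SX.map β (SX.map α s) := by
  have : SX.map (f := f) (α ≫ β) = (SX.map β).comp (SX.map α) :=
    SX.algHom_ext (fun i => by simp; rfl)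
  simp [this]

section Derivation

variable {R : Type} [CommRing R] [Algebra ℂ R] (N : Submonoid R) {A : Type} [CommRing A]
  [Algebra R A] [Algebra ℂ A] [IsScalarTower ℂ R A] (D : Derivation ℂ R R)

/-- Auxiliary: `r ↦ r + ε D(r)`, as a homomorphism to the dual numbers. -/
noncomputable def dualLift (A : Type) [CommRing A] [Algebra R A] [Algebra ℂ A]
    [IsScalarTower ℂ R A] (D : Derivation ℂ R R) : R →ₐ[ℂ] TrivSqZeroExt A A where
  toFun r := (algebraMap R A r, algebraMap R A (D r))
  map_one' := by
    refine Prod.ext ?_ ?_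
    · exact map_one _
    · change algebraMap R A (D 1) = 0
      simp
  map_mul' a b := by
    refine Prod.ext ?_ ?_
    · exact map_mul _ _ _
    · change algebraMap R A (D (a * b)) = algebraMap R A a * algebraMap R A (D b) +
        algebraMap R A (D a) * algebraMap R A b
      rw [D.leibniz, smul_eq_mul, smul_eq_mul, map_add, map_mul, map_mul,
        mul_comm (algebraMap R A b)]
  map_zero' := by
    refine Prod.ext ?_ ?_
    · exact map_zero _
    · change algebraMap R A (D 0) = 0
      simp
  map_add' a b := by
    refine Prod.ext ?_ ?_
    · exact map_add _ _ _
    · change algebraMap R A (D (a + b)) = algebraMap R A (D a) + algebraMap R A (D b)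
      simp
  commutes' c := by
    refine Prod.ext ?_ ?_
    · exact (IsScalarTower.algebraMap_apply ℂ R A c).symm
    · change algebraMap R A (D (algebraMap ℂ R c)) = 0
      simp

theorem dualLift_isUnit [IsLocalization N A] (n : N) : IsUnit (dualLift A D n) := by
  rw [TrivSqZeroExt.isUnit_iff_isUnit_fst]
  exact IsLocalization.map_units A n

/-- Auxiliary: the extension of `dualLift` to the localization. -/
noncomputable def dualLift' [IsLocalization N A] : A →ₐ[ℂ] TrivSqZeroExt A A :=
  IsLocalization.liftAlgHom (M := N) (f := dualLift A D) (dualLift_isUnit N D)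

theorem dualLift'_algebraMap [IsLocalization N A] (r : R) :
    dualLift' N D (algebraMap R A r) = dualLift A D r := by
  simp only [dualLift', IsLocalization.liftAlgHom_apply]
  exact IsLocalization.lift_eq _ _

theorem fst_dualLift' [IsLocalization N A] (s : A) :
    TrivSqZeroExt.fst (dualLift' N D s) = s := by
  have : (TrivSqZeroExt.fstHom ℂ A A).comp (dualLift' N D) = AlgHom.id ℂ A := by
    refine IsLocalization.algHom_ext N ?_
    ext r
    change TrivSqZeroExt.fst (dualLift' N D (algebraMap R A r)) = algebraMap R A r
    rw [dualLift'_algebraMap]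
    rfl
  exact DFunLike.congr_fun this s

/-- The extension of a derivation to a localization (the quotient rule). -/
noncomputable def locDer [IsLocalization N A] : Derivation ℂ A A :=
  Derivation.mk' ((TrivSqZeroExt.sndHom A A).restrictScalars ℂ ∘ₗ (dualLift' N D).toLinearMap)
    (fun a b => by
      change TrivSqZeroExt.snd (dualLift' N D (a * b)) =
        a * TrivSqZeroExt.snd (dualLift' N D b) + b * TrivSqZeroExt.snd (dualLift' N D a)
      rw [map_mul, TrivSqZeroExt.snd_mul, fst_dualLift', fst_dualLift', smul_eq_mul,
        MulOpposite.smul_eq_mul_unop, MulOpposite.unop_op, mul_comm b])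

theorem locDer_algebraMap [IsLocalization N A] (r : R) :
    locDer N D (algebraMap R A r) = algebraMap R A (D r) := by
  change TrivSqZeroExt.snd (dualLift' N D (algebraMap R A r)) = _
  rw [dualLift'_algebraMap]
  rfl

end Derivation

/-- The vector field `∂_i = d/dx_i` on `U(I)`. -/
noncomputable def SX.der {I : FinNEq} (i : I) : Derivation ℂ (SX f I) (SX f I) :=
  locDer (denominators f I) (MvPolynomial.pderiv i)

@[simp] theorem SX.der_x {I : FinNEq} (i j : I) [Decidable (i = j)] :
    SX.der i (SX.x j : SX f I) = if i = j then 1 else 0 := by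
  classical
  rw [SX.der, SX.x, locDer_algebraMap, MvPolynomial.pderiv_X]
  by_cases h : i = j
  · subst h; simp
  · simp [h, Ne.symm h]

theorem SX.deriv_ext {I : FinNEq} {A : Type} [CommRing A] [Algebra ℂ A] (φ : SX f I →ₐ[ℂ] A)
    (δ ε : SX f I →ₗ[ℂ] A) (hδ : ∀ a b, δ (a * b) = φ a * δ b + φ b * δ a)
    (hε : ∀ a b, ε (a * b) = φ a * ε b + φ b * ε a) (h : ∀ i, δ (SX.x i) = ε (SX.x i))
    (s : SX f I) : δ s = ε s := by
  have h1 : δ 1 = 0 := by simpa using hδ 1 1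
  have h2 : ε 1 = 0 := by simpa using hε 1 1
  have hp : ∀ p : MvPolynomial I ℂ, δ (algebraMap _ _ p) = ε (algebraMap _ _ p) := by
    intro p
    induction p using MvPolynomial.induction_on with
    | C c =>
      have : algebraMap (MvPolynomial I ℂ) (SX f I) (MvPolynomial.C c) = c • 1 := by
        rw [Algebra.smul_def, mul_one]
        exact (IsScalarTower.algebraMap_apply ℂ (MvPolynomial I ℂ) (SX f I) c).symm
      rw [this, map_smul, map_smul, h1, h2]
    | add p q hp hq => rw [map_add, map_add, map_add, hp, hq]
    | mul_X p i hp => rw [map_mul, hδ, hε, hp]; erw [h i]; rfl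
  obtain ⟨p, n, rfl⟩ := IsLocalization.exists_mk'_eq (denominators f I) s
  have hu : IsUnit (φ (algebraMap _ _ (n : MvPolynomial I ℂ))) :=
    (IsLocalization.map_units (SX f I) n).map φ
  have e := IsLocalization.mk'_spec (SX f I) p n
  have e1 := hδ (IsLocalization.mk' (SX f I) p n) (algebraMap _ _ (n : MvPolynomial I ℂ))
  have e2 := hε (IsLocalization.mk' (SX f I) p n) (algebraMap _ _ (n : MvPolynomial I ℂ))
  rw [e, hp] at e1
  rw [e, e1, hp] at e2
  exact hu.mul_left_cancel (add_left_cancel e2)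

theorem SX.der_comm {I : FinNEq} (i j : I) (s : SX f I) :
    SX.der i (SX.der j s) = SX.der j (SX.der i s) := by
  classical
  have := SX.deriv_ext (AlgHom.id ℂ (SX f I)) (⁅(SX.der i : Derivation ℂ (SX f I) (SX f I)), SX.der j⁆ : Derivation ℂ (SX f I) (SX f I)).toLinearMap
    0 (fun a b => Derivation.leibniz _ a b) (by simp) (fun k => by
      change (⁅(SX.der i : Derivation ℂ (SX f I) (SX f I)), SX.der j⁆ : Derivation ℂ (SX f I) (SX f I)) _ = 0
      rw [Derivation.commutator_apply]
      simp only [SX.der_x]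
      split_ifs <;> simp) s
  have h : (⁅(SX.der i : Derivation ℂ (SX f I) (SX f I)), SX.der j⁆ : Derivation ℂ (SX f I) (SX f I)) s = 0 := this
  rwa [Derivation.commutator_apply, sub_eq_zero] at h

theorem SX.der_map {I J : FinNEq} (α : I ⟶ J) (j : J) (s : SX f I) :
    SX.der j (SX.map α s) = SX.map α (∑ i ∈ FinNEq.preim α j, SX.der i s) := by
  classical
  have := SX.deriv_ext (SX.map α) ((SX.der j).toLinearMap ∘ₗ (SX.map α).toLinearMap)
    ((SX.map α).toLinearMap ∘ₗ (∑ i ∈ FinNEq.preim α j, (SX.der i).toLinearMap))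
    (by simp) (by
      intro a b
      simp [Finset.mul_sum, Finset.sum_add_distrib]) (fun i => by
      simp only [LinearMap.comp_apply, AlgHom.toLinearMap_apply, SX.map_x,
        LinearMap.sum_apply, Derivation.coeFn_coe, SX.der_x]
      rw [Finset.sum_ite_eq']
      simp only [FinNEq.mem_preim, eq_comm (a := j)]
      split_ifs <;> simp) s
  simpa [LinearMap.sum_apply] using this

/-! ## `D`-modules on `U(I)` -/

/-- A left `D`-module on the smooth affine variety `U(I)`, given by its module of global sections:
an `S_X(I)`-module with commuting actions of the vector fields `∂_i` satisfying the Leibniz rule.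
Equivalently, a vector space with compatible actions of `S_X(I)` and `T(I) = ℂ[∂_i]`. -/
structure DMod (f : ℂ[X]) (I : FinNEq) where
  carrier : Type u
  [addCommGroup : AddCommGroup carrier]
  [moduleC : Module ℂ carrier]
  [module : Module (SX f I) carrier]
  [tower : IsScalarTower ℂ (SX f I) carrier]
  der : I → carrier →ₗ[ℂ] carrier
  der_smul : ∀ (i : I) (s : SX f I) (m : carrier), der i (s • m) = SX.der i s • m + s • der i m
  der_comm : ∀ (i j : I) (m : carrier), der i (der j m) = der j (der i m)

namespace DMod

instance {I : FinNEq} : CoeSort (DMod.{u} f I) (Type u) := ⟨DMod.carrier⟩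

attribute [instance] addCommGroup moduleC module tower

/-- Homomorphisms of `D`-modules. -/
@[ext]
structure Hom {I : FinNEq} (M N : DMod.{u} f I) where
  toLin : M →ₗ[SX f I] N
  map_der : ∀ (i : I) (m : M), toLin (M.der i m) = N.der i (toLin m)

noncomputable instance {I : FinNEq} : Category (DMod.{u} f I) where
  Hom := Hom
  id M := ⟨LinearMap.id, fun _ _ => rfl⟩
  comp φ ψ := ⟨ψ.toLin ∘ₗ φ.toLin, fun i m => by simp [φ.map_der, ψ.map_der]⟩

/-- For `α : I ⟶ J` in `Fin^≢`, `M` over `I` and `N` over `J`: maps `n : M → N` that are compatible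
with `S_X(I) → S_X(J)`, and with `α^* : T(J) → T(I)`, `∂_j ↦ ∑_{α(i) = j} ∂_i`, in the sense
that `t.n(m) = n(α^*(t).m)` for `t ∈ T(J)`. -/
@[ext]
structure SemiHom {I J : FinNEq} (α : I ⟶ J) (M : DMod.{u} f I) (N : DMod.{u} f J) where
  toFun : M →ₗ[ℂ] N
  map_smul : ∀ (s : SX f I) (m : M), toFun (s • m) = SX.map α s • toFun m
  map_der : ∀ (j : J) (m : M), N.der j (toFun m) = toFun (∑ i ∈ FinNEq.preim α j, M.der i m)

instance {I J : FinNEq} (α : I ⟶ J) (M : DMod.{u} f I) (N : DMod.{u} f J) :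
    CoeFun (SemiHom α M N) (fun _ => M → N) := ⟨fun n => n.toFun⟩

end DMod

/-! ## Pullback of `D`-modules -/

section BaseChange

variable {R A : Type} [CommRing R] [CommRing A] [Algebra ℂ R] [Algebra ℂ A] (φ : R →ₐ[ℂ] A)
  (M : Type u) [AddCommGroup M] [Module R M]

/-- The ring `A`, regarded as an `R`-algebra through `φ`. -/
def Along (_ : R →ₐ[ℂ] A) : Type := A

noncomputable instance : CommRing (Along φ) := inferInstanceAs (CommRing A)

noncomputable instance : Algebra R (Along φ) := φ.toRingHom.toAlgebra

noncomputable instance : Algebra A (Along φ) := inferInstanceAs (Algebra A A)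

instance : SMulCommClass R A (Along φ) := ⟨fun r a b => mul_left_comm (φ r) a (b : A)⟩

/-- The base change `A ⊗[R] M` along `φ : R → A`. -/
noncomputable def BaseChange : Type u := Along φ ⊗[R] M

namespace BaseChange

noncomputable instance : AddCommGroup (BaseChange φ M) :=
  TensorProduct.addCommGroup (R := R) (M := Along φ) (N := M)

noncomputable instance : Module A (BaseChange φ M) :=
  TensorProduct.leftModule (R := R) (R'' := A) (M := Along φ) (N := M)

noncomputable instance : Module ℂ (BaseChange φ M) :=
  Module.compHom _ (algebraMap ℂ A)

instance : IsScalarTower ℂ A (BaseChange φ M) :=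
  ⟨fun c a m => by rw [Algebra.smul_def, mul_smul]; rfl⟩

variable {M}

/-- The pure tensor `a ⊗ m`. -/
noncomputable def tmul (a : A) (m : M) : BaseChange φ M :=
  TensorProduct.tmul R (M := Along φ) a m

theorem add_tmul (a b : A) (m : M) : tmul φ (a + b) m = tmul φ a m + tmul φ b m :=
  TensorProduct.add_tmul (R := R) (M := Along φ) a b m

theorem tmul_add (a : A) (m n : M) : tmul φ a (m + n) = tmul φ a m + tmul φ a n :=
  TensorProduct.tmul_add (R := R) (M := Along φ) a m n

theorem tmul_smul (a : A) (r : R) (m : M) : tmul φ a (r • m) = tmul φ (φ r * a) m :=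
  (TensorProduct.smul_tmul (R := R) (M := Along φ) r a m).symm

theorem smul_tmul (a b : A) (m : M) : a • tmul φ b m = tmul φ (a * b) m := rfl

@[elab_as_elim]
theorem induction {p : BaseChange φ M → Prop} (x : BaseChange φ M) (zero : p 0)
    (tmul : ∀ a m, p (tmul φ a m)) (add : ∀ x y, p x → p y → p (x + y)) : p x :=
  TensorProduct.induction_on (motive := p) x zero tmul add

variable {φ}

/-- Additive maps out of the base change. -/
noncomputable def liftAdd {P : Type*} [AddCommGroup P] (g : A →+ M →+ P)
    (h : ∀ (r : R) (a : A) (m : M), g (φ r * a) m = g a (r • m)) : BaseChange φ M →+ P :=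
  TensorProduct.liftAddHom (R := R) (M := Along φ) g h

@[simp] theorem liftAdd_tmul {P : Type*} [AddCommGroup P] (g : A →+ M →+ P)
    (h : ∀ (r : R) (a : A) (m : M), g (φ r * a) m = g a (r • m)) (a : A) (m : M) :
    liftAdd g h (tmul φ a m) = g a m := rfl

end BaseChange

end BaseChange

namespace DMod

variable {I J : FinNEq} (α : I ⟶ J) (M : DMod.{u} f I)

/-- Auxiliary: the action `s ⊗ m ↦ ∂_j(s) ⊗ m + s ⊗ α^*(∂_j) m` on the pullback. -/
noncomputable def pullDerAdd (j : J) :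
    BaseChange (SX.map (f := f) α) M →+ BaseChange (SX.map (f := f) α) M :=
  BaseChange.liftAdd
    (AddMonoidHom.mk' (fun s => AddMonoidHom.mk'
        (fun m => BaseChange.tmul _ (SX.der j s) m +
          BaseChange.tmul _ s (∑ i ∈ FinNEq.preim α j, M.der i m))
        (fun m n => by
          simp only [map_add, Finset.sum_add_distrib, BaseChange.tmul_add]; abel))
      (fun s t => by
        ext m
        simp only [map_add, BaseChange.add_tmul, AddMonoidHom.mk'_apply, AddMonoidHom.add_apply]
        abel))
    (fun r s m => by
      simp only [AddMonoidHom.mk'_apply, M.der_smul, Finset.sum_add_distrib, BaseChange.tmul_add,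
        BaseChange.tmul_smul, Derivation.leibniz, smul_eq_mul, BaseChange.add_tmul, SX.der_map,
        ← Finset.smul_sum, ← Finset.sum_smul]
      rw [mul_comm s]
      abel)

end DMod

namespace DMod

variable {I J : FinNEq} (α : I ⟶ J) (M : DMod.{u} f I)

theorem pullDerAdd_tmul (j : J) (s : SX f J) (m : M) :
    pullDerAdd α M j (BaseChange.tmul _ s m) = BaseChange.tmul _ (SX.der j s) m +
      BaseChange.tmul _ s (∑ i ∈ FinNEq.preim α j, M.der i m) := rfl

theorem pullDerAdd_smul (j : J) (s : SX f J) (x : BaseChange (SX.map (f := f) α) M) :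
    pullDerAdd α M j (s • x) = SX.der j s • x + s • pullDerAdd α M j x := by
  induction x using BaseChange.induction with
  | zero => simp
  | tmul a m =>
    simp only [BaseChange.smul_tmul, pullDerAdd_tmul, Derivation.leibniz, smul_eq_mul, smul_add,
      BaseChange.add_tmul]
    rw [mul_comm a]
    abel
  | add x y hx hy => simp only [smul_add, map_add, hx, hy]; abel

/-- The pullback `φ_U(α)^* M = S_X(J) ⊗_{S_X(I)} M` of a `D`-module along `φ_U(α) : U(J) → U(I)`.
The field `∂_j` acts by `∂_j ⊗ 1 + 1 ⊗ α^*(∂_j)`, with `α^*(∂_j) = ∑_{α(i) = j} ∂_i`. -/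
noncomputable def pull : DMod.{u} f J where
  carrier := BaseChange (SX.map (f := f) α) M
  der j :=
    { toFun := pullDerAdd α M j
      map_add' := map_add _
      map_smul' := fun c x => by
        change pullDerAdd α M j (algebraMap ℂ (SX f J) c • x) =
          algebraMap ℂ (SX f J) c • pullDerAdd α M j x
        rw [pullDerAdd_smul]
        simp }
  der_smul j s x := pullDerAdd_smul α M j s x
  der_comm j k x := by
    change pullDerAdd α M j (pullDerAdd α M k x) = pullDerAdd α M k (pullDerAdd α M j x)
    induction x using BaseChange.induction with
    | zero => simp
    | tmul a m =>
      simp only [pullDerAdd_tmul, map_add]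
      rw [SX.der_comm j k]
      simp only [map_sum]
      rw [Finset.sum_comm]
      simp only [M.der_comm]
      abel
    | add x y hx hy => simp only [map_add, hx, hy]

variable {M}

/-- The section `s ⊗ m` of the pullback. -/
noncomputable def tmul (s : SX f J) (m : M) : M.pull α := BaseChange.tmul _ s m

theorem add_tmul (s t : SX f J) (m : M) : tmul α (s + t) m = tmul α s m + tmul α t m :=
  BaseChange.add_tmul _ s t m

theorem tmul_add (s : SX f J) (m n : M) : tmul α s (m + n) = tmul α s m + tmul α s n :=
  BaseChange.tmul_add _ s m n

theorem tmul_smul (s : SX f J) (r : SX f I) (m : M) :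
    tmul α s (r • m) = tmul α (SX.map α r * s) m :=
  BaseChange.tmul_smul _ s r m

theorem smul_tmul (s t : SX f J) (m : M) : s • tmul α t m = tmul α (s * t) m := rfl

theorem sum_tmul {ι : Type*} (T : Finset ι) (s : ι → SX f J) (m : M) :
    tmul α (∑ i ∈ T, s i) m = ∑ i ∈ T, tmul α (s i) m :=
  map_sum (AddMonoidHom.mk' (fun s => tmul α s m) (fun s t => add_tmul α s t m)) s T

theorem tmul_sum {ι : Type*} (T : Finset ι) (s : SX f J) (m : ι → M) :
    tmul α s (∑ i ∈ T, m i) = ∑ i ∈ T, tmul α s (m i) :=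
  map_sum (AddMonoidHom.mk' (fun m => tmul α s m) (fun m n => tmul_add α s m n)) m T

theorem pull_der_tmul (j : J) (s : SX f J) (m : M) :
    (M.pull α).der j (tmul α s m) = tmul α (SX.der j s) m +
      tmul α s (∑ i ∈ FinNEq.preim α j, M.der i m) := rfl

@[elab_as_elim]
theorem pull_induction {p : M.pull α → Prop} (x : M.pull α) (zero : p 0)
    (tmul : ∀ (s : SX f J) (m : M), p (tmul α s m)) (add : ∀ x y, p x → p y → p (x + y)) :
    p x :=
  BaseChange.induction (φ := SX.map (f := f) α) (M := M) (p := p) x zero tmul add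

/-- A homomorphism `φ_U(α)^* M ⟶ N`, regarded as the map `m ↦ h(1 ⊗ m)` from `M` to `N`. -/
noncomputable def Hom.semi {α : I ⟶ J} {N : DMod.{u} f J} (h : M.pull α ⟶ N) :
    SemiHom α M N where
  toFun :=
    { toFun := fun m => h.toLin (tmul α 1 m)
      map_add' := fun m n => by rw [tmul_add, map_add]
      map_smul' := fun c m => by
        rw [← algebraMap_smul (SX f I) c m, RingHom.id_apply, ← algebraMap_smul (SX f J) c,
          ← map_smul, tmul_smul, smul_tmul, AlgHom.commutes] }
  map_smul s m := by
    change h.toLin _ = _ • h.toLin _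
    rw [← map_smul, tmul_smul, smul_tmul]
  map_der j m := by
    change N.der j (h.toLin _) = h.toLin _
    rw [← h.map_der, pull_der_tmul, Derivation.map_one_eq_zero]
    refine congrArg _ (add_eq_right.2 ?_)
    simpa using add_tmul α 0 0 m

/-- The restriction to `U(I)` of a `D`-module on `X^I`. -/
noncomputable abbrev on {I : FinNEq} (M : DMod.{u} f I.set.toNEq) : DMod.{u} f I :=
  M.pull I.toSelf

/-- The restriction to `U(I)` of a section on `X^I`. -/
noncomputable abbrev res {I : FinNEq} {M : DMod.{u} f I.set.toNEq} (m : M) : M.on (I := I) :=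
  tmul I.toSelf 1 m

theorem on_der_tmul {I : FinNEq} (M : DMod.{u} f I.set.toNEq) (i : I) (s : SX f I) (m : M) :
    M.on.der i (tmul I.toSelf s m) =
      tmul I.toSelf (SX.der i s) m + tmul I.toSelf s (M.der i m) := by
  rw [pull_der_tmul]
  have h : FinNEq.preim I.toSelf i = {i} := by
    ext k
    rw [FinNEq.mem_preim, Finset.mem_singleton]
    rfl
  rw [h, Finset.sum_singleton]

end DMod

namespace DMod

variable {I J : FinNEq} (α : I ⟶ J) {M : DMod.{u} f I.set.toNEq} {N : DMod.{u} f J.set.toNEq}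

/-- Auxiliary: the map `s ⊗ m ↦ α_*(s) ⊗ n(m)`. -/
noncomputable def SemiHom.onAdd (n : SemiHom (FinNEq.ofFun α.toFun) M N) :
    M.on (I := I) →+ N.on (I := J) :=
  BaseChange.liftAdd
    (AddMonoidHom.mk' (fun s => AddMonoidHom.mk'
        (fun m => tmul J.toSelf (SX.map α s) (n m))
        (fun m m' => by rw [map_add, tmul_add]))
      (fun s t => by
        ext m
        simp only [map_add]
        exact add_tmul _ _ _ _))
    (fun r s m => by
      change tmul J.toSelf (SX.map α (_ * s)) (n m) = tmul J.toSelf (SX.map α s) (n (r • m))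
      rw [n.map_smul, tmul_smul, map_mul, ← SX.map_comp, ← SX.map_comp]
      rfl)

theorem SemiHom.onAdd_tmul (n : SemiHom (FinNEq.ofFun α.toFun) M N) (s : SX f I) (m : M) :
    n.onAdd α (tmul I.toSelf s m) = tmul J.toSelf (SX.map α s) (n m) :=
  rfl

theorem SemiHom.onAdd_smul (n : SemiHom (FinNEq.ofFun α.toFun) M N) (s : SX f I)
    (x : M.on (I := I)) : n.onAdd α (s • x) = SX.map α s • n.onAdd α x := by
  induction x using pull_induction with
  | zero => rw [smul_zero, map_zero, smul_zero]
  | tmul a m => rw [smul_tmul, SemiHom.onAdd_tmul, SemiHom.onAdd_tmul, map_mul, smul_tmul]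
  | add x y hx hy => rw [smul_add, map_add, hx, hy, map_add, smul_add]

theorem SemiHom.onAdd_der (n : SemiHom (FinNEq.ofFun α.toFun) M N) (j : J) (x : M.on (I := I)) :
    N.on.der j (n.onAdd α x) = n.onAdd α (∑ i ∈ FinNEq.preim α j, M.on.der i x) := by
  induction x using pull_induction with
  | zero => simp
  | tmul a m =>
    rw [SemiHom.onAdd_tmul, on_der_tmul, SX.der_map, n.map_der]
    simp only [on_der_tmul, map_sum, map_add, SemiHom.onAdd_tmul, sum_tmul, tmul_sum,
      Finset.sum_add_distrib]
    rfl
  | add x y hx hy => simp only [map_add, hx, hy, Finset.sum_add_distrib]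

/-- The restriction of `n : M → N` to open subsets: `s ⊗ m ↦ α_*(s) ⊗ n(m)`. -/
noncomputable def SemiHom.on (n : SemiHom (FinNEq.ofFun α.toFun) M N) :
    SemiHom α (M.on (I := I)) (N.on (I := J)) where
  toFun :=
    { toFun := n.onAdd α
      map_add' := map_add _
      map_smul' := fun c x => by
        rw [← algebraMap_smul (SX f I) c x, RingHom.id_apply, ← algebraMap_smul (SX f J) c,
          SemiHom.onAdd_smul, AlgHom.commutes] }
  map_smul s x := n.onAdd_smul α s x
  map_der j x := n.onAdd_der α j x

/-- A homomorphism of `D`-modules on `X^I`, regarded as a map over the identity of `I`. -/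
noncomputable def SemiHom.ofHom {I : FinSet} {M N : DMod.{u} f I.toNEq} (h : M ⟶ N) :
    SemiHom (FinNEq.ofFun (id : I → I)) M N where
  toFun := h.toLin.restrictScalars ℂ
  map_smul s m := by
    have : SX.map (f := f) (FinNEq.ofFun (id : I → I)) s = s := SX.map_id _ s
    rw [this]
    exact h.toLin.map_smul s m
  map_der j m := by
    have e : FinNEq.preim (FinNEq.ofFun (id : I → I)) j = {j} := by
      ext k
      rw [FinNEq.mem_preim, Finset.mem_singleton]
      rfl
    rw [e, Finset.sum_singleton]
    exact (h.map_der j m).symm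

/-- The restriction to `U(I)` of a homomorphism of `D`-modules on `X^I`: `s ⊗ m ↦ s ⊗ h(m)`. -/
noncomputable def onMap {I : FinNEq} {M N : DMod.{u} f I.set.toNEq} (h : M ⟶ N) :
    M.on (I := I) →ₗ[ℂ] N.on (I := I) :=
  (SemiHom.on (𝟙 I) (SemiHom.ofHom h)).toFun

theorem onMap_tmul {I : FinNEq} {M N : DMod.{u} f I.set.toNEq} (h : M ⟶ N) (s : SX f I)
    (m : M) : onMap h (tmul I.toSelf s m) = tmul I.toSelf s (h.toLin m) := by
  change tmul I.toSelf (SX.map (𝟙 I) s) (h.toLin m) = _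
  rw [SX.map_id]

theorem onMap_id {I : FinNEq} (M : DMod.{u} f I.set.toNEq) (x : M.on (I := I)) :
    onMap (𝟙 M) x = x := by
  induction x using pull_induction with
  | zero => rw [map_zero]
  | tmul s m => rw [onMap_tmul]; rfl
  | add x y hx hy => rw [map_add, hx, hy]

theorem onMap_comp {I : FinNEq} {M N P : DMod.{u} f I.set.toNEq} (g : M ⟶ N) (h : N ⟶ P)
    (x : M.on (I := I)) : onMap (g ≫ h) x = onMap h (onMap g x) := by
  induction x using pull_induction with
  | zero => simp only [map_zero]
  | tmul s m => rw [onMap_tmul, onMap_tmul, onMap_tmul]; rfl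
  | add x y hx hy => simp only [map_add, hx, hy]

/-- The further restriction of sections from `U(I, r)` to a smaller open subset `U(I, r')`. -/
noncomputable def resTo {I : FinSet} {r r' : Setoid I} (h : r' ≤ r) (M : DMod.{u} f I.toNEq) :
    M.on (I := ⟨I, r⟩) →ₗ[ℂ] M.on (I := ⟨I, r'⟩) :=
  (SemiHom.on (I := ⟨I, r⟩) (J := ⟨I, r'⟩) (FinNEq.Hom.mk id fun _ _ hi => h hi)
    (SemiHom.ofHom (𝟙 M))).toFun

end DMod
/-! ## External tensor products -/

section Box

open Classical in
/-- Auxiliary: for `φ_k : R_k → A` and `R_k`-modules `M_k`, the relations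
`1 ⊗ (⋯ ⊗ r m_k ⊗ ⋯) = φ_k(r) ⊗ (⋯ ⊗ m_k ⊗ ⋯)` in `A ⊗_ℂ (⨂_ℂ M_k)`. -/
noncomputable def boxRel {K A : Type} {R : K → Type} [CommRing A] [Algebra ℂ A]
    [∀ k, CommRing (R k)] [∀ k, Algebra ℂ (R k)] (φ : ∀ k, R k →ₐ[ℂ] A) (M : K → Type u)
    [∀ k, AddCommGroup (M k)] [∀ k, Module ℂ (M k)] [∀ k, Module (R k) (M k)] :
    Submodule A (A ⊗[ℂ] (⨂[ℂ] k, M k)) :=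
  Submodule.span A {x | ∃ (k : K) (m : ∀ k, M k) (r : R k),
    x = 1 ⊗ₜ PiTensorProduct.tprod ℂ (Function.update m k (r • m k)) -
      φ k r ⊗ₜ PiTensorProduct.tprod ℂ m}

end Box

/-- The fibre `I_j = α⁻¹(j)`. -/
abbrev FinSet.fiber {I J : FinSet} (α : I → J) (j : J) : FinSet := ⟨{i : I // α i = j}⟩

/-- The set `I` with the equivalence relation `i ∼ i' ↔ α(i) = α(i')`, so that `U(I)` is
`U(α) = {(x_i) | x_i ≠ x_i' unless α(i) = α(i')}`. -/
abbrev FinNEq.ker {I J : FinSet} (α : I → J) : FinNEq := ⟨I, Setoid.ker α⟩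

/-- The inclusion of a fibre. Geometrically, the projection `U(α) → X^{I_j}`. -/
def FinNEq.fiberIncl {I J : FinSet} (α : I → J) (j : J) :
    (FinSet.fiber α j).toNEq ⟶ FinNEq.ker α :=
  FinNEq.Hom.mk Subtype.val (fun _ _ _ => trivial)

namespace DMod

variable {I J : FinSet} (α : I → J) {j₀ : J} (M : ∀ j, DMod.{u} f (FinSet.fiber α j).toNEq)

/-- Auxiliary: the relations defining the external tensor product. -/
noncomputable abbrev boxRels : Submodule (SX f (FinNEq.ker α))
    (SX f (FinNEq.ker α) ⊗[ℂ] (⨂[ℂ] j, M j)) :=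
  boxRel (R := fun j => SX f (FinSet.fiber α j).toNEq)
    (fun j => SX.map (FinNEq.fiberIncl α j)) (fun j => M j)

open Classical in
/-- Auxiliary: `∂_i` on the factor `M_j` if `α(i) = j`, and the identity otherwise. -/
noncomputable def derAt (i : I) (j : J) : M j →ₗ[ℂ] M j :=
  if h : α i = j then (M j).der ⟨i, h⟩ else LinearMap.id

/-- Auxiliary: `∂_i` acting on `A ⊗_ℂ (⨂_ℂ M_j)`. -/
noncomputable def boxDer' (i : I) : (SX f (FinNEq.ker α) ⊗[ℂ] (⨂[ℂ] j, M j)) →ₗ[ℂ]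
    (SX f (FinNEq.ker α) ⊗[ℂ] (⨂[ℂ] j, M j)) :=
  TensorProduct.map (SX.der (I := FinNEq.ker α) i : Derivation ℂ _ _).toLinearMap LinearMap.id +
    TensorProduct.map LinearMap.id (PiTensorProduct.map (derAt α M i))

theorem boxDer'_tmul (i : I) (s : SX f (FinNEq.ker α)) (x : ⨂[ℂ] j, M j) :
    boxDer' α M i (s ⊗ₜ x) = SX.der (I := FinNEq.ker α) i s ⊗ₜ x +
      s ⊗ₜ PiTensorProduct.map (derAt α M i) x := rfl

theorem boxDer'_smul (i : I) (s : SX f (FinNEq.ker α))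
    (x : SX f (FinNEq.ker α) ⊗[ℂ] (⨂[ℂ] j, M j)) :
    boxDer' α M i (s • x) = SX.der (I := FinNEq.ker α) i s • x + s • boxDer' α M i x := by
  induction x using TensorProduct.induction_on with
  | zero => simp
  | tmul a m =>
    simp only [TensorProduct.smul_tmul', boxDer'_tmul, smul_add, smul_eq_mul, Derivation.leibniz,
      TensorProduct.add_tmul]
    rw [mul_comm a]
    abel
  | add x y hx hy => simp only [smul_add, map_add, hx, hy]; abel

theorem derAt_comm (i i' : I) (j : J) :
    derAt α M i j ∘ₗ derAt α M i' j = derAt α M i' j ∘ₗ derAt α M i j := by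
  unfold derAt
  split_ifs
  · ext m; exact (M j).der_comm _ _ m
  all_goals rfl

theorem boxDer'_comm (i i' : I) (x : SX f (FinNEq.ker α) ⊗[ℂ] (⨂[ℂ] j, M j)) :
    boxDer' α M i (boxDer' α M i' x) = boxDer' α M i' (boxDer' α M i x) := by
  induction x using TensorProduct.induction_on with
  | zero => simp
  | tmul a m =>
    have h : PiTensorProduct.map (derAt α M i) (PiTensorProduct.map (derAt α M i') m) =
        PiTensorProduct.map (derAt α M i') (PiTensorProduct.map (derAt α M i) m) := by
      rw [← LinearMap.comp_apply, ← LinearMap.comp_apply, ← PiTensorProduct.map_comp,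
        ← PiTensorProduct.map_comp]
      simp only [derAt_comm]
    simp only [boxDer'_tmul, map_add, h]
    rw [SX.der_comm (I := FinNEq.ker α) i i' a]
    abel
  | add x y hx hy => simp only [map_add, hx, hy]

theorem der_fiberIncl (k : FinSet.fiber α j₀) (r : SX f (FinSet.fiber α j₀).toNEq) :
    SX.der (I := FinNEq.ker α) k.1 (SX.map (FinNEq.fiberIncl α j₀) r) =
      SX.map (FinNEq.fiberIncl α j₀) (SX.der (I := (FinSet.fiber α j₀).toNEq) k r) := by
  have h : FinNEq.preim (FinNEq.fiberIncl α j₀) k.1 = {k} := by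
    ext l
    rw [FinNEq.mem_preim, Finset.mem_singleton]
    exact Subtype.ext_iff.symm
  rw [SX.der_map, h, Finset.sum_singleton]

theorem der_fiberIncl_of_ne (i : I) (h : α i ≠ j₀) (r : SX f (FinSet.fiber α j₀).toNEq) :
    SX.der (I := FinNEq.ker α) i (SX.map (FinNEq.fiberIncl α j₀) r) = 0 := by
  rw [SX.der_map, Finset.sum_eq_zero, map_zero]
  intro k hk
  refine absurd ?_ h
  rw [← show k.1 = i from (FinNEq.mem_preim _ _ _).1 hk]
  exact k.2

theorem boxDer'_mem (i : I) (x : SX f (FinNEq.ker α) ⊗[ℂ] (⨂[ℂ] j, M j))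
    (hx : x ∈ boxRels α M) : boxDer' α M i x ∈ boxRels α M := by
  classical
  unfold boxRels boxRel at hx
  induction hx using Submodule.span_induction with
  | zero => rw [map_zero]; exact zero_mem _
  | add x y _ _ hx hy => rw [map_add]; exact add_mem hx hy
  | smul a x hx' hx =>
    rw [boxDer'_smul]
    exact add_mem (Submodule.smul_mem _ _ hx') (Submodule.smul_mem _ _ hx)
  | mem x hx =>
    obtain ⟨k, m, r, rfl⟩ := hx
    have rel : ∀ (m : ∀ j, M j) (r : SX f (FinSet.fiber α k).toNEq),
        ((1 : SX f (FinNEq.ker α)) ⊗ₜ[ℂ] PiTensorProduct.tprod ℂ (Function.update m k (r • m k)) -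
          SX.map (FinNEq.fiberIncl α k) r ⊗ₜ[ℂ] PiTensorProduct.tprod ℂ m) ∈ boxRels α M :=
      fun m r => Submodule.subset_span ⟨k, m, r, by congr!⟩
    rw [map_sub, boxDer'_tmul, boxDer'_tmul, Derivation.map_one_eq_zero, TensorProduct.zero_tmul,
      zero_add, PiTensorProduct.map_tprod, PiTensorProduct.map_tprod]
    by_cases h : α i = k
    · rw [der_fiberIncl α ⟨i, h⟩]
      have e : (fun j => derAt α M i j (Function.update m k (r • m k) j)) =
          Function.update (fun j => derAt α M i j (m j)) k
            (SX.der (I := (FinSet.fiber α k).toNEq) ⟨i, h⟩ r • m k + r • derAt α M i k (m k)) := by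
        funext j
        by_cases hj : j = k
        · subst hj
          simp only [Function.update_self, derAt, dif_pos h]
          exact (M j).der_smul _ _ _
        · simp only [Function.update_of_ne hj]
      have e' : Function.update (fun j => derAt α M i j (m j)) k
          (SX.der (I := (FinSet.fiber α k).toNEq) ⟨i, h⟩ r • m k) =
          Function.update m k (SX.der (I := (FinSet.fiber α k).toNEq) ⟨i, h⟩ r • m k) := by
        funext j
        by_cases hj : j = k
        · subst hj; simp
        · have : α i ≠ j := fun h' => hj (h'.symm.trans h)
          simp only [Function.update_of_ne hj, derAt, dif_neg this]
          rfl
      rw [e, MultilinearMap.map_update_add, e', TensorProduct.tmul_add]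
      have := add_mem (rel m (SX.der (I := (FinSet.fiber α k).toNEq) ⟨i, h⟩ r))
        (rel (fun j => derAt α M i j (m j)) r)
      convert this using 1
      abel
    · rw [der_fiberIncl_of_ne α i h, TensorProduct.zero_tmul, zero_add]
      have e : (fun j => derAt α M i j (Function.update m k (r • m k) j)) =
          Function.update (fun j => derAt α M i j (m j)) k (r • derAt α M i k (m k)) := by
        funext j
        by_cases hj : j = k
        · subst hj
          simp only [Function.update_self, derAt, dif_neg h]
          rfl
        · simp only [Function.update_of_ne hj]
      rw [e]
      exact rel _ r

/-- The `D`-module `j(α)^*(⊠_j M_j)` on `U(α)`, that is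
`S_X(U(α)) ⊗_{⨂_j S_X(I_j)} (⨂_j M_j)`; the fields `∂_i` act by the Leibniz rule. -/
noncomputable def box : DMod.{u} f (FinNEq.ker α) where
  carrier := (SX f (FinNEq.ker α) ⊗[ℂ] (⨂[ℂ] j, M j)) ⧸ boxRels α M
  der i := (Submodule.Quotient.restrictScalarsEquiv ℂ (boxRels α M)).toLinearMap ∘ₗ
    ((boxRels α M).restrictScalars ℂ).mapQ ((boxRels α M).restrictScalars ℂ) (boxDer' α M i)
      (boxDer'_mem α M i) ∘ₗ
    (Submodule.Quotient.restrictScalarsEquiv ℂ (boxRels α M)).symm.toLinearMap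
  der_smul i s x := by
    obtain ⟨x, rfl⟩ := Submodule.Quotient.mk_surjective _ x
    exact congrArg (Submodule.Quotient.mk (p := boxRels α M)) (boxDer'_smul α M i s x)
  der_comm i i' x := by
    obtain ⟨x, rfl⟩ := Submodule.Quotient.mk_surjective _ x
    exact congrArg (Submodule.Quotient.mk (p := boxRels α M)) (boxDer'_comm α M i i' x)

variable {M}

/-- The section `⊠_j m_j`. -/
noncomputable def boxMk (m : ∀ j, M j) : box α M :=
  Submodule.Quotient.mk (1 ⊗ₜ PiTensorProduct.tprod ℂ m)

end DMod
/-! ## Factorization algebras -/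

/-- The objects of `fSet`: non-empty finite sets. Morphisms are the surjections. -/
structure NFinSet extends FinSet where
  [nonempty : Nonempty carrier]

instance : CoeSort NFinSet Type := ⟨fun I => I.carrier⟩

attribute [instance] NFinSet.nonempty

/-- The fibres of a surjection. -/
abbrev NFinSet.fiber {I J : NFinSet} (α : I → J) (hα : Function.Surjective α) (j : J) : NFinSet :=
  { toFinSet := FinSet.fiber (I := I.toFinSet) (J := J.toFinSet) α j
    nonempty := ⟨⟨(hα j).choose, (hα j).choose_spec⟩⟩ }

/-- For `α : I → J` and `β : J → K`, the induced map `α_k : I_k → J_k` of fibres over `k`. -/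
def fiberMap {I J K : NFinSet} (α : I → J) (β : J → K) (k : K)
    (i : FinSet.fiber (I := I.toFinSet) (J := K.toFinSet) (β ∘ α) k) :
    FinSet.fiber (I := J.toFinSet) (J := K.toFinSet) β k :=
  ⟨α i.1, i.2⟩

theorem fiberMap_surjective {I J K : NFinSet} {α : I → J} (hα : Function.Surjective α)
    (β : J → K) (k : K) : Function.Surjective (fiberMap α β k) := by
  rintro ⟨j, hj⟩
  obtain ⟨i, rfl⟩ := hα j
  exact ⟨⟨i, hj⟩, rfl⟩

/-- The identification of the fibre of `α` over `j ∈ J_k` with the fibre of `α_k` over `j`. -/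
def fiberFiber {I J K : NFinSet} (α : I → J) (β : J → K) (k : K)
    (j : FinSet.fiber (I := J.toFinSet) (J := K.toFinSet) β k)
    (i : FinSet.fiber (I := I.toFinSet) (J := J.toFinSet) α j.1) :
    FinSet.fiber (I := FinSet.fiber (I := I.toFinSet) (J := K.toFinSet) (β ∘ α) k)
      (J := FinSet.fiber (I := J.toFinSet) (J := K.toFinSet) β k) (fiberMap α β k) j :=
  ⟨⟨i.1, (congrArg β i.2).trans j.2⟩, Subtype.ext i.2⟩

theorem fiberFiber_surjective {I J K : NFinSet} (α : I → J) (β : J → K) (k : K)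
    (j : FinSet.fiber (I := J.toFinSet) (J := K.toFinSet) β k) :
    Function.Surjective (fiberFiber α β k j) := by
  rintro ⟨⟨i, hi⟩, h⟩
  exact ⟨⟨i, congrArg Subtype.val h⟩, rfl⟩

/-- The data of a factorization algebra on `X = {f ≠ 0} ⊆ 𝔸¹`: left `D`-modules `B_{X^I}` with
Ran isomorphisms `ν_α : Δ(α)^* B_{X^I} ≅ B_{X^J}` and factorization isomorphisms
`d_α : j(α)^* (⊠_j B_{X^{I_j}}) ≅ j(α)^* B_{X^I}`. -/
structure FactorizationData (f : ℂ[X]) where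
  obj (I : NFinSet) : DMod.{u} f I.toNEq
  ran {I J : NFinSet} (α : I → J) (hα : Function.Surjective α) :
    (obj I).pull (FinNEq.ofFun α) ≅ obj J
  fact {I J : NFinSet} (α : I → J) (hα : Function.Surjective α) :
    DMod.box (I := I.toFinSet) (J := J.toFinSet) α (fun j => obj (NFinSet.fiber α hα j)) ≅
      (obj I).on (I := FinNEq.ker α)

namespace FactorizationData

variable (B : FactorizationData.{u} f) {I J : NFinSet} (α : I → J) (hα : Function.Surjective α)

/-- The map `b ↦ ν_α(1 ⊗ b)` on sections. -/
noncomputable def nu : DMod.SemiHom (FinNEq.ofFun α) (B.obj I) (B.obj J) :=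
  DMod.Hom.semi (B.ran α hα).hom

/-- The section `d_α(⊠_j b_j)`. -/
noncomputable def d (b : ∀ j : J, B.obj (NFinSet.fiber α hα j)) :
    (B.obj I).on (I := FinNEq.ker α) :=
  (B.fact α hα).hom.toLin (DMod.boxMk α b)

end FactorizationData

/-- A (not necessarily unital) factorization algebra on `X`. -/
structure FactorizationAlgebra (f : ℂ[X]) extends FactorizationData.{u} f where
  /-- There are no non-zero sections supported on the diagonal divisor. -/
  eq_zero_of_res : ∀ {I : NFinSet} (b : obj I), DMod.res (I := ⟨I.toFinSet, ⊥⟩) b = 0 → b = 0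
  /-- `ν_{β ∘ α} = ν_β ∘ Δ(β)^* ν_α`. -/
  nu_comp : ∀ {I J K : NFinSet} (α : I → J) (β : J → K) (hα : Function.Surjective α)
    (hβ : Function.Surjective β) (b : obj I),
    toFactorizationData.nu (β ∘ α) (hβ.comp hα) b =
      toFactorizationData.nu β hβ (toFactorizationData.nu α hα b)
  /-- `d_α = d_{β ∘ α} ∘ (⊠_k d_{α_k})` on `U(α)`. As the `d_{α_k}(⊠ b_j)` are only sections on
  `U(α_k)`, the equation is written after clearing denominators `s_k`. -/
  d_comp : ∀ {I J K : NFinSet} (α : I → J) (β : J → K) (hα : Function.Surjective α)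
    (hβ : Function.Surjective β) (b : ∀ j : J, obj (NFinSet.fiber α hα j))
    (s : ∀ k : K, SX f (NFinSet.fiber (β ∘ α) (hβ.comp hα) k).toNEq)
    (c : ∀ k : K, obj (NFinSet.fiber (β ∘ α) (hβ.comp hα) k)),
    (∀ k : K, SX.map (FinNEq.toSelf (FinNEq.ker (fiberMap α β k))) (s k) •
      toFactorizationData.d (I := NFinSet.fiber (β ∘ α) (hβ.comp hα) k)
        (J := NFinSet.fiber β hβ k) (fiberMap α β k) (fiberMap_surjective hα β k)
        (fun j => toFactorizationData.nu (I := NFinSet.fiber α hα j.1)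
          (fiberFiber α β k j) (fiberFiber_surjective α β k j) (b j.1)) =
      DMod.res (I := FinNEq.ker (fiberMap α β k)) (c k)) →
    DMod.resTo (r := Setoid.ker (β ∘ α)) (r' := Setoid.ker α) (fun _ _ h => congrArg β h) (obj I)
        (toFactorizationData.d (β ∘ α) (hβ.comp hα) c) =
      (∏ᶠ k : K, SX.map (FinNEq.fromTop (J := FinNEq.ker α) Subtype.val) (s k)) •
        toFactorizationData.d α hα b
  /-- The restriction of `d_{β ∘ α}` along `Δ(α)` is identified with `d_β` by the `ν`. -/
  nu_d : ∀ {I J K : NFinSet} (α : I → J) (β : J → K) (hα : Function.Surjective α)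
    (hβ : Function.Surjective β) (b : ∀ k : K, obj (NFinSet.fiber (β ∘ α) (hβ.comp hα) k)),
    DMod.SemiHom.on (I := FinNEq.ker (β ∘ α)) (J := FinNEq.ker β)
        (FinNEq.Hom.mk α fun _ _ h => h) (toFactorizationData.nu α hα)
        (toFactorizationData.d (β ∘ α) (hβ.comp hα) b) =
      toFactorizationData.d β hβ (fun k => toFactorizationData.nu
        (I := NFinSet.fiber (β ∘ α) (hβ.comp hα) k) (J := NFinSet.fiber β hβ k)
        (fiberMap α β k) (fiberMap_surjective hα β k) (b k))

/-- The one-element set. -/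
abbrev NFinSet.one : NFinSet := { carrier := Unit }

/-- The two-element set. -/
abbrev NFinSet.two : NFinSet := { carrier := Fin 2 }

/-- The map from `I` to the one-element set. -/
def NFinSet.toOne (I : NFinSet) : I → NFinSet.one := fun _ => ()

theorem NFinSet.toOne_surjective (I : NFinSet) : Function.Surjective (NFinSet.toOne I) :=
  fun _ => ⟨Classical.arbitrary I, rfl⟩

/-- A unital factorization algebra on `X`: a factorization algebra `B` with a map `u : 𝒪 → B` of
factorization algebras such that for every section `b` of `B_X`, the section `1 ⊗ b` of
`j_* j^* (B_X ⊠ B_X) ≅ j_* j^* B_{X²}` belongs to `B_{X²}`, and restricts to `b` on the diagonal. -/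
structure UnitalFactorizationAlgebra (f : ℂ[X]) extends FactorizationAlgebra.{u} f where
  unit (I : NFinSet) : SX f I.toNEq →ₗ[SX f I.toNEq] obj I
  unit_der : ∀ {I : NFinSet} (i : I) (s : SX f I.toNEq),
    unit I (SX.der (I := I.toNEq) i s) = (obj I).der i (unit I s)
  unit_nu : ∀ {I J : NFinSet} (α : I → J) (hα : Function.Surjective α) (s : SX f I.toNEq),
    toFactorizationData.nu α hα (unit I s) = unit J (SX.map (FinNEq.ofFun α) s)
  /-- For `𝒪`, the factorization isomorphism sends `⊠_j s_j` to the product of the `s_j`. -/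
  unit_d : ∀ {I J : NFinSet} (α : I → J) (hα : Function.Surjective α)
    (s : ∀ j : J, SX f (NFinSet.fiber α hα j).toNEq),
    toFactorizationData.d α hα (fun j => unit _ (s j)) =
      (∏ᶠ j : J, SX.map (FinNEq.fiberIncl (I := I.toFinSet) (J := J.toFinSet) α j) (s j)) •
        DMod.res (I := FinNEq.ker α) (unit I 1)
  /-- The family `c` over the two fibres of the identity of `{0, 1}` is `(1, b)`. -/
  unit_tmul : ∀ c : ∀ j : NFinSet.two,
      obj (NFinSet.fiber (I := NFinSet.two) (J := NFinSet.two) id Function.surjective_id j),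
    c 0 = unit _ 1 →
    ∃ c' : obj NFinSet.two,
      toFactorizationData.d (I := NFinSet.two) (J := NFinSet.two) id Function.surjective_id c =
        DMod.res (I := FinNEq.ker id) c' ∧
      toFactorizationData.nu _ (NFinSet.toOne_surjective _) c' =
        toFactorizationData.nu _ (NFinSet.toOne_surjective _) (c 1)

namespace UnitalFactorizationAlgebra

/-- Morphisms of unital factorization algebras: maps of `D`-modules compatible with the `ν_α`,
the `d_α`, and the units. -/
@[ext]
structure Hom (B C : UnitalFactorizationAlgebra.{u} f) where
  app (I : NFinSet) : B.obj I ⟶ C.obj I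
  nu : ∀ {I J : NFinSet} (α : I → J) (hα : Function.Surjective α) (b : B.obj I),
    (app J).toLin (B.nu α hα b) = C.nu α hα ((app I).toLin b)
  d : ∀ {I J : NFinSet} (α : I → J) (hα : Function.Surjective α)
    (b : ∀ j : J, B.obj (NFinSet.fiber α hα j)),
    DMod.onMap (I := FinNEq.ker α) (app I) (B.d α hα b) =
      C.d α hα (fun j => (app _).toLin (b j))
  unit : ∀ (I : NFinSet) (s : SX f I.toNEq), (app I).toLin (B.unit I s) = C.unit I s

/-- The category `FA(X)` of unital factorization algebras on `X = {f ≠ 0} ⊆ 𝔸¹`. -/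
noncomputable instance : Category (UnitalFactorizationAlgebra.{u} f) where
  Hom := Hom
  id B :=
    { app := fun I => 𝟙 _
      nu := fun _ _ _ => rfl
      d := fun _ _ _ => DMod.onMap_id _ _
      unit := fun _ _ => rfl }
  comp φ ψ :=
    { app := fun I => φ.app I ≫ ψ.app I
      nu := fun α hα b =>
        (congrArg (ψ.app _).toLin (φ.nu α hα b)).trans (ψ.nu α hα _)
      d := fun α hα b =>
        ((DMod.onMap_comp _ _ _).trans (congrArg _ (φ.d α hα b))).trans (ψ.d α hα _)
      unit := fun I s => (congrArg (ψ.app _).toLin (φ.unit I s)).trans (ψ.unit I s) }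

end UnitalFactorizationAlgebra

/-! ## `(A, H, S_X)`-vertex algebras -/

/-- The objects of `Fun(Fin^≢, A, T, S_X)`, for `A` the category of complex vector spaces: functors
on `Fin^≢` with compatible actions of `T` and `S_X`. -/
structure SFun (f : ℂ[X]) where
  obj (I : FinNEq) : DMod.{u} f I
  map {I J : FinNEq} (α : I ⟶ J) : DMod.SemiHom α (obj I) (obj J)
  map_id : ∀ (I : FinNEq) (v : obj I), map (𝟙 I) v = v
  map_comp : ∀ {I J K : FinNEq} (α : I ⟶ J) (β : J ⟶ K) (v : obj I),
    map (α ≫ β) v = map β (map α v)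

/-- The objects of `Fun(Fin, A, T, S_X)`. -/
structure SFunFin (f : ℂ[X]) where
  obj (I : FinSet) : DMod.{u} f I.toNEq
  map {I J : FinSet} (α : I → J) : DMod.SemiHom (FinNEq.ofFun α) (obj I) (obj J)
  map_id : ∀ (I : FinSet) (v : obj I), map (id : I → I) v = v
  map_comp : ∀ {I J K : FinSet} (α : I → J) (β : J → K) (v : obj I),
    map (β ∘ α) v = map β (map α v)

/-- The embedding of `Fun(Fin, A, T, S_X)` into `Fun(Fin^≢, A, T, S_X)`:
`V(I₁ : ⋯ : I_n) = V(I₁, …, I_n) ⊗ S_X(I₁ : ⋯ : I_n)` over `S_X(I₁, …, I_n)`. -/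
noncomputable def SFunFin.ext (V : SFunFin.{u} f) : SFun.{u} f where
  obj I := (V.obj I.set).on
  map {I J} α := DMod.SemiHom.on α (V.map α.toFun)
  map_id I v := by
    induction v using DMod.pull_induction with
    | zero => exact map_zero (DMod.SemiHom.on (𝟙 I) (V.map (𝟙 I : I ⟶ I).toFun)).toFun
    | tmul s m =>
      change DMod.tmul I.toSelf (SX.map (𝟙 I) s) (V.map id m) = _
      rw [SX.map_id, V.map_id]
    | add x y hx hy => rw [map_add, hx, hy]
  map_comp {I J K} α β v := by
    induction v using DMod.pull_induction with
    | zero => simp only [map_zero]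
    | tmul s m =>
      change DMod.tmul K.toSelf (SX.map (α ≫ β) s) (V.map (β.toFun ∘ α.toFun) m) =
        DMod.tmul K.toSelf (SX.map β (SX.map α s)) (V.map β.toFun (V.map α.toFun m))
      rw [SX.map_comp, V.map_comp]
    | add x y hx hy => simp only [map_add, hx, hy]

/-- The element `1 ⊗ v` of `V(I)`, for `v` in the value of `V` on the underlying set of `I`. -/
noncomputable def SFunFin.extRes (V : SFunFin.{u} f) {I : FinNEq} (v : V.obj I.set) :
    V.ext.obj I :=
  DMod.res v

/-- The extension `s ⊗ v ↦ s ⊗ h(v)` to `Fin^≢` of a map of the values on the underlying set. -/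
noncomputable def SFunFin.extMap {V W : SFunFin.{u} f} {I : FinNEq}
    (h : V.obj I.set ⟶ W.obj I.set) : V.ext.obj I →ₗ[ℂ] W.ext.obj I :=
  DMod.onMap h

theorem SFunFin.extMap_id (V : SFunFin.{u} f) {I : FinNEq} (v : V.ext.obj I) :
    SFunFin.extMap (𝟙 (V.obj I.set)) v = v :=
  DMod.onMap_id _ v

theorem SFunFin.extMap_comp {V W Z : SFunFin.{u} f} {I : FinNEq} (g : V.obj I.set ⟶ W.obj I.set)
    (h : W.obj I.set ⟶ Z.obj I.set) (v : V.ext.obj I) :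
    SFunFin.extMap (g ≫ h) v = SFunFin.extMap h (SFunFin.extMap g v) :=
  DMod.onMap_comp g h v

namespace FinNEq

/-- The disjoint union `I ⊔ J`, with the disjoint union of the equivalence relations. -/
abbrev sum (I J : FinNEq) : FinNEq where
  set := { carrier := I ⊕ J }
  rel :=
    { r := Sum.LiftRel I.rel J.rel
      iseqv :=
        { refl := by
            rintro (i | j)
            · exact .inl (I.rel.refl' i)
            · exact .inr (J.rel.refl' j)
          symm := by
            rintro _ _ (h | h)
            · exact .inl (I.rel.symm' h)
            · exact .inr (J.rel.symm' h)
          trans := by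
            rintro _ _ _ (h | h) (h' | h')
            · exact .inl (I.rel.trans' h h')
            · exact .inr (J.rel.trans' h h') } }

/-- The inclusion `I → I ⊔ J`. -/
def inl (I J : FinNEq) : I ⟶ I.sum J :=
  Hom.mk Sum.inl fun _ _ h => Sum.liftRel_inl_inl.1 h

/-- The inclusion `J → I ⊔ J`. -/
def inr (I J : FinNEq) : J ⟶ I.sum J :=
  Hom.mk Sum.inr fun _ _ h => Sum.liftRel_inr_inr.1 h

/-- The map `α ⊔ β : I ⊔ J → I' ⊔ J'`. -/
def sumMap {I J I' J' : FinNEq} (α : I ⟶ I') (β : J ⟶ J') : I.sum J ⟶ I'.sum J' :=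
  Hom.mk (Sum.map α.toFun β.toFun) (by
    rintro (i | j) (i' | j') h <;> cases h <;> constructor
    · exact α.map_rel _ _ ‹_›
    · exact β.map_rel _ _ ‹_›)

/-- The symmetry `I ⊔ J → J ⊔ I`. -/
def sumSwap (I J : FinNEq) : I.sum J ⟶ J.sum I :=
  Hom.mk Sum.swap (by
    rintro (i | j) (i' | j') h <;> cases h <;> constructor <;> assumption)

/-- The associativity `(I ⊔ J) ⊔ K → I ⊔ (J ⊔ K)`. -/
def sumAssoc (I J K : FinNEq) : (I.sum J).sum K ⟶ I.sum (J.sum K) :=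
  Hom.mk (Equiv.sumAssoc I J K) (by
    rintro ((i | j) | k) ((i' | j') | k') h <;>
      change Sum.LiftRel I.rel (Sum.LiftRel J.rel K.rel) _ _ at h <;>
      change Sum.LiftRel (Sum.LiftRel I.rel J.rel) K.rel _ _ <;>
      simp_all)

end FinNEq

/-- A morphism `V ⊙ W → Z` in `Fun(Fin^≢, A, T, S_X)` from the singular tensor product, in terms of
the universal property that defines `V ⊙ W`: maps `V(I) ⊗ W(J) → Z(I ⊔ J)`, functorial in `I` and
`J`, that commute with the actions of `S_X(I)`, `S_X(J)`, `T(I)` and `T(J)`. -/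
@[ext]
structure SingMap (V W Z : SFun.{u} f) where
  toFun (I J : FinNEq) : V.obj I →ₗ[ℂ] W.obj J →ₗ[ℂ] Z.obj (I.sum J)
  smul_left : ∀ {I J : FinNEq} (s : SX f I) (v : V.obj I) (w : W.obj J),
    toFun I J (s • v) w = SX.map (FinNEq.inl I J) s • toFun I J v w
  smul_right : ∀ {I J : FinNEq} (s : SX f J) (v : V.obj I) (w : W.obj J),
    toFun I J v (s • w) = SX.map (FinNEq.inr I J) s • toFun I J v w
  der_left : ∀ {I J : FinNEq} (i : I) (v : V.obj I) (w : W.obj J),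
    toFun I J ((V.obj I).der i v) w = (Z.obj (I.sum J)).der (Sum.inl i) (toFun I J v w)
  der_right : ∀ {I J : FinNEq} (j : J) (v : V.obj I) (w : W.obj J),
    toFun I J v ((W.obj J).der j w) = (Z.obj (I.sum J)).der (Sum.inr j) (toFun I J v w)
  natural : ∀ {I J I' J' : FinNEq} (α : I ⟶ I') (β : J ⟶ J') (v : V.obj I) (w : W.obj J),
    Z.map (FinNEq.sumMap α β) (toFun I J v w) = toFun I' J' (V.map α v) (W.map β w)

/-- The empty set. -/
abbrev FinSet.empty : FinSet := { carrier := Empty }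

/-- A (unital) `(A, H, S_X)`-vertex algebra: a commutative ring object for `⊙` whose underlying
object belongs to `Fun(Fin, A, T, S_X)`. The unit is an element of `V(∅)`; the corresponding map
`S_X → V` sends `s ∈ S_X(I)` to `s` times the image of the unit in `V(I)`. -/
structure AHSVertexAlgebra (f : ℂ[X]) extends SFunFin.{u} f where
  mul : SingMap toSFunFin.ext toSFunFin.ext toSFunFin.ext
  mul_comm : ∀ {I J : FinNEq} (v : toSFunFin.ext.obj I) (w : toSFunFin.ext.obj J),
    toSFunFin.ext.map (FinNEq.sumSwap I J) (mul.toFun I J v w) = mul.toFun J I w v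
  mul_assoc : ∀ {I J K : FinNEq} (v : toSFunFin.ext.obj I) (w : toSFunFin.ext.obj J)
    (z : toSFunFin.ext.obj K),
    toSFunFin.ext.map (FinNEq.sumAssoc I J K) (mul.toFun (I.sum J) K (mul.toFun I J v w) z) =
      mul.toFun I (J.sum K) v (mul.toFun J K w z)
  one : obj FinSet.empty
  one_mul : ∀ {J : FinNEq} (v : toSFunFin.ext.obj J),
    mul.toFun FinSet.empty.toNEq J (toSFunFin.extRes one) v =
      toSFunFin.ext.map (FinNEq.inr FinSet.empty.toNEq J) v

namespace AHSVertexAlgebra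

/-- Morphisms of `(A, H, S_X)`-vertex algebras: natural transformations that respect the actions of
`T` and `S_X`, the singular multiplication, and the unit. -/
@[ext]
structure Hom (V W : AHSVertexAlgebra.{u} f) where
  app (I : FinSet) : V.obj I ⟶ W.obj I
  natural : ∀ {I J : FinSet} (α : I → J) (v : V.obj I),
    (app J).toLin (V.map α v) = W.map α ((app I).toLin v)
  mul : ∀ {I J : FinNEq} (v : V.ext.obj I) (w : V.ext.obj J),
    SFunFin.extMap (app (I.sum J).set) (V.mul.toFun I J v w) =
      W.mul.toFun I J (SFunFin.extMap (app I.set) v) (SFunFin.extMap (app J.set) w)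
  one : (app FinSet.empty).toLin V.one = W.one

/-- The category `VA(A, H, S_X)`, for `X = {f ≠ 0} ⊆ 𝔸¹`. -/
noncomputable instance : Category (AHSVertexAlgebra.{u} f) where
  Hom := Hom
  id V :=
    { app := fun I => 𝟙 _
      natural := fun _ _ => rfl
      mul := fun {I J} v w => by
        rw [SFunFin.extMap_id, SFunFin.extMap_id, SFunFin.extMap_id]
      one := rfl }
  comp φ ψ :=
    { app := fun I => φ.app I ≫ ψ.app I
      natural := fun α v =>
        (congrArg (ψ.app _).toLin (φ.natural α v)).trans (ψ.natural α _)
      mul := fun {I J} v w => by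
        rw [SFunFin.extMap_comp, SFunFin.extMap_comp, SFunFin.extMap_comp, φ.mul, ψ.mul]
      one := (congrArg (ψ.app _).toLin φ.one).trans ψ.one }

end AHSVertexAlgebra

/-! ## Decompositions into two parts -/

/-- The disjoint union of non-empty finite sets. -/
abbrev NFinSet.sum (I J : NFinSet) : NFinSet where
  carrier := I ⊕ J

/-- The map `I ⊔ J → {0, 1}` with fibres `I` and `J`. -/
def NFinSet.part (I J : NFinSet) : NFinSet.sum I J → NFinSet.two :=
  Sum.elim (fun _ => (0 : Fin 2)) (fun _ => (1 : Fin 2))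

theorem NFinSet.part_surjective (I J : NFinSet) : Function.Surjective (NFinSet.part I J) := by
  intro j
  change Fin 2 at j
  fin_cases j
  · exact ⟨Sum.inl (Classical.arbitrary I), rfl⟩
  · exact ⟨Sum.inr (Classical.arbitrary J), rfl⟩

/-- The bijection from `I` to the fibre of `I ⊔ J → {0, 1}` over `0`. -/
def NFinSet.toPart₀ (I J : NFinSet) (i : I) :
    NFinSet.fiber (NFinSet.part I J) (NFinSet.part_surjective I J) (0 : Fin 2) :=
  ⟨Sum.inl i, rfl⟩

/-- The bijection from `J` to the fibre of `I ⊔ J → {0, 1}` over `1`. -/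
def NFinSet.toPart₁ (I J : NFinSet) (j : J) :
    NFinSet.fiber (NFinSet.part I J) (NFinSet.part_surjective I J) (1 : Fin 2) :=
  ⟨Sum.inr j, rfl⟩

theorem NFinSet.toPart₀_surjective (I J : NFinSet) :
    Function.Surjective (NFinSet.toPart₀ I J) := by
  rintro ⟨i | j, h⟩
  · exact ⟨i, rfl⟩
  · exact absurd h (by simp [NFinSet.part])

theorem NFinSet.toPart₁_surjective (I J : NFinSet) :
    Function.Surjective (NFinSet.toPart₁ I J) := by
  rintro ⟨i | j, h⟩
  · exact absurd h (by simp [NFinSet.part])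
  · exact ⟨j, rfl⟩

theorem NFinSet.sum_rel_le (I J : NFinSet) :
    (FinNEq.sum I.toNEq J.toNEq).rel ≤ Setoid.ker (NFinSet.part I J) := by
  rintro (i | j) (i' | j') h
  · rfl
  · cases h
  · cases h
  · rfl

/-- The family `(b, c)` of sections over the two fibres of `I ⊔ J → {0, 1}`. -/
noncomputable def FactorizationData.pair (B : FactorizationData.{u} f) {I J : NFinSet}
    (b : B.obj I) (c : B.obj J) :
    ∀ j : NFinSet.two, B.obj (NFinSet.fiber (NFinSet.part I J) (NFinSet.part_surjective I J) j)
  | (0 : Fin 2) => B.nu (NFinSet.toPart₀ I J) (NFinSet.toPart₀_surjective I J) b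
  | (1 : Fin 2) => B.nu (NFinSet.toPart₁ I J) (NFinSet.toPart₁_surjective I J) c

/-- The section `d_α(b ⊠ c)` on `U(α)`, for the decomposition `α : I ⊔ J → {0, 1}` and sections `b`
of `B_{X^I}` and `c` of `B_{X^J}`. -/
noncomputable def FactorizationData.d₂ (B : FactorizationData.{u} f) {I J : NFinSet}
    (b : B.obj I) (c : B.obj J) :
    (B.obj (NFinSet.sum I J)).on (I := FinNEq.sum I.toNEq J.toNEq) :=
  DMod.resTo (NFinSet.sum_rel_le I J) (B.obj (NFinSet.sum I J))
    (B.d (NFinSet.part I J) (NFinSet.part_surjective I J) (B.pair b c))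

end AHS

open AHS

/-! Off all diagonals a factorization algebra is made of its sections over one point. Over that open
set the sections of `B_{X^K}` are spanned, over functions, by the products `gen K m` of sections `m
k` of `B_X`, and a global section is determined by its restriction to it. Call a global section pure
(`IsPure`) if it restricts there to a function times some `gen K m`. Up to denominators, every
section is a sum of pure ones (`pure_induction`). Hence two additive maps, semilinear over functions
and with values that have no torsion along diagonals, agree once they agree on pure sections
(`pure_ext`). On these, `resTo_d` computes each `d_α`: scalars are multiplied and families are
juxtaposed, so that most identities reduce to equalities of families indexed by finite sets.

The main point is the map attached to an inclusion `I → I ⊔ J`: the section `d_α(b ⊠ 1)`, given on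
`U(α)`, has to extend to `X^{I ⊔ J}`. A Hartogs type argument (`exists_res_of_forall_pair`) shows
that a section off the diagonals is global if it extends over the generic point of each diagonal
`x_i = x_j`. Indeed a section killed by the restriction `ν` to this diagonal is divisible by `x_i -
x_j`, and the module on the diagonal again has no sections supported on its own diagonals. Near the
generic point of a diagonal with `i ∈ I` and `j ∈ J`, only the factor `m i ⊠ 1` matters, and it
extends by the unit axiom. The result is `extVac`.

An arbitrary map `α : I → J` is the inclusion `I → I ⊔ J` followed by the surjection `[α, id]`,
which defines `vmap α` as `ν ∘ extVac`. The second half of the unit axiom, that `1 ⊠ b` restricts to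
`b`, gives `nu_fold_extVac`, i.e. `vmap id = id`. From it and from the behaviour of `extVac` under
bijections and surjections follow `vmap_of_surjective` and `vmap_comp`.

The multiplication is `d₂`, extended to all `U(I)` by linearity over functions (`Pairing.on`).
Commutativity (`vmapOn_swap_d₂`) and associativity (`vmapOn_assoc_mulOn`) are checked on pure
sections. Naturality (`vmapOn_sum_map_d₂`) combines the axiom `nu_d` for surjections with a
computation on pure sections for the insertion of units.

Finally `V(∅)` is `S_X(∅) = ℂ`, and everything that involves `∅` is forced by the unit laws. The
data are indexed by a decision `FinSet.Cases`; statements are proved for arbitrary decisions, which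
can be destructed, and only at the end is `FinSet.cases` inserted. -/

namespace AHS

variable {f : ℂ[X]}

/-! ## Restriction of sections to open subsets -/

/-- The restriction of functions from `X^I` to the open subset `U(I, r)`. -/
noncomputable abbrev SX.toOpen {I : FinSet} (r : Setoid I) : SX f I.toNEq →ₐ[ℂ] SX f ⟨I, r⟩ :=
  SX.map (FinNEq.toSelf ⟨I, r⟩)

theorem FinNEq.hom_ext {I J : FinNEq} {α β : I ⟶ J} (h : ∀ i, α.toFun i = β.toFun i) : α = β :=
  FinNEq.Hom.ext (funext h)

/-- The composite is only required to be the right one pointwise. This form and its variants below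
turn nearly every comparison of scalars in the proof into an equality of indices. -/
theorem SX.map_map {I J K : FinNEq} (α : I ⟶ J) (β : J ⟶ K) (γ : I ⟶ K)
    (h : ∀ i, γ.toFun i = β.toFun (α.toFun i)) (s : SX f I) :
    SX.map β (SX.map α s) = SX.map γ s := by
  rw [← SX.map_comp]
  congr 2
  exact FinNEq.hom_ext fun i => (h i).symm

theorem SX.map_square {I J J' K : FinNEq} (α : I ⟶ J) (β : J ⟶ K) (α' : I ⟶ J') (β' : J' ⟶ K)
    (h : ∀ i, β.toFun (α.toFun i) = β'.toFun (α'.toFun i)) (s : SX f I) :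
    SX.map β (SX.map α s) = SX.map β' (SX.map α' s) := by
  rw [SX.map_map α β (α ≫ β) (fun _ => rfl), SX.map_map α' β' (α ≫ β) h]

theorem SX.map_map₃ {I J K L : FinNEq} (α : I ⟶ J) (β : J ⟶ K) (γ : K ⟶ L) (δ : I ⟶ L)
    (h : ∀ i, δ.toFun i = γ.toFun (β.toFun (α.toFun i))) (s : SX f I) :
    SX.map γ (SX.map β (SX.map α s)) = SX.map δ s := by
  rw [SX.map_map α β (α ≫ β) (fun _ => rfl), SX.map_map (α ≫ β) γ δ h]

theorem SX.map_eq_self {I : FinNEq} (α : I ⟶ I) (h : ∀ i, α.toFun i = i) (s : SX f I) :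
    SX.map α s = s := by
  rw [show α = 𝟙 I from FinNEq.hom_ext h, SX.map_id]

theorem SX.isUnit_toOpen_of_le {I : FinSet} {r r' : Setoid I} (h : r' ≤ r) {q : SX f I.toNEq}
    (hq : IsUnit (SX.toOpen r q)) : IsUnit (SX.toOpen r' q) := by
  have := hq.map (SX.map (f := f) (I := ⟨I, r⟩) (J := ⟨I, r'⟩) (FinNEq.Hom.mk id fun _ _ hi => h hi))
  rwa [SX.map_map _ _ (FinNEq.toSelf ⟨I, r'⟩) (fun _ => rfl)] at this

theorem SX.isUnit_toOpen_map {I J : FinSet} {r : Setoid I} {r' : Setoid J} (α : I → J)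
    (h : ∀ i i', r' (α i) (α i') → r i i') {q : SX f I.toNEq}
    (hq : IsUnit (SX.toOpen r q)) : IsUnit (SX.toOpen r' (SX.map (FinNEq.ofFun α) q)) := by
  let a : (⟨I, r⟩ : FinNEq) ⟶ ⟨J, r'⟩ := FinNEq.Hom.mk α h
  have e : SX.map a (SX.toOpen r q) = SX.toOpen r' (SX.map (FinNEq.ofFun α) q) :=
    SX.map_square (FinNEq.toSelf ⟨I, r⟩) a (FinNEq.ofFun α) (FinNEq.toSelf ⟨J, r'⟩)
      (fun _ => rfl) q
  exact e ▸ hq.map (SX.map a)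

/-- Polynomials as functions on `U(I)`. -/
noncomputable def SX.ofPoly (I : FinNEq) : MvPolynomial I ℂ →ₐ[ℂ] SX f I :=
  IsScalarTower.toAlgHom ℂ (MvPolynomial I ℂ) (SX f I)

theorem SX.isUnit_ofPoly {I : FinNEq} {n : MvPolynomial I ℂ} (hn : n ∈ denominators f I) :
    IsUnit (SX.ofPoly (f := f) I n) :=
  IsLocalization.map_units (M := denominators f I) (SX f I) ⟨n, hn⟩

theorem SX.ofPoly_X {I : FinNEq} (i : I) :
    SX.ofPoly (f := f) I (MvPolynomial.X i) = SX.x i := rfl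

theorem SX.map_ofPoly {I J : FinNEq} (α : I ⟶ J) (p : MvPolynomial I ℂ) :
    SX.map α (SX.ofPoly (f := f) I p) = SX.ofPoly J (MvPolynomial.rename α.toFun p) :=
  SX.map_algebraMap α p

theorem SX.toSelf_ofPoly (I : FinNEq) (p : MvPolynomial I ℂ) :
    SX.map I.toSelf (SX.ofPoly (f := f) I.set.toNEq p) = SX.ofPoly I p := by
  rw [SX.map_ofPoly]
  change SX.ofPoly I (MvPolynomial.rename id p) = _
  rw [MvPolynomial.rename_id_apply]

theorem SX.toOpen_ofPoly {I : FinSet} (r : Setoid I) (p : MvPolynomial I ℂ) :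
    SX.toOpen r (SX.ofPoly (f := f) I.toNEq p) = SX.ofPoly ⟨I, r⟩ p :=
  SX.toSelf_ofPoly ⟨I, r⟩ p

theorem SX.isUnit_sub {I : FinNEq} {i j : I} (h : ¬ I.rel i j) :
    IsUnit (SX.x (f := f) i - SX.x j) := by
  rw [← SX.ofPoly_X, ← SX.ofPoly_X, ← map_sub]
  exact SX.isUnit_ofPoly (Submonoid.subset_closure (Or.inr ⟨i, j, h, rfl⟩))

theorem SX.isUnit_toOpen_sub {I : FinSet} {r : Setoid I} {i j : I} (h : ¬ r i j) :
    IsUnit (SX.toOpen r (SX.x (f := f) (I := I.toNEq) i - SX.x (I := I.toNEq) j)) := by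
  rw [map_sub, SX.map_x, SX.map_x]
  exact SX.isUnit_sub (I := ⟨I, r⟩) h

theorem SX.exists_ofPoly_mul {I : FinNEq} (s : SX f I) :
    ∃ n ∈ denominators f I, ∃ p : MvPolynomial I ℂ, SX.ofPoly I n * s = SX.ofPoly I p := by
  obtain ⟨p, n, rfl⟩ := IsLocalization.exists_mk'_eq (denominators f I) s
  refine ⟨n, n.2, p, ?_⟩
  rw [mul_comm]
  exact IsLocalization.mk'_spec _ _ _

theorem SX.exists_toOpen_mul {I : FinSet} {r : Setoid I} (s : SX f ⟨I, r⟩) :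
    ∃ n ∈ denominators f ⟨I, r⟩, ∃ p : SX f I.toNEq,
      SX.toOpen r (SX.ofPoly I.toNEq n) * s = SX.toOpen r p := by
  obtain ⟨n, hn, p, h⟩ := SX.exists_ofPoly_mul s
  exact ⟨n, hn, SX.ofPoly I.toNEq p, by rw [SX.toOpen_ofPoly, SX.toOpen_ofPoly, h]⟩

theorem SX.isUnit_toOpen_denominators {I : FinSet} {r : Setoid I} {n : MvPolynomial I ℂ}
    (hn : n ∈ denominators f ⟨I, r⟩) : IsUnit (SX.toOpen r (SX.ofPoly (f := f) I.toNEq n)) := by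
  rw [SX.toOpen_ofPoly]
  exact SX.isUnit_ofPoly (I := ⟨I, r⟩) hn

namespace DMod

theorem res_add {I : FinNEq} {M : DMod.{u} f I.set.toNEq} (m n : M) :
    (res (m + n) : M.on (I := I)) = res m + res n := tmul_add _ _ _ _

theorem res_smul {I : FinSet} {r : Setoid I} {M : DMod.{u} f I.toNEq} (s : SX f I.toNEq) (m : M) :
    (res (s • m) : M.on (I := ⟨I, r⟩)) = SX.toOpen r s • res m :=
  tmul_smul _ _ _ _

theorem res_zero {I : FinNEq} {M : DMod.{u} f I.set.toNEq} : (res (0 : M) : M.on (I := I)) = 0 := by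
  have := res_add (I := I) (0 : M) 0
  simpa using this

theorem res_sub {I : FinNEq} {M : DMod.{u} f I.set.toNEq} (m n : M) :
    (res (m - n) : M.on (I := I)) = res m - res n := by
  rw [eq_sub_iff_add_eq, ← res_add, sub_add_cancel]

theorem on_der_res {I : FinSet} {r : Setoid I} (M : DMod.{u} f I.toNEq) (i : I) (m : M) :
    (M.on (I := ⟨I, r⟩)).der i (res m) = res (M.der i m) := by
  have h := on_der_tmul (I := ⟨I, r⟩) M i 1 m
  rw [Derivation.map_one_eq_zero] at h
  refine h.trans (add_eq_right.2 ?_)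
  simpa using add_tmul (FinNEq.toSelf ⟨I, r⟩) 0 0 m

theorem tmul_eq_smul_res {I : FinNEq} {M : DMod.{u} f I.set.toNEq} (s : SX f I) (m : M) :
    (tmul I.toSelf s m : M.on (I := I)) = s • res m := by
  rw [smul_tmul, mul_one]

/-- Every section over `U(I, r)` becomes global after multiplication by an invertible function. -/
theorem exists_denominators_smul {I : FinSet} {r : Setoid I} {M : DMod.{u} f I.toNEq}
    (x : M.on (I := ⟨I, r⟩)) :
    ∃ n ∈ denominators f ⟨I, r⟩, ∃ m : M,
      SX.toOpen r (SX.ofPoly (f := f) I.toNEq n) • x = res (I := ⟨I, r⟩) m := by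
  induction x using pull_induction with
  | zero => exact ⟨1, one_mem _, 0, by rw [smul_zero, res_zero]⟩
  | tmul s m =>
    obtain ⟨n, hn, p, h⟩ := SX.exists_toOpen_mul s
    exact ⟨n, hn, p • m, by rw [res_smul, tmul_eq_smul_res, smul_smul, h]⟩
  | add x y hx hy =>
    obtain ⟨n, hn, m, h⟩ := hx
    obtain ⟨n', hn', m', h'⟩ := hy
    refine ⟨n * n', mul_mem hn hn', SX.ofPoly (f := f) I.toNEq n' • m +
      SX.ofPoly (f := f) I.toNEq n • m', ?_⟩
    rw [res_add, res_smul, res_smul, ← h, ← h', map_mul, map_mul, smul_add, smul_smul, smul_smul,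
      mul_comm]

theorem exists_smul_eq_res {I : FinSet} {r : Setoid I} {M : DMod.{u} f I.toNEq}
    (x : M.on (I := ⟨I, r⟩)) :
    ∃ q : SX f I.toNEq, IsUnit (SX.toOpen r q) ∧ ∃ m : M, SX.toOpen r q • x = res (I := ⟨I, r⟩) m := by
  obtain ⟨n, hn, h⟩ := exists_denominators_smul x
  exact ⟨_, SX.isUnit_toOpen_denominators hn, h⟩

theorem SemiHom.on_res {I J : FinNEq} (α : I ⟶ J) {M : DMod.{u} f I.set.toNEq}
    {N : DMod.{u} f J.set.toNEq} (n : SemiHom (FinNEq.ofFun α.toFun) M N) (m : M) :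
    SemiHom.on α n (res m) = res (n m) := by
  change tmul J.toSelf (SX.map α 1) (n m) = _
  rw [map_one]

theorem SemiHom.map_toOpen_smul {I J : FinSet} {r : Setoid I} {r' : Setoid J}
    (α : (⟨I, r⟩ : FinNEq) ⟶ ⟨J, r'⟩) {M : DMod.{u} f ⟨I, r⟩} {N : DMod.{u} f ⟨J, r'⟩}
    (n : SemiHom α M N) (s : SX f I.toNEq) (x : M) :
    n (SX.toOpen r s • x) = SX.toOpen r' (SX.map (FinNEq.ofFun α.toFun) s) • n x := by
  rw [n.map_smul]
  refine congrArg (· • n x) ?_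
  exact SX.map_square (FinNEq.toSelf ⟨I, r⟩) α (FinNEq.ofFun α.toFun) (FinNEq.toSelf ⟨J, r'⟩)
    (fun _ => rfl) s

/-- Semilinear maps out of the restriction to `U(I)` are determined by global sections. -/
theorem on_ext {I J : FinNEq} {M : DMod.{u} f I.set.toNEq} {N : Type*} [AddCommGroup N]
    [Module (SX f J) N] (α : I ⟶ J) (F G : M.on (I := I) →+ N)
    (hF : ∀ (s : SX f I) x, F (s • x) = SX.map α s • F x)
    (hG : ∀ (s : SX f I) x, G (s • x) = SX.map α s • G x)
    (h : ∀ m : M, F (res m) = G (res m)) (x : M.on (I := I)) : F x = G x := by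
  induction x using pull_induction with
  | zero => rw [map_zero, map_zero]
  | tmul s m => rw [tmul_eq_smul_res, hF, hG, h]
  | add x y hx hy => rw [map_add, map_add, hx, hy]

/-- Both composites act separately on the two factors of `s ⊗ m`, so commutation on indices and on
global sections suffices. -/
theorem SemiHom.on_square {I J J' K : FinNEq} {α : I ⟶ J} {β : J ⟶ K} {α' : I ⟶ J'} {β' : J' ⟶ K}
    (hα : ∀ i, β.toFun (α.toFun i) = β'.toFun (α'.toFun i))
    {M : DMod.{u} f I.set.toNEq} {N : DMod.{u} f J.set.toNEq} {N' : DMod.{u} f J'.set.toNEq}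
    {P : DMod.{u} f K.set.toNEq} {n : SemiHom (FinNEq.ofFun α.toFun) M N}
    {p : SemiHom (FinNEq.ofFun β.toFun) N P} {n' : SemiHom (FinNEq.ofFun α'.toFun) M N'}
    {p' : SemiHom (FinNEq.ofFun β'.toFun) N' P} (h : ∀ m, p (n m) = p' (n' m))
    (x : M.on (I := I)) :
    SemiHom.on β p (SemiHom.on α n x) = SemiHom.on β' p' (SemiHom.on α' n' x) := by
  induction x using pull_induction with
  | zero => simp only [map_zero]
  | tmul s m =>
    change tmul K.toSelf (SX.map β (SX.map α s)) (p (n m)) =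
      tmul K.toSelf (SX.map β' (SX.map α' s)) (p' (n' m))
    rw [h, SX.map_square α β α' β' hα]
  | add x y hx hy => simp only [map_add, hx, hy]

theorem SemiHom.on_on {I J K : FinNEq} {α : I ⟶ J} {β : J ⟶ K} {γ : I ⟶ K}
    (hα : ∀ i, γ.toFun i = β.toFun (α.toFun i))
    {M : DMod.{u} f I.set.toNEq} {N : DMod.{u} f J.set.toNEq}
    {P : DMod.{u} f K.set.toNEq} {n : SemiHom (FinNEq.ofFun α.toFun) M N}
    {p : SemiHom (FinNEq.ofFun β.toFun) N P} {t : SemiHom (FinNEq.ofFun γ.toFun) M P}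
    (h : ∀ m, t m = p (n m)) (x : M.on (I := I)) :
    SemiHom.on β p (SemiHom.on α n x) = SemiHom.on γ t x := by
  induction x using pull_induction with
  | zero => simp only [map_zero]
  | tmul s m =>
    change tmul K.toSelf (SX.map β (SX.map α s)) (p (n m)) = tmul K.toSelf (SX.map γ s) (t m)
    rw [h, SX.map_map α β γ hα]
  | add x y hx hy => simp only [map_add, hx, hy]

section resTo

variable {I : FinSet} {r r' r'' : Setoid I} {M : DMod.{u} f I.toNEq}

/-- The inclusion of a smaller open subset. -/
def _root_.AHS.FinNEq.ofLE (h : r' ≤ r) : (⟨I, r⟩ : FinNEq) ⟶ ⟨I, r'⟩ :=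
  FinNEq.Hom.mk id fun _ _ hi => h hi

/-- The restriction of sections to a smaller open subset, with its compatibilities. -/
noncomputable def resSemi (h : r' ≤ r) (M : DMod.{u} f I.toNEq) :
    SemiHom (FinNEq.ofLE h) (M.on (I := ⟨I, r⟩)) (M.on (I := ⟨I, r'⟩)) :=
  SemiHom.on (FinNEq.ofLE h) (SemiHom.ofHom (𝟙 M))

theorem resSemi_apply (h : r' ≤ r) (x : M.on (I := ⟨I, r⟩)) : resSemi h M x = resTo h M x := rfl

@[simp] theorem resTo_res (h : r' ≤ r) (m : M) :
    resTo h M (res m) = res m := SemiHom.on_res (FinNEq.ofLE h) _ _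

theorem resTo_smul (h : r' ≤ r) (s : SX f ⟨I, r⟩) (x : M.on (I := ⟨I, r⟩)) :
    resTo h M (s • x) = SX.map (FinNEq.ofLE h) s • resTo h M x :=
  (resSemi h M).map_smul s x

theorem resTo_toOpen_smul (h : r' ≤ r) (s : SX f I.toNEq) (x : M.on (I := ⟨I, r⟩)) :
    resTo h M (SX.toOpen r s • x) = SX.toOpen r' s • resTo h M x := by
  rw [resTo_smul]
  refine congrArg (· • resTo h M x) ?_
  exact SX.map_map _ _ _ (fun _ => rfl) s

theorem resTo_der (h : r' ≤ r) (i : I) (x : M.on (I := ⟨I, r⟩)) :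
    resTo h M ((M.on (I := ⟨I, r⟩)).der i x) = (M.on (I := ⟨I, r'⟩)).der i (resTo h M x) := by
  rw [← resSemi_apply, ← resSemi_apply, (resSemi h M).map_der]
  have e : FinNEq.preim (FinNEq.ofLE h) i = {i} := by
    ext k
    rw [FinNEq.mem_preim, Finset.mem_singleton]
    rfl
  rw [e, Finset.sum_singleton]

theorem resTo_resTo (h : r' ≤ r) (h' : r'' ≤ r') (x : M.on (I := ⟨I, r⟩)) :
    resTo h' M (resTo h M x) = resTo (h'.trans h) M x :=
  SemiHom.on_on (I := ⟨I, r⟩) (J := ⟨I, r'⟩) (K := ⟨I, r''⟩) (fun _ => rfl) (fun _ => rfl) x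

theorem resTo_self (h : r ≤ r) (x : M.on (I := ⟨I, r⟩)) : resTo h M x = x :=
  onMap_id (I := ⟨I, r⟩) M x

/-- There are no non-zero sections supported on the diagonal divisor. -/
def NoDiagonal (M : DMod.{u} f I.toNEq) : Prop :=
  ∀ m : M, res (I := ⟨I, ⊥⟩) m = 0 → m = 0

theorem NoDiagonal.eq_zero (hM : NoDiagonal M) {m : M} (h : (res m : M.on (I := ⟨I, r⟩)) = 0) :
    m = 0 := by
  refine hM m ?_
  have := congrArg (resTo (bot_le : ⊥ ≤ r) M) h
  rwa [resTo_res, map_zero] at this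

theorem NoDiagonal.res_injective (hM : NoDiagonal M) :
    Function.Injective (fun m : M => (res m : M.on (I := ⟨I, r⟩))) := by
  intro m n h
  rw [← sub_eq_zero]
  refine hM.eq_zero (r := r) ?_
  rw [res_sub, sub_eq_zero]
  exact h

/-- A unit on `U(I, r)` makes the section global, and a global section that vanishes on a smaller
open set vanishes off all diagonals. -/
theorem NoDiagonal.resTo_injective (hM : NoDiagonal M) (h : r' ≤ r) :
    Function.Injective (resTo h M) := by
  rw [injective_iff_map_eq_zero]
  intro x hx
  obtain ⟨q, hq, m, hm⟩ := exists_smul_eq_res x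
  have h0 := congrArg (resTo h M) hm
  rw [resTo_toOpen_smul, hx, smul_zero, resTo_res] at h0
  rw [← hq.smul_eq_zero, hm, hM.eq_zero h0.symm, res_zero]

/-- The function `q` need not be invertible on `U(I, r)`. Being invertible on some `U(I, r₀)`, it is
invertible off all diagonals, and restriction to that open set is injective. -/
theorem NoDiagonal.smul_eq_zero (hM : NoDiagonal M) {q : SX f I.toNEq} {r₀ : Setoid I}
    (hq : IsUnit (SX.toOpen r₀ q)) {x : M.on (I := ⟨I, r⟩)} (h : SX.toOpen r q • x = 0) :
    x = 0 := by
  refine hM.resTo_injective (bot_le : ⊥ ≤ r) ?_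
  have := congrArg (resTo (bot_le : ⊥ ≤ r) M) h
  rw [resTo_toOpen_smul, map_zero,
    (SX.isUnit_toOpen_of_le (bot_le : ⊥ ≤ r₀) hq).smul_eq_zero] at this
  rw [this, map_zero]

theorem NoDiagonal.smul_left_cancel (hM : NoDiagonal M) {q : SX f I.toNEq} {r₀ : Setoid I}
    (hq : IsUnit (SX.toOpen r₀ q)) {x y : M.on (I := ⟨I, r⟩)}
    (h : SX.toOpen r q • x = SX.toOpen r q • y) : x = y := by
  rw [← sub_eq_zero] at h ⊢
  rw [← smul_sub] at h
  exact hM.smul_eq_zero hq h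

theorem NoDiagonal.smul_cancel (hM : NoDiagonal M) {q : SX f I.toNEq} {r₀ : Setoid I}
    (hq : IsUnit (SX.toOpen r₀ q)) {m : M} (h : q • m = 0) : m = 0 := by
  refine hM.eq_zero (r := ⊥) (hM.smul_eq_zero hq ?_)
  exact (res_smul q m).symm.trans (by rw [h, res_zero])

end resTo

end DMod

end AHS

namespace AHS

variable {f : ℂ[X]}

/-! ## Generators of external tensor products -/

namespace DMod

section box

variable {I J : FinSet} {α : I → J} {M : ∀ j, DMod.{u} f (FinSet.fiber α j).toNEq}

theorem eq_update_of_forall_ne {K : Type*} [DecidableEq K] {X : K → Type*} {b b' : ∀ k, X k}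
    {j : K} (h : ∀ k, k ≠ j → b k = b' k) : b = Function.update b' j (b j) := by
  funext k
  by_cases hk : k = j
  · subst hk; simp
  · rw [Function.update_of_ne hk, h k hk]

/-- The families are compared pointwise instead of through `Function.update`, so that the rule
applies to families defined by cases, such as `pair`. -/
theorem boxMk_add (j : J) {b b' b'' : ∀ j, M j} (h : b j = b' j + b'' j)
    (h' : ∀ k, k ≠ j → b k = b' k) (h'' : ∀ k, k ≠ j → b k = b'' k) :
    boxMk α b = boxMk α b' + boxMk α b'' := by
  classical
  rw [eq_update_of_forall_ne h', h]
  unfold boxMk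
  rw [MultilinearMap.map_update_add, TensorProduct.tmul_add, Submodule.Quotient.mk_add,
    Function.update_eq_self]
  congr 4
  rw [← eq_update_of_forall_ne fun k hk => (h'' k hk).symm.trans (h' k hk)]

theorem boxMk_smul (j : J) {b b' : ∀ j, M j} (s : SX f (FinSet.fiber α j).toNEq)
    (h : b j = s • b' j) (h' : ∀ k, k ≠ j → b k = b' k) :
    boxMk α b = SX.map (FinNEq.fiberIncl α j) s • boxMk α b' := by
  classical
  rw [eq_update_of_forall_ne h', h]
  unfold boxMk
  refine (Submodule.Quotient.eq _).2 ?_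
  have e : SX.map (FinNEq.fiberIncl α j) s •
      ((1 : SX f (FinNEq.ker α)) ⊗ₜ[ℂ] PiTensorProduct.tprod ℂ b') =
      SX.map (FinNEq.fiberIncl α j) s ⊗ₜ PiTensorProduct.tprod ℂ b' := by
    rw [TensorProduct.smul_tmul', smul_eq_mul, mul_one]
  exact Submodule.subset_span ⟨j, b', s, by rw [← e]⟩

/-- Since `∂_i` kills the coefficient `1`, it acts only on the factor over `α i`. -/
theorem boxMk_der (i : I) {b b' : ∀ j, M j} (h : b (α i) = (M (α i)).der ⟨i, rfl⟩ (b' (α i)))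
    (h' : ∀ k, k ≠ α i → b k = b' k) : boxMk α b = (box α M).der i (boxMk α b') := by
  refine Eq.trans ?_ (congrArg (Submodule.Quotient.mk (p := boxRels α M))
    (boxDer'_tmul α M i 1 (PiTensorProduct.tprod ℂ b'))).symm
  rw [Derivation.map_one_eq_zero, TensorProduct.zero_tmul, zero_add, PiTensorProduct.map_tprod]
  unfold boxMk
  congr 3
  funext k
  by_cases hk : α i = k
  · subst hk
    rw [h, derAt, dif_pos rfl]
  · rw [h' k (Ne.symm hk), derAt, dif_neg hk]
    rfl

theorem boxMk_induction {p : box α M → Prop} (x : box α M) (zero : p 0)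
    (smul : ∀ (s : SX f (FinNEq.ker α)) (b : ∀ j, M j), p (s • boxMk α b))
    (add : ∀ x y, p x → p y → p (x + y)) : p x := by
  obtain ⟨x, rfl⟩ := Submodule.Quotient.mk_surjective _ x
  induction x using TensorProduct.induction_on with
  | zero => exact zero
  | add x y hx hy => exact add _ _ hx hy
  | tmul s t =>
    induction t using PiTensorProduct.induction_on with
    | smul_tprod c b =>
      have e : s ⊗ₜ[ℂ] (c • PiTensorProduct.tprod ℂ b) =
          (c • s) • ((1 : SX f (FinNEq.ker α)) ⊗ₜ[ℂ] PiTensorProduct.tprod ℂ b) := by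
        rw [TensorProduct.smul_tmul', smul_eq_mul, mul_one, TensorProduct.smul_tmul]
      rw [e]
      exact smul (c • s) b
    | add x y hx hy =>
      rw [TensorProduct.tmul_add]
      exact add _ _ hx hy

/-- An external tensor product over a one-element set is the only factor. -/
theorem boxMk_injective_of_subsingleton [Subsingleton I] (j : J) (hJ : ∀ k, k = j) {b b' : ∀ j, M j}
    (h : boxMk α b = boxMk α b') : b j = b' j := by
  classical
  -- As `j` is the only index, the external product maps to the pullback of `M j` by `L`, which
  -- kills the relations. It then remains to map the pullback back to `M j`.
  let N := (M j).pull (FinNEq.fiberIncl α j)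
  let l : MultilinearMap ℂ (fun j => M j) N :=
    { toFun := fun m => tmul _ 1 (m j)
      map_update_add' := fun m k x y => by
        obtain rfl := hJ k
        have e : ∀ x, Function.update m k x k = x := fun x => by
          convert Function.update_self k x m
        rw [e, e, e, tmul_add]
      map_update_smul' := fun m k c x => by
        obtain rfl := hJ k
        have e : ∀ x, Function.update m k x k = x := fun x => by
          convert Function.update_self k x m
        rw [e, e, ← algebraMap_smul (SX f (FinSet.fiber α k).toNEq) c, tmul_smul,
          AlgHom.commutes, ← smul_tmul, algebraMap_smul] }
  let L : SX f (FinNEq.ker α) ⊗[ℂ] (⨂[ℂ] j, M j) →ₗ[SX f (FinNEq.ker α)] N :=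
    LinearMap.liftBaseChange _ (PiTensorProduct.lift l)
  have hL : ∀ s m, L (s ⊗ₜ PiTensorProduct.tprod ℂ m) = s • tmul (FinNEq.fiberIncl α j) 1 (m j) := by
    intro s m
    simp [L, l]
  have hle : boxRels α M ≤ LinearMap.ker L := by
    refine Submodule.span_le.2 ?_
    rintro _ ⟨k, m, r, rfl⟩
    obtain rfl := hJ k
    rw [SetLike.mem_coe, LinearMap.mem_ker, map_sub, hL, hL, one_smul, Function.update_self,
      tmul_smul, smul_tmul, sub_self]
  have h1 : tmul (FinNEq.fiberIncl α j) 1 (b j) = tmul (FinNEq.fiberIncl α j) 1 (b' j) := by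
    have : L (1 ⊗ₜ PiTensorProduct.tprod ℂ b) = L (1 ⊗ₜ PiTensorProduct.tprod ℂ b') := by
      rw [← sub_eq_zero, ← map_sub]
      exact hle ((Submodule.Quotient.eq _).1 h)
    rwa [hL, hL, one_smul, one_smul] at this
  -- With at most one point in `I`, the inclusion of the fibre has a retraction in `Fin^≢`. Hence `s
  -- ⊗ m ↦ ρ(s) m` is well defined, and it recovers `m` from `1 ⊗ m`.
  let ρ : FinNEq.ker α ⟶ (FinSet.fiber α j).toNEq :=
    FinNEq.Hom.mk (fun i => ⟨i, hJ _⟩) fun i i' _ => congrArg α (Subsingleton.elim i i')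
  let P : BaseChange (SX.map (f := f) (FinNEq.fiberIncl α j)) (M j) →+ M j :=
    BaseChange.liftAdd
      (AddMonoidHom.mk' (fun s => AddMonoidHom.mk' (fun m => SX.map ρ s • m)
        (fun m m' => smul_add _ _ _))
        (fun s t => by ext m; simp [add_smul]))
      (fun r s m => by
        change SX.map ρ (_ * s) • m = SX.map ρ s • r • m
        rw [map_mul, mul_comm, mul_smul, SX.map_map _ _ (𝟙 _) (fun _ => rfl), SX.map_id])
  have hP : ∀ m, P (tmul (FinNEq.fiberIncl α j) 1 m) = m := fun m => by
    refine (BaseChange.liftAdd_tmul _ _ _ _).trans ?_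
    change SX.map ρ (1 : SX f (FinNEq.ker α)) • m = m
    rw [map_one, one_smul]
  rw [← hP (b j), h1, hP]

end box

end DMod

end AHS

namespace AHS

variable {f : ℂ[X]}

/-! ## Structure maps of factorization algebras on sections -/

namespace FactorizationData

variable (B : FactorizationData.{u} f) {I J : NFinSet} {α : I → J} {hα : Function.Surjective α}

theorem d_add (j : J) {b b' b'' : ∀ j : J, B.obj (NFinSet.fiber α hα j)} (h : b j = b' j + b'' j)
    (h' : ∀ k, k ≠ j → b k = b' k) (h'' : ∀ k, k ≠ j → b k = b'' k) :
    B.d α hα b = B.d α hα b' + B.d α hα b'' := by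
  unfold d
  rw [DMod.boxMk_add j h h' h'', map_add]

theorem d_smul (j : J) {b b' : ∀ j : J, B.obj (NFinSet.fiber α hα j)}
    (s : SX f (NFinSet.fiber α hα j).toNEq) (h : b j = s • b' j) (h' : ∀ k, k ≠ j → b k = b' k) :
    B.d α hα b =
      SX.map (FinNEq.fiberIncl (I := I.toFinSet) (J := J.toFinSet) α j) s • B.d α hα b' := by
  unfold d
  rw [DMod.boxMk_smul j s h h', map_smul]

theorem d_der (i : I) {b b' : ∀ j : J, B.obj (NFinSet.fiber α hα j)}
    (h : b (α i) = (B.obj (NFinSet.fiber α hα (α i))).der ⟨i, rfl⟩ (b' (α i)))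
    (h' : ∀ k, k ≠ α i → b k = b' k) :
    B.d α hα b = ((B.obj I).on (I := FinNEq.ker α)).der i (B.d α hα b') := by
  unfold d
  rw [DMod.boxMk_der (I := I.toFinSet) (J := J.toFinSet) i h h', DMod.Hom.map_der]

/-- A section of the surjection `α` lifts functions from `X^J` to `X^I`, so every element of the
pullback has the form `1 ⊗ b`; and `ran` is an isomorphism. -/
theorem nu_surjective (α : I → J) (hα : Function.Surjective α) :
    Function.Surjective (B.nu α hα) := by
  intro y
  obtain ⟨s, hs⟩ := hα.hasRightInverse
  have h : ∀ x : (B.obj I).pull (FinNEq.ofFun α), ∃ b, DMod.tmul _ 1 b = x := by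
    intro x
    induction x using DMod.pull_induction with
    | zero => exact ⟨0, by simpa using DMod.tmul_add (FinNEq.ofFun α) 1 (0 : B.obj I) 0⟩
    | tmul t m =>
      refine ⟨SX.map (FinNEq.ofFun s) t • m, ?_⟩
      rw [DMod.tmul_smul, mul_one, SX.map_map _ _ (𝟙 _) (fun j => (hs j).symm), SX.map_id]
    | add x y hx hy =>
      obtain ⟨b, rfl⟩ := hx
      obtain ⟨c, rfl⟩ := hy
      exact ⟨b + c, DMod.tmul_add _ _ _ _⟩
  obtain ⟨b, hb⟩ := h ((B.ran α hα).inv.toLin y)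
  refine ⟨b, (congrArg (B.ran α hα).hom.toLin hb).trans ?_⟩
  exact congrArg (fun g : B.obj J ⟶ B.obj J => g.toLin y) (B.ran α hα).inv_hom_id

/-- Because `ran` is an isomorphism, vanishing of the restriction can be read in the tensor product,
where divisibility by a coordinate difference becomes visible. -/
theorem tmul_eq_zero_of_nu (α : I → J) (hα : Function.Surjective α) {b : B.obj I}
    (h : B.nu α hα b = 0) : DMod.tmul (FinNEq.ofFun α) 1 b = 0 := by
  have h1 : (B.ran α hα).inv.toLin ((B.ran α hα).hom.toLin (DMod.tmul (FinNEq.ofFun α) 1 b)) = 0 :=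
    (congrArg (B.ran α hα).inv.toLin h).trans (map_zero _)
  rw [← h1]
  exact (congrArg (fun g : (B.obj I).pull (FinNEq.ofFun α) ⟶ _ => g.toLin (DMod.tmul _ 1 b))
    (B.ran α hα).hom_inv_id).symm

theorem nu_smul (α : I → J) (hα : Function.Surjective α) (s : SX f I.toNEq) (b : B.obj I) :
    B.nu α hα (s • b) = SX.map (FinNEq.ofFun α) s • B.nu α hα b :=
  (B.nu α hα).map_smul s b

end FactorizationData

/-- The map from the one-element set to the fibre of the identity over `k`. -/
def NFinSet.toFiberId (K : NFinSet) (k : K) :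
    NFinSet.one → NFinSet.fiber (I := K) (J := K) id Function.surjective_id k :=
  fun _ => ⟨k, rfl⟩

theorem NFinSet.toFiberId_surjective (K : NFinSet) (k : K) :
    Function.Surjective (NFinSet.toFiberId K k) := by
  rintro ⟨k', rfl⟩
  exact ⟨(), rfl⟩

namespace FactorizationAlgebra

variable (B : FactorizationAlgebra.{u} f) {I J K : NFinSet}

theorem noDiagonal (I : NFinSet) : (B.obj I).NoDiagonal := fun _ h => B.eq_zero_of_res _ h

theorem nu_nu {α : I → J} {β : J → K} {γ : I → K} (hα : Function.Surjective α)
    (hβ : Function.Surjective β) (hγ : Function.Surjective γ) (h : ∀ i, γ i = β (α i))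
    (b : B.obj I) : B.nu β hβ (B.nu α hα b) = B.nu γ hγ b := by
  obtain rfl : γ = β ∘ α := funext h
  exact (B.nu_comp α β hα hβ b).symm

/-- No axiom states that `ν_id` is the identity. It is idempotent by functoriality and also
surjective, which forces it. -/
theorem nu_eq_self {α : I → I} (hα : Function.Surjective α) (h : ∀ i, α i = i) (b : B.obj I) :
    B.nu α hα b = b := by
  obtain ⟨c, rfl⟩ := B.nu_surjective α hα b
  exact B.nu_nu hα hα hα (fun i => (h _).symm) c

theorem nu_congr {α β : I → J} (hα : Function.Surjective α) (h : ∀ i, α i = β i)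
    (hβ : Function.Surjective β) (b : B.obj I) : B.nu α hα b = B.nu β hβ b := by
  obtain rfl : α = β := funext h
  rfl

theorem nu_injective {α : I → J} (hα : Function.Bijective α) :
    Function.Injective (B.nu α hα.surjective) := by
  let e := Equiv.ofBijective α hα
  intro b c h
  have := congrArg (B.nu e.symm e.symm.surjective) h
  rwa [B.nu_nu hα.surjective e.symm.surjective Function.surjective_id (fun i => (e.symm_apply_apply i).symm),
    B.nu_nu hα.surjective e.symm.surjective Function.surjective_id (fun i => (e.symm_apply_apply i).symm),
    B.nu_eq_self (α := id) _ (fun _ => rfl), B.nu_eq_self (α := id) _ (fun _ => rfl)] at this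

/-- The restriction of `ν_α` to open subsets. -/
noncomputable def nuOn (α : I → J) (hα : Function.Surjective α) (r : Setoid I) (r' : Setoid J)
    (h : ∀ i i', r' (α i) (α i') → r i i') :
    DMod.SemiHom (I := ⟨I.toFinSet, r⟩) (J := ⟨J.toFinSet, r'⟩) (FinNEq.Hom.mk α h)
      ((B.obj I).on (I := ⟨I.toFinSet, r⟩)) ((B.obj J).on (I := ⟨J.toFinSet, r'⟩)) :=
  DMod.SemiHom.on (I := ⟨I.toFinSet, r⟩) (J := ⟨J.toFinSet, r'⟩) (FinNEq.Hom.mk α h) (B.nu α hα)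

section nuOn

variable {α : I → J} {hα : Function.Surjective α} {r : Setoid I} {r' : Setoid J}
  {h : ∀ i i', r' (α i) (α i') → r i i'}

@[simp] theorem nuOn_res (b : B.obj I) :
    B.nuOn α hα r r' h (DMod.res b) = DMod.res (B.nu α hα b) :=
  DMod.SemiHom.on_res _ _ _

theorem nuOn_toOpen_smul (s : SX f I.toNEq) (x : (B.obj I).on (I := ⟨I.toFinSet, r⟩)) :
    B.nuOn α hα r r' h (SX.toOpen r s • x) =
      SX.toOpen r' (SX.map (FinNEq.ofFun α) s) • B.nuOn α hα r r' h x :=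
  DMod.SemiHom.map_toOpen_smul _ _ _ _

theorem resTo_nuOn {r₁ : Setoid I} {r₁' : Setoid J} (h₁ : ∀ i i', r₁' (α i) (α i') → r₁ i i')
    (hr : r₁ ≤ r) (hr' : r₁' ≤ r') (x : (B.obj I).on (I := ⟨I.toFinSet, r⟩)) :
    DMod.resTo hr' (B.obj J) (B.nuOn α hα r r' h x) =
      B.nuOn α hα r₁ r₁' h₁ (DMod.resTo hr (B.obj I) x) := by
  refine DMod.SemiHom.on_square (I := ⟨I.toFinSet, r⟩) (J := ⟨J.toFinSet, r'⟩)
    (J' := ⟨I.toFinSet, r₁⟩) (K := ⟨J.toFinSet, r₁'⟩) (fun _ => rfl) (fun _ => rfl) x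

theorem nuOn_nuOn {β : J → K} {γ : I → K} {hβ : Function.Surjective β}
    {hγ : Function.Surjective γ} {r'' : Setoid K} {h' : ∀ i i', r'' (β i) (β i') → r' i i'}
    {h'' : ∀ i i', r'' (γ i) (γ i') → r i i'} (e : ∀ i, γ i = β (α i))
    (x : (B.obj I).on (I := ⟨I.toFinSet, r⟩)) :
    B.nuOn β hβ r' r'' h' (B.nuOn α hα r r' h x) = B.nuOn γ hγ r r'' h'' x := by
  refine DMod.SemiHom.on_on (I := ⟨I.toFinSet, r⟩) (J := ⟨J.toFinSet, r'⟩)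
    (K := ⟨K.toFinSet, r''⟩) e (fun m => (B.nu_nu hα hβ hγ e m).symm) x

theorem nuOn_eq_self {α : I → I} {hα : Function.Surjective α}
    {h : ∀ i i', r (α i) (α i') → r i i'} (e : ∀ i, α i = i)
    (x : (B.obj I).on (I := ⟨I.toFinSet, r⟩)) : B.nuOn α hα r r h x = x := by
  obtain rfl : α = id := funext e
  refine (DMod.SemiHom.on_on (I := ⟨I.toFinSet, r⟩) (J := ⟨I.toFinSet, r⟩)
    (K := ⟨I.toFinSet, r⟩) (α := 𝟙 _) (n := DMod.SemiHom.ofHom (𝟙 (B.obj I)))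
    (β := 𝟙 _) (γ := FinNEq.Hom.mk id h) (p := DMod.SemiHom.ofHom (𝟙 (B.obj I)))
    (t := B.nu id hα) (fun _ => rfl)
    (fun m => B.nu_eq_self _ (fun _ => rfl) m) x).symm.trans ?_
  exact (DMod.onMap_id _ _).trans (DMod.onMap_id _ _)

/-- The inverse bijection provides a left inverse; `h₁` is what makes it a morphism for the two
equivalence relations. -/
theorem nuOn_injective (hα' : Function.Bijective α) (h₁ : ∀ i i', r i i' → r' (α i) (α i')) :
    Function.Injective (B.nuOn α hα r r' h) := by
  let e := Equiv.ofBijective α hα'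
  have he : ∀ i, e.symm (α i) = i := e.symm_apply_apply
  have he' : ∀ i, α (e.symm i) = i := e.apply_symm_apply
  intro x y hxy
  have := congrArg (B.nuOn e.symm e.symm.surjective r' r (fun j j' hj => by
    simpa only [he'] using h₁ _ _ hj)) hxy
  rwa [B.nuOn_nuOn (γ := id) (hγ := Function.surjective_id) (h'' := fun _ _ hi => hi)
      (fun i => (he i).symm),
    B.nuOn_nuOn (γ := id) (hγ := Function.surjective_id) (h'' := fun _ _ hi => hi)
      (fun i => (he i).symm),
    B.nuOn_eq_self (α := id) (fun _ => rfl), B.nuOn_eq_self (α := id) (fun _ => rfl)] at this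

end nuOn

/-- Equality, as an equivalence relation, so that `U(K)` is the complement of all diagonals. -/
abbrev _root_.AHS.NFinSet.discrete (K : NFinSet) : Setoid K := Setoid.ker id

/-- The section `d_id(⊠_k m_k)` outside of all diagonals, for sections `m_k` of `B_X`. -/
noncomputable def gen (K : NFinSet) (m : K → B.obj NFinSet.one) :
    (B.obj K).on (I := ⟨K.toFinSet, K.discrete⟩) :=
  B.d (I := K) (J := K) id Function.surjective_id
    (fun k => B.nu (NFinSet.toFiberId K k) (NFinSet.toFiberId_surjective K k) (m k))

/-- The section `c` over `X^K` restricts to `s • d_id(⊠_k m_k)` outside of all diagonals. -/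
def IsPure (K : NFinSet) (s : SX f K.toNEq) (m : K → B.obj NFinSet.one) (c : B.obj K) : Prop :=
  SX.toOpen K.discrete s • B.gen K m = DMod.res (I := ⟨K.toFinSet, K.discrete⟩) c

theorem ker_id_le {I J : Type*} (α : I → J) : Setoid.ker (id : I → I) ≤ Setoid.ker α :=
  fun _ _ h => congrArg α h

/-- This is `d_comp` for `id` followed by `α`, where the inner factorization separates all points.
It evaluates any `d_α` on pure sections, and all later computations off the diagonals go through it.
-/
theorem resTo_d (α : I → J) (hα : Function.Surjective α) (m : I → B.obj NFinSet.one)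
    (s : ∀ j : J, SX f (NFinSet.fiber α hα j).toNEq)
    (c : ∀ j : J, B.obj (NFinSet.fiber α hα j))
    (h : ∀ j : J, B.IsPure (NFinSet.fiber α hα j) (s j) (fun i => m i.1) (c j)) :
    DMod.resTo (r' := I.discrete) (ker_id_le α) (B.obj I) (B.d α hα c) =
      (∏ᶠ j : J, SX.map (FinNEq.fromTop (J := ⟨I.toFinSet, I.discrete⟩) Subtype.val) (s j)) •
        B.gen I m := by
  refine B.d_comp (I := I) (J := I) (K := J) id α Function.surjective_id hα _ s c fun j => ?_
  refine Eq.trans (congrArg (SX.map (f := f) _ (s j) • ·) ?_) (h j)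
  unfold gen
  refine congrArg (B.d _ _) (funext fun i => ?_)
  -- Both families arise from `m` by `ν` along the same map from the one-point set to a one-point
  -- fibre.
  exact B.nu_nu (K := NFinSet.fiber (I := NFinSet.fiber α hα j) (J := NFinSet.fiber α hα j) id
    Function.surjective_id i) (NFinSet.toFiberId_surjective I i.1)
    (fiberFiber_surjective (I := I) (J := I) (K := J) id α j i)
    (NFinSet.toFiberId_surjective _ i) (fun _ => rfl) _

end FactorizationAlgebra

end AHS

/-! ### One-point sets, and transport of generators along bijections -/

namespace AHS

variable {f : ℂ[X]}

/-- With at most one point there is nothing to remove: `U(I, r)` is all of `X^I`, whatever `r` is.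
-/
theorem DMod.res_surjective_of_subsingleton {I : FinSet} [Subsingleton I] {r : Setoid I}
    {M : DMod.{u} f I.toNEq} (x : M.on (I := ⟨I, r⟩)) :
    ∃ m : M, DMod.res (I := ⟨I, r⟩) m = x := by
  let ρ : (⟨I, r⟩ : FinNEq) ⟶ I.toNEq :=
    FinNEq.Hom.mk id fun i i' _ => by rw [Subsingleton.elim i i']
  induction x using DMod.pull_induction with
  | zero => exact ⟨0, DMod.res_zero (I := ⟨I, r⟩)⟩
  | tmul s m =>
    refine ⟨SX.map ρ s • m, ?_⟩
    rw [DMod.res_smul, SX.map_eq_self (ρ ≫ FinNEq.toSelf ⟨I, r⟩ : (⟨I, r⟩ : FinNEq) ⟶ ⟨I, r⟩)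
      (fun _ => rfl) s |> (SX.map_comp _ _ s).symm.trans, ← DMod.tmul_eq_smul_res (I := ⟨I, r⟩)]
  | add x y hx hy =>
    obtain ⟨m, rfl⟩ := hx
    obtain ⟨n, rfl⟩ := hy
    exact ⟨m + n, DMod.res_add (I := ⟨I, r⟩) m n⟩

namespace NFinSet

/-- The map from the one-element set to `K` with value `k`. -/
def const (K : NFinSet) (k : K) : one → K := fun _ => k

theorem const_surjective {K : NFinSet} {k : K} (h : ∀ k', k' = k) :
    Function.Surjective (const K k) := fun k' => ⟨(), (h k').symm⟩

end NFinSet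

namespace FactorizationAlgebra

variable (B : FactorizationAlgebra.{u} f) {I J K : NFinSet}

/-- The isomorphism `d_id` is injective, and an external product with one factor loses no
information about that factor. -/
theorem gen_injective_of_subsingleton [Subsingleton K] (k : K) {m m' : K → B.obj NFinSet.one}
    (h : B.gen K m = B.gen K m') : m k = m' k := by
  have h' := congrArg (B.fact (I := K) (J := K) id Function.surjective_id).inv.toLin h
  have e : ∀ x, (B.fact (I := K) (J := K) id Function.surjective_id).inv.toLin
      ((B.fact (I := K) (J := K) id Function.surjective_id).hom.toLin x) = x := fun x =>
    congrArg (fun g : _ ⟶ DMod.box (I := K.toFinSet) (J := K.toFinSet) id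
      (fun j => B.obj (NFinSet.fiber (I := K) (J := K) id Function.surjective_id j)) => g.toLin x)
      (B.fact (I := K) (J := K) id Function.surjective_id).hom_inv_id
  unfold gen FactorizationData.d at h'
  rw [e, e] at h'
  have := DMod.boxMk_injective_of_subsingleton (I := K.toFinSet) (J := K.toFinSet) k
    (fun k' => Subsingleton.elim k' k) h'
  refine B.nu_injective (α := NFinSet.toFiberId K k) ⟨?_, NFinSet.toFiberId_surjective K k⟩ this
  exact fun _ _ _ => rfl

/-- The factorization isomorphism of a one-point set is the identity, although no axiom says so.
Write the generator of `m` as the restriction of `ν(n)`. Then `d_comp`, with all maps equal to `id`,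
evaluates `d_id` on `ν(n)` as the generator of `m`, while by definition it is the generator of `n`;
injectivity gives `n = m`. -/
theorem isPure_fiber_id [Subsingleton K] (k : K)
    (m : NFinSet.fiber (I := K) (J := K) id Function.surjective_id k → B.obj NFinSet.one) :
    B.IsPure (NFinSet.fiber (I := K) (J := K) id Function.surjective_id k) 1 m
      (B.nu (NFinSet.toFiberId K k) (NFinSet.toFiberId_surjective K k) (m ⟨k, rfl⟩)) := by
  have : Subsingleton (NFinSet.fiber (I := K) (J := K) id Function.surjective_id k) :=
    inferInstanceAs (Subsingleton {i : K // id i = k})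
  obtain ⟨c, hc⟩ := DMod.res_surjective_of_subsingleton (B.gen _ m)
  obtain ⟨n, rfl⟩ := B.nu_surjective (NFinSet.toFiberId K k) (NFinSet.toFiberId_surjective K k) c
  suffices h : n = m ⟨k, rfl⟩ by
    subst h
    unfold IsPure
    rw [map_one, one_smul, hc]
  have h := B.resTo_d (I := K) (J := K) id Function.surjective_id (fun _ => m ⟨k, rfl⟩)
    (fun _ => 1)
    (fun j => B.nu (NFinSet.toFiberId K j) (NFinSet.toFiberId_surjective K j) n) (fun j => by
      obtain rfl := Subsingleton.elim j k
      unfold IsPure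
      rw [map_one, one_smul, hc]
      exact congrArg (B.gen _) (funext fun i => congrArg m (Subsingleton.elim _ _)))
  simp only [map_one, finprod_one, one_smul] at h
  rw [DMod.resTo_self] at h
  exact B.gen_injective_of_subsingleton (m := fun _ => n) k h

/-- A one-point set need not be a fibre of an identity map. It maps bijectively to such a fibre `L`;
by `nu_d` this carries its generator to that of `L`, and `ν` along a bijection is injective. -/
theorem isPure_of_subsingleton (k : K) (hk : ∀ k', k' = k) (m : K → B.obj NFinSet.one) :
    B.IsPure K 1 m (B.nu (NFinSet.const K k) (NFinSet.const_surjective hk) (m k)) := by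
  have : Subsingleton K := ⟨fun a b => (hk a).trans (hk b).symm⟩
  let L := NFinSet.fiber (I := K) (J := K) id Function.surjective_id k
  have hL : Subsingleton L := inferInstanceAs (Subsingleton {i : K // id i = k})
  let β : K → L := fun i => ⟨i, hk i⟩
  have hβ : Function.Surjective β := fun l => ⟨l.1, rfl⟩
  -- A predicate that holds everywhere on `K` equals `fun i => id i = k`, so the fibres of `β` are,
  -- as types, the fibre already treated.
  have fib : ∀ (p : K → Prop) (hp : ∀ i, p i) (m : {i // p i} → B.obj NFinSet.one),
      B.IsPure { carrier := {i // p i}, nonempty := ⟨⟨k, hp k⟩⟩ } 1 m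
        (B.nu (I := NFinSet.one) (J := { carrier := {i // p i}, nonempty := ⟨⟨k, hp k⟩⟩ })
          (fun _ => ⟨k, hp k⟩) (fun i => ⟨(), Subtype.ext (hk _).symm⟩) (m ⟨k, hp k⟩)) := by
    intro p hp
    obtain rfl : p = fun i => id i = k := funext fun i => propext ⟨fun _ => hk i, fun _ => hp i⟩
    exact B.isPure_fiber_id k
  let c : ∀ j : L, B.obj (NFinSet.fiber β hβ j) := fun j =>
    B.nu (I := NFinSet.one) (J := NFinSet.fiber β hβ j) (fun _ => ⟨k, Subsingleton.elim _ _⟩)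
      (fun i => ⟨(), Subtype.ext (hk _).symm⟩) (m k)
  have h1 := B.resTo_d β hβ m (fun _ => 1) c (fun j => fib (fun i => β i = j)
    (fun _ => Subsingleton.elim _ _) (fun i => m i.1))
  simp only [map_one, finprod_one, one_smul] at h1
  have h2 := B.nu_d (I := K) (J := L) (K := L) β id hβ Function.surjective_id c
  have h3 := B.isPure_fiber_id k (fun i => m i.1)
  unfold IsPure at h3 ⊢
  rw [map_one, one_smul] at h3 ⊢
  have h4 : B.nuOn β hβ (Setoid.ker β) L.discrete (fun _ _ h => h) (B.d β hβ c) =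
      B.gen L (fun i => m i.1) := by
    refine h2.trans (congrArg (B.d _ _) (funext fun j => ?_))
    refine (B.nu_nu (γ := NFinSet.toFiberId L j) _ _ (NFinSet.toFiberId_surjective L j) (fun _ =>
      Subtype.ext (Subsingleton.elim _ _)) _).trans ?_
    exact congrArg _ (congrArg m (hk j.1).symm)
  have hb : Function.Bijective β := ⟨fun _ _ _ => Subsingleton.elim _ _, hβ⟩
  refine B.nuOn_injective (r := K.discrete) (r' := L.discrete) (hα := hβ)
    (h := fun i i' _ => Subsingleton.elim i i') hb (fun i i' _ => Subsingleton.elim _ _) ?_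
  rw [← h1]
  refine (B.resTo_nuOn (α := β) (hα := hβ) (r := Setoid.ker β) (r' := L.discrete)
    (h := fun _ _ h => h) _ (ker_id_le β) le_rfl _).symm.trans ?_
  rw [DMod.resTo_self, h4, h3, nuOn_res]
  exact congrArg _ (B.nu_nu (α := NFinSet.const K k) (β := β) (γ := NFinSet.toFiberId K k)
    (NFinSet.const_surjective hk) hβ (NFinSet.toFiberId_surjective K k) (fun _ => rfl) _).symm

/-- Transport of generators along bijections. -/
theorem nuOn_gen {σ : I → J} (hσ : Function.Bijective σ) (m : J → B.obj NFinSet.one)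
    (h : ∀ i i', J.discrete (σ i) (σ i') → I.discrete i i') :
    B.nuOn σ hσ.surjective I.discrete J.discrete h (B.gen I (fun i => m (σ i))) = B.gen J m := by
  let e := Equiv.ofBijective σ hσ
  have he : ∀ j, σ (e.symm j) = j := e.apply_symm_apply
  have hk : ∀ j, ∀ k' : NFinSet.fiber σ hσ.surjective j, k' = ⟨e.symm j, he j⟩ := by
    rintro j ⟨i, rfl⟩
    exact Subtype.ext (hσ.injective (he _).symm)
  -- The fibres of `σ` are points, so `c` consists of pure sections. By `resTo_d` the section
  -- `d_σ(c)` restricts to the generator on `I`, and by `nu_d` its image under `ν_σ` is the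
  -- generator on `J`.
  let c : ∀ j : J, B.obj (NFinSet.fiber σ hσ.surjective j) := fun j =>
    B.nu (NFinSet.const _ _) (NFinSet.const_surjective (hk j)) (m j)
  have h1 := B.resTo_d σ hσ.surjective (fun i => m (σ i)) (fun _ => 1) c (fun j => by
    convert B.isPure_of_subsingleton _ (hk j) (fun i => m (σ i.1)) using 3
    exact (he j).symm)
  simp only [map_one, finprod_one, one_smul] at h1
  have h2 := B.nu_d (I := I) (J := J) (K := J) σ id hσ.surjective Function.surjective_id c
  have h4 : B.nuOn σ hσ.surjective (Setoid.ker σ) J.discrete (fun _ _ h => h) (B.d σ hσ.surjective c) =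
      B.gen J m := by
    refine h2.trans (congrArg (B.d _ _) (funext fun j => ?_))
    exact B.nu_nu (K := NFinSet.fiber (I := J) (J := J) id Function.surjective_id j)
      (α := NFinSet.const (NFinSet.fiber σ hσ.surjective j) ⟨e.symm j, he j⟩) (β := fiberMap σ id j)
      (γ := NFinSet.toFiberId J j) _ _ (NFinSet.toFiberId_surjective J j) (fun _ =>
      Subtype.ext (he j).symm) _
  rw [← h1]
  refine (B.resTo_nuOn (α := σ) (hα := hσ.surjective) (r := Setoid.ker σ) (r' := J.discrete)
    (h := fun _ _ h => h) _ (ker_id_le σ) le_rfl _).symm.trans ?_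
  rw [DMod.resTo_self, h4]

theorem IsPure.nu {σ : I → J} (hσ : Function.Bijective σ) {m : J → B.obj NFinSet.one}
    {s : SX f I.toNEq} {c : B.obj I} (h : B.IsPure I s (fun i => m (σ i)) c) :
    B.IsPure J (SX.map (FinNEq.ofFun σ) s) m (B.nu σ hσ.surjective c) := by
  have h' := congrArg (B.nuOn σ hσ.surjective I.discrete J.discrete fun i i' hi => hσ.injective hi) h
  rw [nuOn_res, nuOn_toOpen_smul, B.nuOn_gen hσ] at h'
  exact h'

/-- The generators span the sections outside of all diagonals. -/
theorem gen_induction {p : (B.obj K).on (I := ⟨K.toFinSet, K.discrete⟩) → Prop} (x) (zero : p 0)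
    (smul : ∀ (s : SX f ⟨K.toFinSet, K.discrete⟩) (m : K → B.obj NFinSet.one),
      p (s • B.gen K m))
    (add : ∀ x y, p x → p y → p (x + y)) : p x := by
  have e : (B.fact (I := K) (J := K) id Function.surjective_id).hom.toLin
      ((B.fact (I := K) (J := K) id Function.surjective_id).inv.toLin x) = x :=
    congrArg (fun g : (B.obj K).on (I := ⟨K.toFinSet, K.discrete⟩) ⟶ _ => g.toLin x)
      (B.fact (I := K) (J := K) id Function.surjective_id).inv_hom_id
  rw [← e]
  generalize (B.fact (I := K) (J := K) id Function.surjective_id).inv.toLin x = y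
  induction y using DMod.boxMk_induction with
  | zero => rw [map_zero]; exact zero
  | smul s b =>
    rw [map_smul]
    choose m hm using fun k => B.nu_surjective (NFinSet.toFiberId K k)
      (NFinSet.toFiberId_surjective K k) (b k)
    obtain rfl : (fun k => B.nu (NFinSet.toFiberId K k)
      (NFinSet.toFiberId_surjective K k) (m k)) = b := funext hm
    exact smul s m
  | add x y hx hy => rw [map_add]; exact add _ _ hx hy

end FactorizationAlgebra

end AHS

/-! ### Reduction to pure sections, and extension of sections across diagonals -/

namespace AHS

variable {f : ℂ[X]}

namespace FactorizationAlgebra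

variable (B : FactorizationAlgebra.{u} f) {I J K : NFinSet}

theorem IsPure.smul {s : SX f K.toNEq} {m : K → B.obj NFinSet.one} {c : B.obj K}
    (h : B.IsPure K s m c) (t : SX f K.toNEq) : B.IsPure K (t * s) m (t • c) := by
  unfold IsPure at h ⊢
  rw [DMod.res_smul, ← h, map_mul, mul_smul]

/-- Off the diagonals the section is a combination of generators. After clearing the denominators of
the coefficients and of the generators themselves, the identity holds between global sections, as
restriction is injective. -/
theorem exists_smul_mem_span (b : B.obj K) :
    ∃ q : SX f K.toNEq, IsUnit (SX.toOpen K.discrete q) ∧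
      q • b ∈ Submodule.span (SX f K.toNEq) {c | ∃ s m, B.IsPure K s m c} := by
  have key : ∀ x : (B.obj K).on (I := ⟨K.toFinSet, K.discrete⟩),
      ∃ q : SX f K.toNEq, IsUnit (SX.toOpen K.discrete q) ∧
        ∃ c ∈ Submodule.span (SX f K.toNEq) {c | ∃ s m, B.IsPure K s m c},
          SX.toOpen K.discrete q • x = DMod.res (I := ⟨K.toFinSet, K.discrete⟩) c := by
    intro x
    induction x using B.gen_induction with
    | zero => exact ⟨1, by simp, 0, zero_mem _, by rw [smul_zero, DMod.res_zero]⟩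
    | smul s m =>
      obtain ⟨q, hq, c, hc⟩ := DMod.exists_smul_eq_res (B.gen K m)
      obtain ⟨n, hn, p, hp⟩ := SX.exists_toOpen_mul s
      have hn' := SX.isUnit_toOpen_denominators hn
      refine ⟨q * SX.ofPoly (f := f) K.toNEq n, ?_, p • c,
        Submodule.smul_mem _ _ (Submodule.subset_span ⟨q, m, hc⟩), ?_⟩
      · rw [map_mul]
        exact hq.mul hn'
      · rw [DMod.res_smul, ← hc, ← hp]
        simp only [map_mul, smul_smul]
        ring_nf
    | add x y hx hy =>
      obtain ⟨q, hq, c, hc, h⟩ := hx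
      obtain ⟨q', hq', c', hc', h'⟩ := hy
      refine ⟨q * q', ?_, q' • c + q • c', add_mem (Submodule.smul_mem _ _ hc)
        (Submodule.smul_mem _ _ hc'), ?_⟩
      · rw [map_mul]
        exact hq.mul hq'
      · rw [DMod.res_add, DMod.res_smul, DMod.res_smul, ← h, ← h', smul_add]
        simp only [map_mul, smul_smul]
        rw [mul_comm (SX.toOpen K.discrete q')]
  obtain ⟨q, hq, c, hc, h⟩ := key (DMod.res b)
  refine ⟨q, hq, ?_⟩
  rw [← DMod.res_smul] at h
  rwa [(B.noDiagonal K).res_injective (r := K.discrete) h]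

/-- A property of sections that can be checked on `d_id(⊠_k m_k)`, up to denominators. -/
theorem pure_induction {p : B.obj K → Prop} (b : B.obj K)
    (pure : ∀ s m c, B.IsPure K s m c → p c) (zero : p 0) (add : ∀ b c, p b → p c → p (b + c))
    (cancel : ∀ (q : SX f K.toNEq) b, IsUnit (SX.toOpen K.discrete q) → p (q • b) → p b) :
    p b := by
  obtain ⟨q, hq, h⟩ := B.exists_smul_mem_span b
  refine cancel q b hq ?_
  rw [← one_smul (SX f K.toNEq) (q • b)]
  -- The motive runs over all multiples of the section, since `p` is not assumed to be stable under
  -- scalars whereas purity is.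
  refine Submodule.span_induction (p := fun c _ => ∀ t : SX f K.toNEq, p (t • c)) ?_ ?_ ?_ ?_ h 1
  · rintro c ⟨s, m, h⟩ t
    exact pure _ _ _ (IsPure.smul B h t)
  · intro t
    rwa [smul_zero]
  · intro x y _ _ hx hy t
    rw [smul_add]
    exact add _ _ (hx t) (hy t)
  · intro a x _ hx t
    rw [smul_smul]
    exact hx _

/-- The target may be a module over another ring, through `φ`. All that is asked of it is that
functions invertible off the diagonals can be cancelled. -/
theorem pure_ext {S : Type*} [CommRing S] (φ : SX f K.toNEq → S) {N : Type*} [AddCommGroup N]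
    [Module S N] (F G : B.obj K →+ N)
    (hN : ∀ q, IsUnit (SX.toOpen K.discrete q) → ∀ n n' : N, φ q • n = φ q • n' → n = n')
    (hF : ∀ s b, F (s • b) = φ s • F b) (hG : ∀ s b, G (s • b) = φ s • G b)
    (h : ∀ s m c, B.IsPure K s m c → F c = G c) (b : B.obj K) : F b = G b := by
  induction b using B.pure_induction with
  | pure s m c hc => exact h s m c hc
  | zero => rw [map_zero, map_zero]
  | add b c hb hc => rw [map_add, map_add, hb, hc]
  | cancel q b hq hb =>
    rw [hF, hG] at hb
    exact hN q hq _ _ hb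

/-- The sections of `B_{X^K}` which vanish on the diagonal `x_i = x_j` are divisible by the
difference of these coordinates. -/
theorem exists_eq_sub_smul {γ : K → J} (hγ : Function.Surjective γ) {i j : K}
    (s : J → K) (hj : s (γ j) = i) (hne : ∀ k, k ≠ j → s (γ k) = k)
    {b : B.obj K} (h : B.nu γ hγ b = 0) :
    ∃ b', b = (SX.x (f := f) (I := K.toNEq) i - SX.x (I := K.toNEq) j) • b' := by
  let p : SX f K.toNEq := SX.x (I := K.toNEq) i - SX.x (I := K.toNEq) j
  let N : Submodule (SX f K.toNEq) (B.obj K) := LinearMap.range (LinearMap.lsmul _ (B.obj K) p)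
  have hN : ∀ (r : SX f K.toNEq) (m : B.obj K), r ∈ Ideal.span {p} → r • m ∈ N := by
    intro r m hr
    obtain ⟨a, rfl⟩ := Ideal.mem_span_singleton'.1 hr
    exact ⟨a • m, by simp [smul_smul]⟩
  -- The composite `s ∘ γ` moves only `j`, to `i`. On functions it is the substitution `x_j := x_i`,
  -- which is the identity modulo `p`.
  have hsγ : ∀ r : SX f K.toNEq,
      SX.map (FinNEq.ofFun s) (SX.map (FinNEq.ofFun γ) r) - r ∈ Ideal.span {p} := by
    intro r
    rw [← Ideal.Quotient.eq]
    have : (Ideal.Quotient.mkₐ ℂ (Ideal.span {p})).comp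
        ((SX.map (FinNEq.ofFun s)).comp (SX.map (FinNEq.ofFun γ))) =
        Ideal.Quotient.mkₐ ℂ (Ideal.span {p}) := by
      refine SX.algHom_ext fun k => ?_
      refine (Ideal.Quotient.eq (I := Ideal.span {p})).2 ?_
      change SX.map (FinNEq.ofFun s) (SX.map (FinNEq.ofFun γ) (SX.x (I := K.toNEq) k)) - _ ∈ _
      rw [SX.map_x, SX.map_x]
      change SX.x (I := K.toNEq) (s (γ k)) - SX.x (I := K.toNEq) k ∈ _
      by_cases hk : k = j
      · subst hk
        rw [hj]
        exact Ideal.mem_span_singleton_self _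
      · rw [hne k hk, sub_self]
        exact zero_mem _
    exact DFunLike.congr_fun this r
  -- Because of `hsγ`, the rule `a ⊗ m ↦ s(a) m` is balanced modulo the multiples of `p`. It sends
  -- `1 ⊗ b` to the class of `b`, which therefore vanishes.
  let P : BaseChange (SX.map (f := f) (FinNEq.ofFun γ)) (B.obj K) →+ B.obj K ⧸ N :=
    BaseChange.liftAdd
      (AddMonoidHom.mk' (fun a => AddMonoidHom.mk'
        (fun m => (Submodule.Quotient.mk (SX.map (FinNEq.ofFun s) a • m) : B.obj K ⧸ N))
        (fun m m' => by rw [smul_add, Submodule.Quotient.mk_add]))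
        (fun s t => by ext m; simp [add_smul]))
      (fun r a m => by
        refine (Submodule.Quotient.eq N).2 ?_
        rw [map_mul, mul_comm, mul_smul, ← smul_sub, ← sub_smul]
        exact N.smul_mem _ (hN _ _ (hsγ r)))
  have hP : P (DMod.tmul (FinNEq.ofFun γ) 1 b) = Submodule.Quotient.mk b := by
    refine (BaseChange.liftAdd_tmul _ _ _ _).trans ?_
    change Submodule.Quotient.mk (SX.map (FinNEq.ofFun s) (1 : SX f J.toNEq) • b) = _
    rw [map_one, one_smul]
  rw [B.tmul_eq_zero_of_nu γ hγ h] at hP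
  obtain ⟨b', hb'⟩ := (Submodule.Quotient.mk_eq_zero N).1 (hP.symm.trans (map_zero P))
  exact ⟨b', hb'.symm⟩

/-- The equivalence relation that identifies `i` and `j`. -/
noncomputable def pairRel (K : NFinSet) (i j : K) : Setoid K := by
  classical exact Setoid.ker (fun k => if k = j then i else k)

theorem pairRel_le {r : Setoid K} {i j : K} (h : r i j) : pairRel K i j ≤ r := by
  classical
  intro k k' hk
  change (if k = j then i else k) = (if k' = j then i else k') at hk
  split_ifs at hk with h1 h2 h2
  · rw [h1, h2]
  · rw [h1, ← hk]; exact r.symm' h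
  · rw [h2, hk]; exact h
  · rw [hk]

theorem eq_of_pairRel {i j k k' : K} (hk : k ≠ j) (hk' : k' ≠ j) (h : pairRel K i j k k') :
    k = k' := by
  classical
  change (if k = j then i else k) = (if k' = j then i else k') at h
  rwa [if_neg hk, if_neg hk'] at h

theorem pairRel_self (i j : K) : pairRel K i j j i := by
  classical
  change (if j = j then i else j) = (if i = j then i else i)
  simp

/-- This presents the diagonal `x_i = x_j` as a power `X^L`, with `L = K ∖ {j}`: the map `γ` sends
`j` to `i`, so that `ν_γ` is restriction to the diagonal, and `s` is the inclusion of `L`. -/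
theorem exists_collapse (i j : K) (hij : i ≠ j) : ∃ (L : NFinSet) (γ : K → L) (s : L → K),
    (∀ l, γ (s l) = l) ∧ s (γ j) = i ∧ (∀ k, k ≠ j → s (γ k) = k) ∧
      ∀ k k', γ k = γ k' ↔ pairRel K i j k k' := by
  classical
  let γ : K → {k // k ≠ j} := fun k => if h : k = j then ⟨i, hij⟩ else ⟨k, h⟩
  have hγ : ∀ k, (γ k).1 = if k = j then i else k := fun k => by
    simp only [γ]; split_ifs <;> rfl
  refine ⟨{ carrier := {k // k ≠ j}, nonempty := ⟨⟨i, hij⟩⟩ }, γ, Subtype.val, ?_, ?_, ?_, ?_⟩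
  · exact fun l => Subtype.ext (by rw [hγ, if_neg l.2])
  · rw [hγ, if_pos rfl]
  · intro k hk
    rw [hγ, if_neg hk]
  · intro k k'
    rw [← Subtype.coe_inj, hγ, hγ]
    change _ ↔ (if k = j then i else k) = (if k' = j then i else k')
    rfl

/-- Let `b` and `b₂` be the global sections `(x_i - x_j) y` and `q y`. Then `q b = (x_i - x_j) b₂`
vanishes on the diagonal. Generically on the diagonal `q` is invertible, and the module there has no
sections supported on smaller diagonals, so `b` itself vanishes on the diagonal and is divisible by
`x_i - x_j`. The quotient is `y`. -/
theorem exists_res_of_sub_smul {i j : K} (hij : i ≠ j)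
    (y : (B.obj K).on (I := ⟨K.toFinSet, K.discrete⟩))
    (h : ∃ q : SX f K.toNEq, IsUnit (SX.toOpen (pairRel K i j) q) ∧
      ∃ b : B.obj K, SX.toOpen K.discrete q • y = DMod.res (I := ⟨K.toFinSet, K.discrete⟩) b)
    (h' : ∃ b : B.obj K, SX.toOpen K.discrete
      (SX.x (f := f) (I := K.toNEq) i - SX.x (I := K.toNEq) j) • y = DMod.res (I := ⟨K.toFinSet, K.discrete⟩) b) :
    ∃ b : B.obj K, y = DMod.res (I := ⟨K.toFinSet, K.discrete⟩) b := by
  obtain ⟨L, γ, s, h1, h2, h3, h4⟩ := exists_collapse i j hij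
  have hγ : Function.Surjective γ := fun l => ⟨s l, h1 l⟩
  obtain ⟨q, hq, b₂, hb₂⟩ := h
  obtain ⟨b, hb⟩ := h'
  have hd : IsUnit (SX.toOpen K.discrete
      (SX.x (f := f) (I := K.toNEq) i - SX.x (I := K.toNEq) j)) := SX.isUnit_toOpen_sub hij
  have e : q • b = (SX.x (f := f) (I := K.toNEq) i - SX.x (I := K.toNEq) j) • b₂ := by
    refine (B.noDiagonal K).res_injective (r := K.discrete) ?_
    beta_reduce
    rw [DMod.res_smul, DMod.res_smul, ← hb, ← hb₂, smul_smul, smul_smul, mul_comm]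
  have e' := congrArg (B.nu γ hγ) e
  rw [B.nu_smul, B.nu_smul, map_sub, SX.map_x, SX.map_x] at e'
  have hij' : γ i = γ j := by rw [← h2, h1]
  have h0 : B.nu γ hγ b = 0 := by
    change _ = (SX.x (I := L.toNEq) (γ i) - SX.x (I := L.toNEq) (γ j)) • _ at e'
    rw [hij', sub_self, zero_smul] at e'
    refine (B.noDiagonal L).smul_cancel (r₀ := L.discrete) ?_ e'
    exact SX.isUnit_toOpen_map (r' := L.discrete) γ (fun k k' hk => (h4 k k').1 hk) hq
  obtain ⟨b', rfl⟩ := B.exists_eq_sub_smul hγ s h2 h3 h0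
  refine ⟨b', ?_⟩
  rw [DMod.res_smul] at hb
  exact hd.smul_left_cancel.1 hb

/-- A section outside of all diagonals which extends over the generic points of the diagonals is
the restriction of a global section. -/
theorem exists_res_of_forall_pair (y : (B.obj K).on (I := ⟨K.toFinSet, K.discrete⟩))
    (h : ∀ i j : K, i ≠ j → ∃ q : SX f K.toNEq, IsUnit (SX.toOpen (pairRel K i j) q) ∧
      ∃ b : B.obj K, SX.toOpen K.discrete q • y = DMod.res (I := ⟨K.toFinSet, K.discrete⟩) b) :
    ∃ b : B.obj K, y = DMod.res (I := ⟨K.toFinSet, K.discrete⟩) b := by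
  obtain ⟨n, hn, hy⟩ := DMod.exists_denominators_smul y
  -- The denominator is removed one factor at a time. The claim is generalised over `y` because for
  -- a product `n n'` it is first applied to `n' y`.
  have key : ∀ n ∈ denominators f ⟨K.toFinSet, K.discrete⟩,
      ∀ y : (B.obj K).on (I := ⟨K.toFinSet, K.discrete⟩),
      (∀ i j : K, i ≠ j → ∃ q : SX f K.toNEq, IsUnit (SX.toOpen (pairRel K i j) q) ∧
        ∃ b : B.obj K, SX.toOpen K.discrete q • y = DMod.res (I := ⟨K.toFinSet, K.discrete⟩) b) →
      (∃ b : B.obj K, SX.toOpen K.discrete (SX.ofPoly (f := f) K.toNEq n) • y = DMod.res (I := ⟨K.toFinSet, K.discrete⟩) b) →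
      ∃ b : B.obj K, y = DMod.res (I := ⟨K.toFinSet, K.discrete⟩) b := by
    intro n hn
    unfold denominators at hn
    induction hn using Submonoid.closure_induction with
    | one => simp
    | mul n n' _ _ hn hn' =>
      intro y h hy
      refine hn' y h (hn _ (fun i j hij => ?_) ?_)
      · obtain ⟨q, hq, b, hb⟩ := h i j hij
        refine ⟨q, hq, SX.ofPoly (f := f) K.toNEq n' • b, ?_⟩
        rw [DMod.res_smul, ← hb, smul_smul, smul_smul, mul_comm]
      · rw [smul_smul, ← map_mul, ← map_mul]
        exact hy
    | mem n hn =>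
      intro y h hy
      obtain ⟨i, rfl⟩ | ⟨i, j, hij, rfl⟩ := hn
      · obtain ⟨b, hb⟩ := hy
        -- The factors `f(x_i)` are invertible on the whole of `X^K`, so only coordinate differences
        -- need the extension argument.
        have hu : IsUnit (SX.ofPoly (f := f) K.toNEq (Polynomial.aeval (MvPolynomial.X i) f)) :=
          SX.isUnit_ofPoly (Submonoid.subset_closure (Or.inl ⟨i, rfl⟩))
        obtain ⟨u, hu⟩ := hu
        refine ⟨(↑u⁻¹ : SX f K.toNEq) • b, ?_⟩
        rw [DMod.res_smul, ← hb, smul_smul, ← hu, ← map_mul, Units.inv_mul, map_one, one_smul]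
      · rw [map_sub] at hy
        exact B.exists_res_of_sub_smul hij y (h i j hij) hy
  exact key n hn y h hy

end FactorizationAlgebra

/-! ### The unit section, and its products with a section at one further point -/

namespace UnitalFactorizationAlgebra

variable (B : UnitalFactorizationAlgebra.{u} f) {K : NFinSet}

/-- The unit section of `B_{X^K}`. -/
noncomputable def vac (K : NFinSet) : B.obj K := B.unit K 1

theorem nu_vac {I J : NFinSet} (α : I → J) (hα : Function.Surjective α) :
    B.nu α hα (B.vac I) = B.vac J := by
  unfold vac
  rw [B.unit_nu, map_one]

theorem der_vac (i : K) : (B.obj K).der i (B.vac K) = 0 := by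
  unfold vac
  rw [← B.unit_der, Derivation.map_one_eq_zero, map_zero]

/-- By `unit_d` for the identity, the unit over `X^K` is the product of the units at the points; `ν`
carries units to units. -/
theorem isPure_vac (K : NFinSet) :
    B.IsPure K 1 (fun _ => B.vac NFinSet.one) (B.vac K) := by
  unfold FactorizationAlgebra.IsPure FactorizationAlgebra.gen
  have h := B.unit_d (I := K) (J := K) id Function.surjective_id (fun _ => 1)
  simp only [map_one, finprod_one, one_smul] at h ⊢
  refine Eq.trans ?_ h
  refine congrArg (B.d _ _) (funext fun k => ?_)
  exact B.nu_vac _ _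

/-- The extension of `1 ⊠ m` over the diagonal. -/
theorem exists_isPure_pair (a b : K) (hab : ∀ k, k = a ∨ k = b) (m : K → B.obj NFinSet.one)
    (hb : a ≠ b → m b = B.vac NFinSet.one) :
    ∃ c : B.obj K, B.IsPure K 1 m c ∧
      B.nu (NFinSet.toOne K) (NFinSet.toOne_surjective K) c = m a := by
  by_cases h : a = b
  · subst h
    have hk : ∀ k, k = a := fun k => (hab k).elim id id
    refine ⟨_, B.isPure_of_subsingleton a hk m, ?_⟩
    rw [← B.nu_comp, B.nu_eq_self _ (fun _ => rfl)]
  -- The unit axiom has `1` at index `0` and the section at index `1`, so `σ` sends `0` to the point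
  -- `b`, which carries the unit.
  · let σ : NFinSet.two → K := fun t => if t = (0 : Fin 2) then b else a
    have σ0 : σ (0 : Fin 2) = b := rfl
    have σ1 : σ (1 : Fin 2) = a := rfl
    have hσ : Function.Bijective σ := by
      constructor
      · intro t t' htt
        change Fin 2 at t t'
        fin_cases t <;> fin_cases t' <;> first | rfl | exact absurd htt h | exact absurd htt.symm h
      · intro k
        obtain rfl | rfl := hab k
        · exact ⟨(1 : Fin 2), rfl⟩
        · exact ⟨(0 : Fin 2), rfl⟩
    obtain ⟨c', hc, hn⟩ := B.unit_tmul (fun k => B.nu (NFinSet.toFiberId _ k)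
      (NFinSet.toFiberId_surjective _ k) (m (σ k))) (by
        rw [σ0, hb h]
        exact B.nu_vac _ _)
    have hp : B.IsPure NFinSet.two 1 (fun t => m (σ t)) c' := by
      unfold FactorizationAlgebra.IsPure
      rw [map_one, one_smul]
      exact hc
    refine ⟨B.nu σ hσ.surjective c', ?_, ?_⟩
    · have := FactorizationAlgebra.IsPure.nu B.toFactorizationAlgebra hσ hp
      rwa [map_one] at this
    · rw [← B.nu_comp]
      refine (hn.trans (B.nu_comp _ _ _ _ _).symm).trans ?_
      rw [B.nu_eq_self _ (fun _ => rfl), σ1]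

end UnitalFactorizationAlgebra

end AHS

namespace AHS

variable {f : ℂ[X]}

/-! ## Multiplication of sections over two disjoint sets of points -/

/-- The equivalence relation on `I ⊔ J` with classes `I` and `J`. -/
abbrev NFinSet.sumRel (I J : NFinSet) : Setoid (NFinSet.sum I J) :=
  (FinNEq.sum I.toNEq J.toNEq).rel

theorem NFinSet.two_cases {p : NFinSet.two → Prop} (h0 : p (0 : Fin 2)) (h1 : p (1 : Fin 2)) :
    ∀ k, p k := by
  intro k
  change Fin 2 at k
  fin_cases k
  · exact h0
  · exact h1

theorem NFinSet.toPart₀_bijective (I J : NFinSet) : Function.Bijective (NFinSet.toPart₀ I J) :=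
  ⟨fun _ _ h => Sum.inl_injective (congrArg Subtype.val h), NFinSet.toPart₀_surjective I J⟩

theorem NFinSet.toPart₁_bijective (I J : NFinSet) : Function.Bijective (NFinSet.toPart₁ I J) :=
  ⟨fun _ _ h => Sum.inr_injective (congrArg Subtype.val h), NFinSet.toPart₁_surjective I J⟩

theorem NFinSet.discrete_le_sumRel (I J : NFinSet) :
    (NFinSet.sum I J).discrete ≤ NFinSet.sumRel I J :=
  fun k _ h => Eq.subst (motive := fun k' => NFinSet.sumRel I J k k') h ((sumRel I J).refl' k)

namespace FactorizationData

variable (B : FactorizationData.{u} f) {I J : NFinSet}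

theorem pair_congr_left (b b' : B.obj I) (c : B.obj J) :
    ∀ k, k ≠ (0 : Fin 2) → B.pair b c k = B.pair b' c k :=
  NFinSet.two_cases (fun h => absurd rfl h) (fun _ => rfl)

theorem pair_congr_right (b : B.obj I) (c c' : B.obj J) :
    ∀ k, k ≠ (1 : Fin 2) → B.pair b c k = B.pair b c' k :=
  NFinSet.two_cases (fun _ => rfl) (fun h => absurd rfl h)

theorem d₂_add_left (b b' : B.obj I) (c : B.obj J) : B.d₂ (b + b') c = B.d₂ b c + B.d₂ b' c := by
  unfold d₂
  rw [← map_add]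
  exact congrArg _ (B.d_add (J := NFinSet.two) (0 : Fin 2) (map_add (B.nu _ _).toFun b b')
    (B.pair_congr_left _ _ _) (B.pair_congr_left _ _ _))

theorem d₂_add_right (b : B.obj I) (c c' : B.obj J) : B.d₂ b (c + c') = B.d₂ b c + B.d₂ b c' := by
  unfold d₂
  rw [← map_add]
  exact congrArg _ (B.d_add (J := NFinSet.two) (1 : Fin 2) (map_add (B.nu _ _).toFun c c')
    (B.pair_congr_right _ _ _) (B.pair_congr_right _ _ _))

theorem d₂_smul_left (s : SX f I.toNEq) (b : B.obj I) (c : B.obj J) :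
    B.d₂ (s • b) c = SX.map (FinNEq.inl I.toNEq J.toNEq) s • B.d₂ b c := by
  unfold d₂
  rw [B.d_smul (J := NFinSet.two) (b' := B.pair b c) (0 : Fin 2) _ (B.nu_smul _ _ s b)
    (B.pair_congr_left _ _ _), DMod.resTo_smul]
  refine congrArg (· • _) ?_
  exact SX.map_map₃ _ _ _ _ (fun _ => rfl) s

theorem d₂_smul_right (s : SX f J.toNEq) (b : B.obj I) (c : B.obj J) :
    B.d₂ b (s • c) = SX.map (FinNEq.inr I.toNEq J.toNEq) s • B.d₂ b c := by
  unfold d₂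
  rw [B.d_smul (J := NFinSet.two) (b' := B.pair b c) (1 : Fin 2) _ (B.nu_smul _ _ s c)
    (B.pair_congr_right _ _ _), DMod.resTo_smul]
  refine congrArg (· • _) ?_
  exact SX.map_map₃ _ _ _ _ (fun _ => rfl) s

theorem nu_der {α : I → J} (hα : Function.Bijective α) (i : I) (b : B.obj I) :
    B.nu α hα.surjective ((B.obj I).der i b) =
      (B.obj J).der (α i) (B.nu α hα.surjective b) := by
  rw [(B.nu α hα.surjective).map_der]
  have e : FinNEq.preim (FinNEq.ofFun α) (α i) = {i} := by
    ext k
    rw [FinNEq.mem_preim, Finset.mem_singleton]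
    exact hα.injective.eq_iff
  rw [e, Finset.sum_singleton]

theorem d₂_der_left (i : I) (b : B.obj I) (c : B.obj J) :
    B.d₂ ((B.obj I).der i b) c =
      ((B.obj (NFinSet.sum I J)).on (I := ⟨_, NFinSet.sumRel I J⟩)).der (Sum.inl i)
        (B.d₂ b c) := by
  unfold d₂
  rw [← DMod.resTo_der]
  exact congrArg _ (B.d_der (I := NFinSet.sum I J) (J := NFinSet.two) (b' := B.pair b c)
    (Sum.inl i) (B.nu_der (NFinSet.toPart₀_bijective I J) i b) (B.pair_congr_left _ _ _))

theorem d₂_der_right (j : J) (b : B.obj I) (c : B.obj J) :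
    B.d₂ b ((B.obj J).der j c) =
      ((B.obj (NFinSet.sum I J)).on (I := ⟨_, NFinSet.sumRel I J⟩)).der (Sum.inr j)
        (B.d₂ b c) := by
  unfold d₂
  rw [← DMod.resTo_der]
  exact congrArg _ (B.d_der (I := NFinSet.sum I J) (J := NFinSet.two) (b' := B.pair b c)
    (Sum.inr j) (B.nu_der (NFinSet.toPart₁_bijective I J) j c) (B.pair_congr_right _ _ _))

/-- The section `d_α(b ⊠ c)` as a bilinear function of `b` and `c`. -/
noncomputable def d₂Lin (I J : NFinSet) : B.obj I →ₗ[ℂ] B.obj J →ₗ[ℂ]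
    (B.obj (NFinSet.sum I J)).on (I := ⟨_, NFinSet.sumRel I J⟩) :=
  LinearMap.mk₂ ℂ B.d₂ B.d₂_add_left
    (fun z b c => by
      rw [← algebraMap_smul (SX f I.toNEq) z b, d₂_smul_left, AlgHom.commutes, algebraMap_smul])
    B.d₂_add_right
    (fun z b c => by
      rw [← algebraMap_smul (SX f J.toNEq) z c, d₂_smul_right, AlgHom.commutes, algebraMap_smul])

/-- A map `p` that arises as a composite equals `part` only propositionally, and the types of its
fibres change with it. This recognises `d_p(x)` as `d₂` from the values of `x` on the two fibres. -/
theorem d₂_eq_d {p : NFinSet.sum I J → NFinSet.two} (hp : Function.Surjective p)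
    (h : p = NFinSet.part I J) {x : ∀ k, B.obj (NFinSet.fiber p hp k)} (b : B.obj I) (c : B.obj J)
    (e₀ : I → NFinSet.fiber p hp (0 : Fin 2)) (e₁ : J → NFinSet.fiber p hp (1 : Fin 2))
    (he₀ : ∀ i, (e₀ i).1 = Sum.inl i) (he₁ : ∀ j, (e₁ j).1 = Sum.inr j)
    (hs₀ : Function.Surjective e₀) (hs₁ : Function.Surjective e₁)
    (hx₀ : x (0 : Fin 2) = B.nu e₀ hs₀ b) (hx₁ : x (1 : Fin 2) = B.nu e₁ hs₁ c)
    (hr : NFinSet.sumRel I J ≤ Setoid.ker p) :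
    B.d₂ b c = DMod.resTo hr (B.obj (NFinSet.sum I J)) (B.d p hp x) := by
  subst h
  obtain rfl : e₀ = NFinSet.toPart₀ I J := funext fun i => Subtype.ext (he₀ i)
  obtain rfl : e₁ = NFinSet.toPart₁ I J := funext fun j => Subtype.ext (he₁ j)
  obtain rfl : x = B.pair b c := funext (NFinSet.two_cases hx₀ hx₁)
  rfl

end FactorizationData

namespace FactorizationAlgebra

variable (B : FactorizationAlgebra.{u} f) {I J I' J' K : NFinSet}

theorem map_toPart₀ (s : SX f I.toNEq) :
    SX.map (FinNEq.fromTop (I := (NFinSet.fiber (NFinSet.part I J) (NFinSet.part_surjective I J)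
      (0 : Fin 2)).toFinSet) (J := ⟨(NFinSet.sum I J).toFinSet, (NFinSet.sum I J).discrete⟩)
      Subtype.val) (SX.map (FinNEq.ofFun (NFinSet.toPart₀ I J)) s) =
    SX.toOpen (NFinSet.sum I J).discrete
      (SX.map (FinNEq.ofFun (I := I.toFinSet) (J := (NFinSet.sum I J).toFinSet) Sum.inl) s) :=
  SX.map_square _ _ _ _ (fun _ => by rfl) s

theorem map_toPart₁ (t : SX f J.toNEq) :
    SX.map (FinNEq.fromTop (I := (NFinSet.fiber (NFinSet.part I J) (NFinSet.part_surjective I J)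
      (1 : Fin 2)).toFinSet) (J := ⟨(NFinSet.sum I J).toFinSet, (NFinSet.sum I J).discrete⟩)
      Subtype.val) (SX.map (FinNEq.ofFun (NFinSet.toPart₁ I J)) t) =
    SX.toOpen (NFinSet.sum I J).discrete
      (SX.map (FinNEq.ofFun (I := J.toFinSet) (J := (NFinSet.sum I J).toFinSet) Sum.inr) t) :=
  SX.map_square _ _ _ _ (fun _ => by rfl) t

/-- The basic computation with the multiplication: off the diagonals, the product of two pure
sections is the product of the scalars times the generator of the juxtaposed family. -/
theorem resTo_d₂ {s : SX f I.toNEq} {m : I → B.obj NFinSet.one} {b : B.obj I}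
    (hb : B.IsPure I s m b) {t : SX f J.toNEq} {n : J → B.obj NFinSet.one} {c : B.obj J}
    (hc : B.IsPure J t n c) :
    DMod.resTo (NFinSet.discrete_le_sumRel I J) (B.obj (NFinSet.sum I J)) (B.d₂ b c) =
      SX.toOpen (NFinSet.sum I J).discrete
        (SX.map (FinNEq.ofFun (I := I.toFinSet) (J := (NFinSet.sum I J).toFinSet) Sum.inl) s *
          SX.map (FinNEq.ofFun (I := J.toFinSet) (J := (NFinSet.sum I J).toFinSet) Sum.inr) t) •
        B.gen (NFinSet.sum I J) (Sum.elim m n) := by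
  unfold FactorizationData.d₂
  rw [DMod.resTo_resTo]
  let σ : ∀ k : NFinSet.two, SX f (NFinSet.fiber (NFinSet.part I J)
      (NFinSet.part_surjective I J) k).toNEq
    | (0 : Fin 2) => SX.map (FinNEq.ofFun (NFinSet.toPart₀ I J)) s
    | (1 : Fin 2) => SX.map (FinNEq.ofFun (NFinSet.toPart₁ I J)) t
  refine (B.resTo_d (NFinSet.part I J) (NFinSet.part_surjective I J) (Sum.elim m n) σ
    (B.pair b c) (NFinSet.two_cases ?_ ?_)).trans ?_
  · exact IsPure.nu B (NFinSet.toPart₀_bijective I J) (m := fun i => Sum.elim m n i.1) hb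
  · exact IsPure.nu B (NFinSet.toPart₁_bijective I J) (m := fun i => Sum.elim m n i.1) hc
  · refine congrArg (· • _) ?_
    refine (finprod_eq_prod_of_fintype (α := Fin 2) _).trans ((Fin.prod_univ_two _).trans ?_)
    rw [map_mul]
    exact congrArg₂ (· * ·) (map_toPart₀ s) (map_toPart₁ t)

theorem sum_map_surjective {σ : I → I'} {τ : J → J'} (hσ : Function.Surjective σ)
    (hτ : Function.Surjective τ) :
    Function.Surjective (Sum.map σ τ : NFinSet.sum I J → NFinSet.sum I' J') :=
  Sum.map_surjective.2 ⟨hσ, hτ⟩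

theorem sumRel_map (σ : I → I') (τ : J → J') (k k' : NFinSet.sum I J)
    (h : NFinSet.sumRel I' J' (Sum.map σ τ k) (Sum.map σ τ k')) : NFinSet.sumRel I J k k' :=
  (FinNEq.sumMap (FinNEq.ofFun σ) (FinNEq.ofFun τ)).map_rel k k' h

theorem nuOn_resTo_d {ρ : I → J} {p : J → K} (hρ : Function.Surjective ρ)
    (hp : Function.Surjective p) {r : Setoid I} {r' : Setoid J} (hr : r ≤ Setoid.ker (p ∘ ρ))
    (hr' : r' ≤ Setoid.ker p) (h : ∀ i i', r' (ρ i) (ρ i') → r i i')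
    (x : ∀ k, B.obj (NFinSet.fiber (p ∘ ρ) (hp.comp hρ) k)) :
    B.nuOn ρ hρ r r' h (DMod.resTo hr (B.obj I) (B.d (p ∘ ρ) (hp.comp hρ) x)) =
      DMod.resTo hr' (B.obj J) (B.d p hp fun k =>
        B.nu (I := NFinSet.fiber (p ∘ ρ) (hp.comp hρ) k) (J := NFinSet.fiber p hp k)
          (fiberMap ρ p k) (fiberMap_surjective hρ p k) (x k)) := by
  rw [← B.nu_d ρ p hρ hp x]
  exact (B.resTo_nuOn (r := Setoid.ker (p ∘ ρ)) (r' := Setoid.ker p) (h := fun _ _ h => h)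
    h hr hr' _).symm

/-- For surjections, naturality is the axiom `nu_d` with the partition of `I' ⊔ J'` as outer map,
once its composite with `σ ⊔ τ` is recognised as the partition of `I ⊔ J`. -/
theorem nuOn_d₂ {σ : I → I'} {τ : J → J'} (hσ : Function.Surjective σ)
    (hτ : Function.Surjective τ) (b : B.obj I) (c : B.obj J) :
    B.nuOn (I := NFinSet.sum I J) (J := NFinSet.sum I' J') (Sum.map σ τ)
      (sum_map_surjective hσ hτ) (NFinSet.sumRel I J) (NFinSet.sumRel I' J') (sumRel_map σ τ)
      (B.d₂ b c) = B.d₂ (B.nu σ hσ b) (B.nu τ hτ c) := by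
  have hp : (NFinSet.part I' J' ∘ Sum.map σ τ : NFinSet.sum I J → NFinSet.two) =
    NFinSet.part I J := by
    funext k
    rcases k with i | j <;> rfl
  have hs := (NFinSet.part_surjective I' J').comp (sum_map_surjective hσ hτ)
  let e₀ : I → NFinSet.fiber (I := NFinSet.sum I J) (NFinSet.part I' J' ∘ Sum.map σ τ) hs
    (0 : Fin 2) := fun i => ⟨Sum.inl i, rfl⟩
  let e₁ : J → NFinSet.fiber (I := NFinSet.sum I J) (NFinSet.part I' J' ∘ Sum.map σ τ) hs
    (1 : Fin 2) := fun j => ⟨Sum.inr j, rfl⟩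
  have hs₀ : Function.Surjective e₀ := by
    rintro ⟨i | j, h⟩
    · exact ⟨i, rfl⟩
    · exact absurd h (by simp [NFinSet.part])
  have hs₁ : Function.Surjective e₁ := by
    rintro ⟨i | j, h⟩
    · exact absurd h (by simp [NFinSet.part])
    · exact ⟨j, rfl⟩
  let x : ∀ k : NFinSet.two, B.obj (NFinSet.fiber (I := NFinSet.sum I J)
      (NFinSet.part I' J' ∘ Sum.map σ τ) hs k)
    | (0 : Fin 2) => B.nu e₀ hs₀ b
    | (1 : Fin 2) => B.nu e₁ hs₁ c
  have hr : NFinSet.sumRel I J ≤ Setoid.ker (NFinSet.part I' J' ∘ Sum.map σ τ) := by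
    rw [hp]
    exact NFinSet.sum_rel_le I J
  rw [B.d₂_eq_d hs hp b c e₀ e₁ (fun _ => rfl) (fun _ => rfl) hs₀ hs₁ (x := x) rfl rfl hr]
  refine (B.nuOn_resTo_d (sum_map_surjective hσ hτ) (NFinSet.part_surjective I' J') hr
    (NFinSet.sum_rel_le I' J') (sumRel_map σ τ) x).trans ?_
  unfold FactorizationData.d₂
  refine congrArg _ (congrArg (B.d _ _) (funext (NFinSet.two_cases ?_ ?_)))
  · exact (B.nu_comp _ _ _ _ _).symm.trans
      (B.nu_comp _ (NFinSet.toPart₀ I' J') _ (NFinSet.toPart₀_surjective I' J') b)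
  · exact (B.nu_comp _ _ _ _ _).symm.trans
      (B.nu_comp _ (NFinSet.toPart₁ I' J') _ (NFinSet.toPart₁_surjective I' J') c)

end FactorizationAlgebra

end AHS

namespace AHS

variable {f : ℂ[X]}

/-! ## Insertion of the unit -/

namespace UnitalFactorizationAlgebra

variable (B : UnitalFactorizationAlgebra.{u} f) {I J K L : NFinSet}

/-- Sections which are the unit at one point of each fibre of `γ : K → L` with two points extend
over the diagonals `x_k = x_k'` for `γ(k) = γ(k')`. -/
theorem exists_resTo_d_eq_gen (γ : K → L) (hγ : Function.Surjective γ) (a b : L → K)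
    (ha : ∀ l, γ (a l) = l) (hb : ∀ l, γ (b l) = l) (hab : ∀ k, k = a (γ k) ∨ k = b (γ k))
    (m : K → B.obj NFinSet.one) (hm : ∀ l, a l ≠ b l → m (b l) = B.vac NFinSet.one) :
    ∃ c : ∀ l : L, B.obj (NFinSet.fiber γ hγ l),
      DMod.resTo (r' := K.discrete) (FactorizationAlgebra.ker_id_le γ) (B.obj K) (B.d γ hγ c) =
        B.gen K m ∧
      ∀ l, B.nu (NFinSet.toOne _) (NFinSet.toOne_surjective _) (c l) = m (a l) := by
  have h : ∀ l : L, ∃ c : B.obj (NFinSet.fiber γ hγ l),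
      B.IsPure (NFinSet.fiber γ hγ l) 1 (fun k => m k.1) c ∧
        B.nu (NFinSet.toOne _) (NFinSet.toOne_surjective _) c = m (a l) := by
    intro l
    refine B.exists_isPure_pair (K := NFinSet.fiber γ hγ l) ⟨a l, ha l⟩ ⟨b l, hb l⟩ ?_ _ ?_
    · rintro ⟨k, rfl⟩
      exact (hab k).imp Subtype.ext Subtype.ext
    · exact fun h => hm l fun h' => h (Subtype.ext h')
  choose c hc hc' using h
  refine ⟨c, ?_, hc'⟩
  rw [B.resTo_d γ hγ m (fun _ => 1) c hc]
  simp only [map_one, finprod_one, one_smul]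

/-- For pure `b`, factorize along the map that identifies `i` with `j` only. The fibre with these
two points carries `m i ⊠ 1`, which extends over the diagonal by the unit axiom; the other fibres
are points. Sums and denominators are then harmless. -/
theorem d₂_vac_extends_pair (b : B.obj I) (i : I) (j : J) :
    ∃ q : SX f (NFinSet.sum I J).toNEq,
      IsUnit (SX.toOpen (FactorizationAlgebra.pairRel (NFinSet.sum I J) (Sum.inl i) (Sum.inr j)) q) ∧
      ∃ c : B.obj (NFinSet.sum I J), SX.toOpen (NFinSet.sum I J).discrete q •
        DMod.resTo (NFinSet.discrete_le_sumRel I J) _ (B.d₂ b (B.vac J)) =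
          DMod.res (I := ⟨_, (NFinSet.sum I J).discrete⟩) c := by
  induction b using B.pure_induction with
  | zero =>
    refine ⟨1, by simp, 0, ?_⟩
    have : B.d₂ (0 : B.obj I) (B.vac J) = 0 := (B.d₂Lin I J).map_zero₂ _
    rw [this, map_zero, smul_zero, DMod.res_zero]
  | add b b' h h' =>
    obtain ⟨q, hq, c, hc⟩ := h
    obtain ⟨q', hq', c', hc'⟩ := h'
    refine ⟨q * q', by rw [map_mul]; exact hq.mul hq', q' • c + q • c', ?_⟩
    rw [DMod.res_add, DMod.res_smul, DMod.res_smul, ← hc, ← hc', B.d₂_add_left, map_add, smul_add,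
      smul_smul, smul_smul, ← map_mul, ← map_mul, mul_comm q']
  | cancel q b hq h =>
    obtain ⟨q', hq', c, hc⟩ := h
    refine ⟨q' * SX.map (FinNEq.ofFun (J := (NFinSet.sum I J).toFinSet) Sum.inl) q, ?_, c, ?_⟩
    · rw [map_mul]
      refine hq'.mul (SX.isUnit_toOpen_map (I := I.toFinSet) (J := (NFinSet.sum I J).toFinSet)
        (r := I.discrete) Sum.inl (fun k k' hk => ?_) hq)
      -- No two elements of `I` are identified by the relation of the pair, so a function of the
      -- coordinates in `I` that is invertible off the diagonals of `X^I` stays invertible near this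
      -- generic point.
      exact Sum.inl_injective (FactorizationAlgebra.eq_of_pairRel Sum.inl_ne_inr Sum.inl_ne_inr hk)
    · rw [← hc, B.d₂_smul_left, DMod.resTo_smul, map_mul, mul_smul]
      congr 2
      exact SX.map_square _ _ _ _ (fun _ => by rfl) q
  | pure s m b hb =>
    obtain ⟨L, γ, t, h1, h2, h3, h4⟩ := FactorizationAlgebra.exists_collapse
      (K := NFinSet.sum I J) (Sum.inl i) (Sum.inr j) Sum.inl_ne_inr
    have hγ : Function.Surjective γ := fun l => ⟨t l, h1 l⟩
    classical
    -- The representatives `t l` never equal `inr j`. Changing the representative to `inr j` in the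
    -- fibre over `γ (inr j)` lists the two points of that fibre, the second one carrying the unit.
    obtain ⟨c, hc, -⟩ := B.exists_resTo_d_eq_gen γ hγ t
      (fun l => if l = γ (Sum.inr j) then Sum.inr j else t l) h1
      (fun l => by split_ifs with h <;> simp [h, h1])
      (fun k => by
        by_cases hk : k = Sum.inr j
        · subst hk; simp
        · exact Or.inl (h3 k hk).symm)
      (Sum.elim m fun _ => B.vac NFinSet.one)
      (fun l hl => by
        split_ifs at hl ⊢
        · rfl
        · exact absurd rfl hl)
    obtain ⟨q, hq, y, hy⟩ := DMod.exists_smul_eq_res (B.d γ hγ c)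
    refine ⟨q, SX.isUnit_toOpen_of_le (fun k k' hk => (h4 k k').2 hk) hq,
      SX.map (FinNEq.ofFun (J := (NFinSet.sum I J).toFinSet) Sum.inl) s • y, ?_⟩
    have hy' := congrArg (DMod.resTo (r' := (NFinSet.sum I J).discrete)
      (FactorizationAlgebra.ker_id_le γ) _) hy
    rw [DMod.resTo_toOpen_smul, hc, DMod.resTo_res] at hy'
    rw [B.resTo_d₂ hb (B.isPure_vac J), DMod.res_smul, ← hy', smul_smul, smul_smul, map_one,
      mul_one, mul_comm]

/-- The extension criterion is applied pair by pair. For two points of `I`, or two of `J`, the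
section `d₂ b 1` is already defined at the generic point of the diagonal; the mixed pairs are
`d₂_vac_extends_pair`. -/
theorem exists_res_eq_d₂_vac (b : B.obj I) (J : NFinSet) :
    ∃ c : B.obj (NFinSet.sum I J),
      DMod.res (I := ⟨_, NFinSet.sumRel I J⟩) c = B.d₂ b (B.vac J) := by
  have hs : ∀ k k', NFinSet.sumRel I J k k' → ∃ q : SX f (NFinSet.sum I J).toNEq,
      IsUnit (SX.toOpen (FactorizationAlgebra.pairRel (NFinSet.sum I J) k k') q) ∧
      ∃ c : B.obj (NFinSet.sum I J), SX.toOpen (NFinSet.sum I J).discrete q •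
        DMod.resTo (NFinSet.discrete_le_sumRel I J) _ (B.d₂ b (B.vac J)) =
          DMod.res (I := ⟨_, (NFinSet.sum I J).discrete⟩) c := by
    intro k k' h
    obtain ⟨q, hq, c, hc⟩ := DMod.exists_smul_eq_res (B.d₂ b (B.vac J))
    refine ⟨q, SX.isUnit_toOpen_of_le (FactorizationAlgebra.pairRel_le h) hq, c, ?_⟩
    have hc' := congrArg (DMod.resTo (NFinSet.discrete_le_sumRel I J) _) hc
    rwa [DMod.resTo_toOpen_smul, DMod.resTo_res] at hc'
  obtain ⟨c, hc⟩ := B.exists_res_of_forall_pair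
    (DMod.resTo (NFinSet.discrete_le_sumRel I J) _ (B.d₂ b (B.vac J))) (by
      rintro (i | j) (i' | j') -
      · exact hs _ _ (.inl trivial)
      · exact B.d₂_vac_extends_pair b i j'
      · obtain ⟨q, hq, h⟩ := B.d₂_vac_extends_pair b i' j
        refine ⟨q, SX.isUnit_toOpen_of_le (FactorizationAlgebra.pairRel_le ?_) hq, h⟩
        exact FactorizationAlgebra.pairRel_self _ _
      · exact hs _ _ (.inr trivial))
  refine ⟨c, (B.noDiagonal _).resTo_injective (NFinSet.discrete_le_sumRel I J) ?_⟩
  rw [hc, DMod.resTo_res]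

/-- The section over `X^{I ⊔ J}` that restricts to `d_α(b ⊠ 1)` on `U(α)`. -/
noncomputable def extVac (J : NFinSet) (b : B.obj I) : B.obj (NFinSet.sum I J) :=
  (B.exists_res_eq_d₂_vac b J).choose

theorem res_extVac (b : B.obj I) :
    DMod.res (I := ⟨_, NFinSet.sumRel I J⟩) (B.extVac J b) = B.d₂ b (B.vac J) :=
  (B.exists_res_eq_d₂_vac b J).choose_spec

theorem eq_extVac {b : B.obj I} {c : B.obj (NFinSet.sum I J)}
    (h : DMod.res (I := ⟨_, NFinSet.sumRel I J⟩) c = B.d₂ b (B.vac J)) : c = B.extVac J b :=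
  (B.noDiagonal _).res_injective (r := NFinSet.sumRel I J) (h.trans (B.res_extVac b).symm)

theorem extVac_add (b b' : B.obj I) : B.extVac J (b + b') = B.extVac J b + B.extVac J b' := by
  refine (B.eq_extVac ?_).symm
  rw [DMod.res_add, res_extVac, res_extVac, B.d₂_add_left]

theorem extVac_smul (s : SX f I.toNEq) (b : B.obj I) :
    B.extVac J (s • b) = SX.map (FinNEq.ofFun (J := (NFinSet.sum I J).toFinSet) Sum.inl) s • B.extVac J b := by
  refine (B.eq_extVac ?_).symm
  rw [DMod.res_smul, res_extVac, B.d₂_smul_left]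
  refine congrArg (· • _) ?_
  exact SX.map_map _ _ _ (fun _ => by rfl) s

theorem extVac_der (i : I) (b : B.obj I) :
    B.extVac J ((B.obj I).der i b) =
      (B.obj (NFinSet.sum I J)).der (Sum.inl i) (B.extVac J b) := by
  refine (B.eq_extVac ?_).symm
  rw [B.d₂_der_left, ← B.res_extVac, DMod.on_der_res]

/-- The unit is horizontal, so the extended section is constant in the new coordinates. This is the
compatibility with `T` for indices outside the image of `I`. -/
theorem der_inr_extVac (j : J) (b : B.obj I) :
    (B.obj (NFinSet.sum I J)).der (Sum.inr j) (B.extVac J b) = 0 := by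
  refine (B.noDiagonal _).eq_zero (r := NFinSet.sumRel I J) ?_
  rw [← DMod.on_der_res, res_extVac, ← B.d₂_der_right, B.der_vac]
  exact map_zero (B.d₂Lin I J b)

theorem isPure_extVac {s : SX f I.toNEq} {m : I → B.obj NFinSet.one} {b : B.obj I}
    (h : B.IsPure I s m b) :
    B.IsPure (NFinSet.sum I J) (SX.map (FinNEq.ofFun (J := (NFinSet.sum I J).toFinSet) Sum.inl) s)
      (Sum.elim m fun _ => B.vac NFinSet.one) (B.extVac J b) := by
  unfold FactorizationAlgebra.IsPure
  have := B.resTo_d₂ h (B.isPure_vac J)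
  rw [← B.res_extVac, DMod.resTo_res, map_one, mul_one] at this
  exact this.symm

theorem isPure_ext {s : SX f I.toNEq} {m : I → B.obj NFinSet.one} {b c : B.obj I}
    (h : B.IsPure I s m b) (h' : B.IsPure I s m c) : b = c :=
  (B.noDiagonal _).res_injective (r := I.discrete) (h.symm.trans h')

/-- The codiagonal `I ⊔ I → I`. -/
def _root_.AHS.NFinSet.fold (I : NFinSet) : NFinSet.sum I I → I := Sum.elim id id

theorem _root_.AHS.NFinSet.fold_surjective (I : NFinSet) : Function.Surjective (NFinSet.fold I) :=
  fun i => ⟨Sum.inl i, rfl⟩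

/-- This is where the second half of the unit axiom enters. For pure `b`, regroup `I ⊔ I` into the
pairs `{inl i, inr i}`: each pair carries `m i ⊠ 1`, whose restriction to the diagonal is `m i`, and
`nu_d` reassembles the generator of `m`. -/
theorem nu_fold_extVac (b : B.obj I) :
    B.nu (NFinSet.fold I) (NFinSet.fold_surjective I) (B.extVac I b) = b := by
  refine B.pure_ext (S := SX f I.toNEq) id
    (AddMonoidHom.mk' (fun b => B.nu (NFinSet.fold I) (NFinSet.fold_surjective I) (B.extVac I b))
      (fun b b' => by rw [extVac_add, map_add])) (AddMonoidHom.id _) ?_ ?_ (fun _ _ => rfl) ?_ b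
  · intro q hq n n' h
    refine (B.noDiagonal I).res_injective (r := I.discrete) ?_
    refine (B.noDiagonal I).smul_left_cancel hq (?_ : _ = SX.toOpen I.discrete q • _)
    rw [← DMod.res_smul, ← DMod.res_smul]
    exact congrArg _ h
  · intro s b
    change B.nu _ _ (B.extVac I (s • b)) = s • B.nu _ _ (B.extVac I b)
    rw [extVac_smul, B.nu_smul, SX.map_map _ _ (𝟙 _) (fun _ => rfl), SX.map_id]
  · intro s m c hc
    change B.nu _ _ (B.extVac I c) = c
    -- Here `x i` is the extension of `m i ⊠ 1` over the fibre of the codiagonal at `i`.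
    obtain ⟨x, hx, hx'⟩ := B.exists_resTo_d_eq_gen (NFinSet.fold I) (NFinSet.fold_surjective I)
      Sum.inl Sum.inr (fun _ => rfl) (fun _ => rfl) (by
        rintro (i | i)
        · exact Or.inl rfl
        · exact Or.inr rfl) (Sum.elim m fun _ => B.vac NFinSet.one) (fun _ _ => rfl)
    have h1 : DMod.res (I := ⟨_, Setoid.ker (NFinSet.fold I)⟩) (B.extVac I c) =
        SX.toOpen (Setoid.ker (NFinSet.fold I)) (SX.map (FinNEq.ofFun (J := (NFinSet.sum I I).toFinSet) Sum.inl) s) •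
          B.d (NFinSet.fold I) (NFinSet.fold_surjective I) x := by
      refine (B.noDiagonal _).resTo_injective (r' := (NFinSet.sum I I).discrete)
        (FactorizationAlgebra.ker_id_le _) ?_
      rw [DMod.resTo_toOpen_smul, hx, DMod.resTo_res]
      exact (B.isPure_extVac hc).symm
    have h2 := congrArg (B.nuOn (NFinSet.fold I) (NFinSet.fold_surjective I)
      (Setoid.ker (NFinSet.fold I)) I.discrete (fun _ _ h => h)) h1
    have h3 := B.nu_d (NFinSet.fold I) id (NFinSet.fold_surjective I) Function.surjective_id x
    rw [B.nuOn_res, B.nuOn_toOpen_smul, SX.map_map _ _ (𝟙 _) (fun _ => rfl), SX.map_id] at h2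
    refine (B.noDiagonal I).res_injective (r := I.discrete) (h2.trans (Eq.trans ?_ hc))
    refine congrArg (SX.toOpen _ s • ·) (h3.trans (congrArg (B.d _ _) (funext fun i => ?_)))
    have h4 : m i = B.nu (NFinSet.toOne _) (NFinSet.toOne_surjective _) (x i) := (hx' i).symm
    rw [h4, ← B.nu_comp]
    refine B.nu_congr _ ?_ _ _
    rintro ⟨k, rfl⟩
    rfl

end UnitalFactorizationAlgebra

end AHS

namespace AHS

variable {f : ℂ[X]}

/-! ## Functoriality in all maps of non-empty finite sets -/

/-- Composition of maps over `α` and `β`. -/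
noncomputable def DMod.SemiHom.comp {I J K : FinNEq} {α : I ⟶ J} {β : J ⟶ K} {γ : I ⟶ K}
    {M : DMod.{u} f I} {N : DMod.{u} f J} {P : DMod.{u} f K} (p : DMod.SemiHom β N P)
    (n : DMod.SemiHom α M N) (h : ∀ i, γ.toFun i = β.toFun (α.toFun i)) :
    DMod.SemiHom γ M P where
  toFun := p.toFun ∘ₗ n.toFun
  map_smul s m := by
    rw [LinearMap.comp_apply, n.map_smul, p.map_smul, SX.map_map α β γ h]
    rfl
  map_der k m := by
    classical
    rw [LinearMap.comp_apply, p.map_der, LinearMap.comp_apply]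
    congr 1
    rw [Finset.sum_congr rfl fun j _ => n.map_der j m, ← map_sum]
    congr 1
    -- The fibre of `γ` over `k` is partitioned by the fibres of `α` over the points `j` with `β(j)
    -- = k`.
    rw [← Finset.sum_fiberwise_of_maps_to (s := FinNEq.preim γ k) (t := FinNEq.preim β k)
      (g := α.toFun) (fun i hi => by simpa [← h] using hi)]
    refine Finset.sum_congr rfl fun j hj => Finset.sum_congr ?_ fun _ _ => rfl
    ext i
    simp only [FinNEq.mem_preim, Finset.mem_filter] at hj ⊢
    constructor
    · rintro rfl
      exact ⟨(h i).trans hj, rfl⟩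
    · exact And.right

namespace FactorizationAlgebra

variable (B : FactorizationAlgebra.{u} f) {I J K : NFinSet}

/-- An injection keeps distinct points distinct. For this reason the extensionality lemmas on pure
sections below ask for an injective `α`: denominators remain cancellable after the change of
coordinates. -/
theorem isUnit_discrete_map {α : I → J} (hα : Function.Injective α) {q : SX f I.toNEq}
    (hq : IsUnit (SX.toOpen I.discrete q)) :
    IsUnit (SX.toOpen J.discrete (SX.map (FinNEq.ofFun α) q)) :=
  SX.isUnit_toOpen_map (I := I.toFinSet) (J := J.toFinSet) (r := I.discrete) (r' := J.discrete) α
    (fun _ _ h => hα h) hq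

theorem pure_ext_obj {α : I → J} (hα : Function.Injective α) (F G : B.obj I →+ B.obj J)
    (hF : ∀ (s : SX f I.toNEq) b, F (s • b) = SX.map (FinNEq.ofFun α) s • F b)
    (hG : ∀ (s : SX f I.toNEq) b, G (s • b) = SX.map (FinNEq.ofFun α) s • G b)
    (h : ∀ s m c, B.IsPure I s m c → F c = G c) (b : B.obj I) : F b = G b := by
  refine B.pure_ext (S := SX f J.toNEq) (SX.map (FinNEq.ofFun α)) F G (fun q hq n n' hn => ?_)
    hF hG h b
  refine (B.noDiagonal J).res_injective (r := J.discrete) ?_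
  refine (B.noDiagonal J).smul_left_cancel (isUnit_discrete_map hα hq)
    (?_ : _ = SX.toOpen J.discrete _ • _)
  rw [← DMod.res_smul, ← DMod.res_smul]
  exact congrArg _ hn

theorem pure_ext_on {α : I → J} (hα : Function.Injective α) {r : Setoid J}
    (F G : B.obj I →+ (B.obj J).on (I := ⟨J.toFinSet, r⟩))
    (hF : ∀ (s : SX f I.toNEq) b, F (s • b) = SX.toOpen r (SX.map (FinNEq.ofFun α) s) • F b)
    (hG : ∀ (s : SX f I.toNEq) b, G (s • b) = SX.toOpen r (SX.map (FinNEq.ofFun α) s) • G b)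
    (h : ∀ s m c, B.IsPure I s m c → F c = G c) (b : B.obj I) : F b = G b := by
  refine B.pure_ext (S := SX f ⟨J.toFinSet, r⟩)
    (fun s => SX.toOpen r (SX.map (FinNEq.ofFun α) s)) F G (fun q hq n n' hn => ?_) hF hG h b
  exact (B.noDiagonal J).smul_left_cancel (isUnit_discrete_map hα hq) hn

end FactorizationAlgebra

namespace UnitalFactorizationAlgebra

variable (B : UnitalFactorizationAlgebra.{u} f) {I J K I' J' : NFinSet}

/-- The image restricts to `d₂ (ν_σ b) 1` by naturality of `d₂` for surjections, and such an
extension is unique. -/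
theorem nu_sum_map_extVac {σ : I → I'} {τ : J → J'} (hσ : Function.Surjective σ)
    (hτ : Function.Surjective τ) (b : B.obj I) :
    B.nu (I := NFinSet.sum I J) (J := NFinSet.sum I' J') (Sum.map σ τ)
      (FactorizationAlgebra.sum_map_surjective hσ hτ) (B.extVac J b) =
      B.extVac J' (B.nu σ hσ b) := by
  refine B.eq_extVac ?_
  rw [← B.nu_vac τ hτ, ← B.nuOn_d₂ hσ hτ, ← B.res_extVac, B.nuOn_res]

theorem sum_assoc_bijective (I J K : NFinSet) : Function.Bijective
    (Equiv.sumAssoc I J K : NFinSet.sum (NFinSet.sum I J) K → NFinSet.sum I (NFinSet.sum J K)) :=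
  (Equiv.sumAssoc I J K).bijective

/-- On pure sections both sides have the same family: `m` on `I`, and the unit at all other points.
-/
theorem nu_assoc_extVac (b : B.obj I) :
    B.nu (I := NFinSet.sum (NFinSet.sum I J) K) (J := NFinSet.sum I (NFinSet.sum J K))
      (Equiv.sumAssoc I J K) (sum_assoc_bijective I J K).surjective
      (B.extVac K (B.extVac J b)) = B.extVac (NFinSet.sum J K) b := by
  refine B.pure_ext_obj (α := Sum.inl) Sum.inl_injective
    (AddMonoidHom.mk' (fun b => B.nu (I := NFinSet.sum (NFinSet.sum I J) K)
      (J := NFinSet.sum I (NFinSet.sum J K)) (Equiv.sumAssoc I J K)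
      (sum_assoc_bijective I J K).surjective (B.extVac K (B.extVac J b)))
      (fun b b' => by rw [extVac_add, extVac_add, map_add]))
    (AddMonoidHom.mk' (B.extVac (NFinSet.sum J K)) B.extVac_add) ?_ ?_ ?_ b
  · intro s b
    change B.nu _ _ (B.extVac K (B.extVac J (s • b))) = _ • B.nu _ _ (B.extVac K (B.extVac J b))
    rw [extVac_smul, extVac_smul, B.nu_smul]
    refine congrArg (· • _) ?_
    exact SX.map_map₃ _ _ _ _ (fun _ => by rfl) s
  · intro s b
    exact B.extVac_smul s b
  · intro s m c hc
    have h1 := FactorizationAlgebra.IsPure.nu B.toFactorizationAlgebra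
      (I := NFinSet.sum (NFinSet.sum I J) K) (J := NFinSet.sum I (NFinSet.sum J K))
      (sum_assoc_bijective I J K) (m := Sum.elim m fun _ => B.vac NFinSet.one)
      (s := SX.map (FinNEq.ofFun (J := (NFinSet.sum (NFinSet.sum I J) K).toFinSet) Sum.inl)
        (SX.map (FinNEq.ofFun (J := (NFinSet.sum I J).toFinSet) Sum.inl) s))
      (c := B.extVac K (B.extVac J c)) (by
        convert B.isPure_extVac (J := K) (B.isPure_extVac (J := J) hc) using 1
        funext k
        rcases k with (i | j) | k <;> rfl)
    rw [SX.map_map₃ _ _ _ (FinNEq.ofFun Sum.inl) (fun _ => rfl)] at h1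
    exact B.isPure_ext h1 (B.isPure_extVac hc)

/-- The map `[α, id] : I ⊔ J → J`. -/
def _root_.AHS.NFinSet.foldMap (α : I → J) : NFinSet.sum I J → J := Sum.elim α id

theorem _root_.AHS.NFinSet.foldMap_surjective (α : I → J) :
    Function.Surjective (NFinSet.foldMap α) := fun j => ⟨Sum.inr j, rfl⟩

/-- `B.extVac J` with its compatibilities. -/
noncomputable def extVacSemi (I J : NFinSet) :
    DMod.SemiHom (FinNEq.ofFun (I := I.toFinSet) (J := (NFinSet.sum I J).toFinSet) Sum.inl)
      (B.obj I) (B.obj (NFinSet.sum I J)) where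
  toFun :=
    { toFun := B.extVac J
      map_add' := B.extVac_add
      map_smul' := fun z b => by
        rw [← algebraMap_smul (SX f I.toNEq) z b, extVac_smul, AlgHom.commutes, algebraMap_smul]
        rfl }
  map_smul := B.extVac_smul
  map_der k b := by
    change (B.obj (NFinSet.sum I J)).der k (B.extVac J b) = B.extVac J _
    rcases k with i | j
    · have e : FinNEq.preim (FinNEq.ofFun (I := I.toFinSet) (J := (NFinSet.sum I J).toFinSet)
          Sum.inl) (Sum.inl i) = {i} := by
        ext k
        rw [FinNEq.mem_preim, Finset.mem_singleton]
        exact Sum.inl_injective.eq_iff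
      rw [e, Finset.sum_singleton, extVac_der]
    · have e : FinNEq.preim (FinNEq.ofFun (I := I.toFinSet) (J := (NFinSet.sum I J).toFinSet)
          Sum.inl) (Sum.inr j) = ∅ := by
        ext k
        rw [FinNEq.mem_preim]
        exact ⟨fun h => absurd h Sum.inl_ne_inr, fun h => absurd h (Finset.notMem_empty k)⟩
      rw [e, Finset.sum_empty, der_inr_extVac]
      exact (by simpa using B.extVac_add (J := J) (0 : B.obj I) 0 : B.extVac J (0 : B.obj I) = 0).symm

/-- The map `B(X^I) → B(X^J)` for an arbitrary map `α : I → J`. -/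
noncomputable def vmap (α : I → J) : DMod.SemiHom (FinNEq.ofFun α) (B.obj I) (B.obj J) :=
  DMod.SemiHom.comp (B.nu (NFinSet.foldMap α) (NFinSet.foldMap_surjective α)) (B.extVacSemi I J)
    (fun _ => rfl)

theorem vmap_apply (α : I → J) (b : B.obj I) :
    B.vmap α b = B.nu (NFinSet.foldMap α) (NFinSet.foldMap_surjective α) (B.extVac J b) := rfl

theorem vmap_id (b : B.obj I) : B.vmap (id : I → I) b = b := B.nu_fold_extVac b

theorem extVac_eq_nu_sum_map {τ : J → J'} (hτ : Function.Surjective τ) (b : B.obj I) :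
    B.extVac J' b = B.nu (I := NFinSet.sum I J) (J := NFinSet.sum I J') (Sum.map id τ)
      (FactorizationAlgebra.sum_map_surjective Function.surjective_id hτ) (B.extVac J b) := by
  rw [B.nu_sum_map_extVac Function.surjective_id hτ, B.nu_eq_self (α := id) _ (fun _ => rfl)]

/-- Units over `J` are the image under `ν` of units over `I`, so both sides become restrictions of
`extVac I b` along one and the same map `I ⊔ I → J`. -/
theorem vmap_of_surjective {α : I → J} (hα : Function.Surjective α) (b : B.obj I) :
    B.vmap α b = B.nu α hα b := by
  rw [vmap_apply, B.extVac_eq_nu_sum_map hα, ← B.nu_comp]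
  conv_rhs => rw [← B.nu_fold_extVac b, ← B.nu_comp]
  exact B.nu_congr _ (by rintro (i | i) <;> rfl) _ _

/-- Moving all insertions of units inside, both sides become `ν` of the section `b` with units
inserted over `J` and then `K`, along two maps `(I ⊔ J) ⊔ K → K` that agree pointwise. -/
theorem vmap_comp (α : I → J) (β : J → K) (b : B.obj I) :
    B.vmap (β ∘ α) b = B.vmap β (B.vmap α b) := by
  rw [vmap_apply, vmap_apply, vmap_apply,
    B.extVac_eq_nu_sum_map (NFinSet.foldMap_surjective β) b, ← B.nu_assoc_extVac,
    ← B.nu_comp, ← B.nu_comp, ← B.nu_sum_map_extVac _ Function.surjective_id, ← B.nu_comp]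
  exact B.nu_congr _ (by rintro ((i | j) | k) <;> rfl) _ _

/-- Replacing `b` on the right by `ν` of `extVac I b` makes both sides restrictions of `b` with
units inserted over `I` and then `J`. -/
theorem vmap_inl (b : B.obj I) :
    B.vmap (J := NFinSet.sum I J) Sum.inl b = B.extVac J b := by
  rw [vmap_apply, ← B.nu_assoc_extVac, ← B.nu_comp]
  conv_rhs => rw [← B.nu_fold_extVac b]
  rw [← B.nu_sum_map_extVac (NFinSet.fold_surjective I) Function.surjective_id]
  exact B.nu_congr _ (by rintro ((i | j) | k) <;> rfl) _ _

theorem vmap_vac (α : I → J) : B.vmap α (B.vac I) = B.vac J := by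
  have h : B.extVac J (B.vac I) = B.vac (NFinSet.sum I J) := by
    have h1 := B.isPure_extVac (J := J) (B.isPure_vac I)
    rw [map_one, show (Sum.elim (fun _ => B.vac NFinSet.one) (fun _ => B.vac NFinSet.one) :
      NFinSet.sum I J → B.obj NFinSet.one) = fun _ => B.vac NFinSet.one from by
        funext k; rcases k with i | j <;> rfl] at h1
    exact B.isPure_ext h1 (B.isPure_vac _)
  rw [vmap_apply, h, B.nu_vac]

end UnitalFactorizationAlgebra

end AHS

namespace AHS

variable {f : ℂ[X]}

/-! ## Singular multiplications given on global sections -/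

namespace FinNEq

theorem sum_rel_le (I J : FinNEq) : (I.sum J).rel ≤ (I.set.toNEq.sum J.set.toNEq).rel := by
  rintro (i | j) (i' | j') h
  · exact .inl trivial
  · cases h
  · cases h
  · exact .inr trivial

end FinNEq

namespace DMod

/-- A bilinear map `M × N → P` over `X^I × X^J`, with values that may have poles along the
diagonals between the two factors, compatible with functions and vector fields. -/
structure Pairing {I J : FinSet} (M : DMod.{u} f I.toNEq) (N : DMod.{u} f J.toNEq)
    (P : DMod.{u} f (I.toNEq.sum J.toNEq).set.toNEq) where
  toFun : M →ₗ[ℂ] N →ₗ[ℂ] P.on (I := I.toNEq.sum J.toNEq)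
  smul_left : ∀ (s : SX f I.toNEq) (m : M) (n : N),
    toFun (s • m) n = SX.map (FinNEq.inl I.toNEq J.toNEq) s • toFun m n
  smul_right : ∀ (s : SX f J.toNEq) (m : M) (n : N),
    toFun m (s • n) = SX.map (FinNEq.inr I.toNEq J.toNEq) s • toFun m n
  der_left : ∀ (i : I) (m : M) (n : N),
    toFun (M.der i m) n = (P.on (I := I.toNEq.sum J.toNEq)).der (Sum.inl i) (toFun m n)
  der_right : ∀ (j : J) (m : M) (n : N),
    toFun m (N.der j n) = (P.on (I := I.toNEq.sum J.toNEq)).der (Sum.inr j) (toFun m n)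

namespace Pairing

variable {I J : FinNEq} {M : DMod.{u} f I.set.toNEq} {N : DMod.{u} f J.set.toNEq}
  {P : DMod.{u} f (I.sum J).set.toNEq} (b : Pairing M N P)

/-- Auxiliary: `s ⊗ m ↦ (n ↦ s • b(m, n))`. -/
noncomputable def onLeft : M.on (I := I) →+ N →+ P.on (I := I.sum J) :=
  BaseChange.liftAdd
    (AddMonoidHom.mk' (fun s => AddMonoidHom.mk' (fun m => AddMonoidHom.mk' (fun n =>
          SX.map (FinNEq.inl I J) s • resTo (FinNEq.sum_rel_le I J) P (b.toFun m n))
        (fun n n' => by rw [map_add, map_add, smul_add]))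
      (fun m m' => by ext n; simp [smul_add]))
      (fun s s' => by ext m n; simp [add_smul]))
    (fun r s m => by
      ext n
      change SX.map (FinNEq.inl I J) (SX.map I.toSelf r * s) • _ =
        SX.map (FinNEq.inl I J) s • resTo (FinNEq.sum_rel_le I J) P (b.toFun (r • m) n)
      rw [b.smul_left, resTo_smul, smul_smul, map_mul, mul_comm]
      refine congrArg (fun t => (_ * t) • _) ?_
      exact SX.map_square _ _ _ _ (fun _ => by rfl) r)

theorem onLeft_res (m : M) (n : N) :
    b.onLeft (res m) n = resTo (FinNEq.sum_rel_le I J) P (b.toFun m n) := by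
  change SX.map (FinNEq.inl I J) (1 : SX f I) • resTo (FinNEq.sum_rel_le I J) P (b.toFun m n) = _
  rw [map_one, one_smul]

theorem onLeft_smul (s : SX f I) (x : M.on (I := I)) (n : N) :
    b.onLeft (s • x) n = SX.map (FinNEq.inl I J) s • b.onLeft x n := by
  induction x using pull_induction with
  | zero => simp
  | tmul t m =>
    change SX.map (FinNEq.inl I J) (s * t) • resTo (FinNEq.sum_rel_le I J) P (b.toFun m n) =
      _ • SX.map (FinNEq.inl I J) t • resTo (FinNEq.sum_rel_le I J) P (b.toFun m n)
    rw [map_mul, mul_smul]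
  | add x y hx hy => simp only [smul_add, map_add, AddMonoidHom.add_apply, hx, hy]

theorem onLeft_smul_right (s : SX f J.set.toNEq) (x : M.on (I := I)) (n : N) :
    b.onLeft x (s • n) = SX.map (FinNEq.inr I J) (SX.map J.toSelf s) • b.onLeft x n := by
  induction x using pull_induction with
  | zero => simp
  | tmul t m =>
    rw [tmul_eq_smul_res, onLeft_smul, onLeft_smul, onLeft_res, onLeft_res, b.smul_right,
      resTo_smul, smul_smul, smul_smul, mul_comm]
    refine congrArg (fun t => (t * _) • _) ?_
    exact SX.map_square _ _ _ _ (fun _ => by rfl) s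
  | add x y hx hy => simp only [smul_add, map_add, AddMonoidHom.add_apply, hx, hy]

/-- Auxiliary: `t ⊗ n ↦ (x ↦ t • b(x, n))`. -/
noncomputable def onRight : N.on (I := J) →+ M.on (I := I) →+ P.on (I := I.sum J) :=
  BaseChange.liftAdd
    (AddMonoidHom.mk' (fun t => AddMonoidHom.mk' (fun n => AddMonoidHom.mk' (fun x =>
          SX.map (FinNEq.inr I J) t • b.onLeft x n)
        (fun n n' => by rw [map_add, AddMonoidHom.add_apply, smul_add]))
      (fun m m' => by ext n; simp [smul_add]))
      (fun s s' => by ext m n; simp [add_smul]))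
    (fun r t n => by
      ext x
      change SX.map (FinNEq.inr I J) (SX.map J.toSelf r * t) • _ =
        SX.map (FinNEq.inr I J) t • b.onLeft x (r • n)
      rw [onLeft_smul_right, smul_smul, map_mul, mul_comm])

theorem onRight_tmul (t : SX f J) (n : N) (x : M.on (I := I)) :
    b.onRight (tmul J.toSelf t n) x = SX.map (FinNEq.inr I J) t • b.onLeft x n := rfl

theorem onRight_smul (s : SX f J) (y : N.on (I := J)) (x : M.on (I := I)) :
    b.onRight (s • y) x = SX.map (FinNEq.inr I J) s • b.onRight y x := by
  induction y using pull_induction with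
  | zero => simp
  | tmul t n => rw [smul_tmul, onRight_tmul, onRight_tmul, map_mul, mul_smul]
  | add x y hx hy => simp only [smul_add, map_add, AddMonoidHom.add_apply, hx, hy]

theorem onRight_smul_right (s : SX f I) (y : N.on (I := J)) (x : M.on (I := I)) :
    b.onRight y (s • x) = SX.map (FinNEq.inl I J) s • b.onRight y x := by
  induction y using pull_induction with
  | zero => simp
  | tmul t n => rw [onRight_tmul, onRight_tmul, onLeft_smul, smul_smul, smul_smul, mul_comm]
  | add x y hx hy => simp only [smul_add, map_add, AddMonoidHom.add_apply, hx, hy]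

/-- The extension `(s ⊗ m, t ⊗ n) ↦ s t • b(m, n)` to sections over open subsets. -/
noncomputable def on : M.on (I := I) →ₗ[ℂ] N.on (I := J) →ₗ[ℂ] P.on (I := I.sum J) :=
  LinearMap.mk₂ ℂ (fun x y => b.onRight y x)
    (fun x x' y => map_add _ _ _)
    (fun z x y => by
      rw [← algebraMap_smul (SX f I) z x, onRight_smul_right, AlgHom.commutes, algebraMap_smul])
    (fun x y y' => by rw [map_add, AddMonoidHom.add_apply])
    (fun z x y => by
      rw [← algebraMap_smul (SX f J) z y, onRight_smul, AlgHom.commutes, algebraMap_smul])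

theorem on_res (m : M) (n : N) :
    b.on (I := I) (J := J) (res m) (res n) =
      resTo (FinNEq.sum_rel_le I J) P (b.toFun m n) := by
  refine (b.onRight_tmul 1 n (res m)).trans ?_
  rw [map_one, one_smul, onLeft_res]

theorem on_smul_left (s : SX f I) (x : M.on (I := I)) (y : N.on (I := J)) :
    b.on (s • x) y = SX.map (FinNEq.inl I J) s • b.on x y := b.onRight_smul_right s y x

theorem on_smul_right (s : SX f J) (x : M.on (I := I)) (y : N.on (I := J)) :
    b.on x (s • y) = SX.map (FinNEq.inr I J) s • b.on x y := b.onRight_smul s y x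

theorem der_inl (i : I) (s : SX f I) :
    SX.der (I := I.sum J) (Sum.inl i) (SX.map (FinNEq.inl I J) s) =
      SX.map (FinNEq.inl I J) (SX.der i s) := by
  have e : FinNEq.preim (FinNEq.inl I J) (Sum.inl i) = {i} := by
    ext k
    rw [FinNEq.mem_preim, Finset.mem_singleton]
    exact Sum.inl_injective.eq_iff
  rw [SX.der_map, e, Finset.sum_singleton]

theorem der_inr (j : J) (s : SX f J) :
    SX.der (I := I.sum J) (Sum.inr j) (SX.map (FinNEq.inr I J) s) =
      SX.map (FinNEq.inr I J) (SX.der j s) := by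
  have e : FinNEq.preim (FinNEq.inr I J) (Sum.inr j) = {j} := by
    ext k
    rw [FinNEq.mem_preim, Finset.mem_singleton]
    exact Sum.inr_injective.eq_iff
  rw [SX.der_map, e, Finset.sum_singleton]

theorem der_inl_inr (i : I) (s : SX f J) :
    SX.der (I := I.sum J) (Sum.inl i) (SX.map (FinNEq.inr I J) s) = 0 := by
  have e : FinNEq.preim (FinNEq.inr I J) (Sum.inl i) = ∅ := by
    ext k
    rw [FinNEq.mem_preim]
    exact ⟨fun h => absurd h Sum.inr_ne_inl, fun h => absurd h (Finset.notMem_empty k)⟩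
  rw [SX.der_map, e, Finset.sum_empty, map_zero]

theorem der_inr_inl (j : J) (s : SX f I) :
    SX.der (I := I.sum J) (Sum.inr j) (SX.map (FinNEq.inl I J) s) = 0 := by
  have e : FinNEq.preim (FinNEq.inl I J) (Sum.inr j) = ∅ := by
    ext k
    rw [FinNEq.mem_preim]
    exact ⟨fun h => absurd h Sum.inl_ne_inr, fun h => absurd h (Finset.notMem_empty k)⟩
  rw [SX.der_map, e, Finset.sum_empty, map_zero]

theorem on_der_left (i : I) (x : M.on (I := I)) (y : N.on (I := J)) :
    b.on ((M.on (I := I)).der i x) y = (P.on (I := I.sum J)).der (Sum.inl i) (b.on x y) := by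
  induction x using pull_induction with
  | zero => simp
  | add x x' hx hx' => simp only [map_add, LinearMap.add_apply, hx, hx']
  | tmul s m =>
    induction y using pull_induction with
    | zero => simp
    | add y y' hy hy' => simp only [map_add, hy, hy']
    | tmul t n =>
      have h : (M.on (I := I)).der i (res m) = res (M.der i m) :=
        DMod.on_der_res (I := I.set) (r := I.rel) M i m
      have h' := resTo_der (M := P) (FinNEq.sum_rel_le I J) (Sum.inl i) (b.toFun m n)
      rw [tmul_eq_smul_res, tmul_eq_smul_res, DMod.der_smul, h, map_add, LinearMap.add_apply]
      simp only [on_smul_left, on_smul_right, on_res, DMod.der_smul, der_inl, der_inl_inr,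
        b.der_left, h', zero_smul, zero_add, smul_add]

theorem on_der_right (j : J) (x : M.on (I := I)) (y : N.on (I := J)) :
    b.on x ((N.on (I := J)).der j y) = (P.on (I := I.sum J)).der (Sum.inr j) (b.on x y) := by
  induction x using pull_induction with
  | zero => simp
  | add x x' hx hx' => simp only [map_add, LinearMap.add_apply, hx, hx']
  | tmul s m =>
    induction y using pull_induction with
    | zero => simp
    | add y y' hy hy' => simp only [map_add, hy, hy']
    | tmul t n =>
      have h : (N.on (I := J)).der j (res n) = res (N.der j n) :=
        DMod.on_der_res (I := J.set) (r := J.rel) N j n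
      have h' := resTo_der (M := P) (FinNEq.sum_rel_le I J) (Sum.inr j) (b.toFun m n)
      rw [tmul_eq_smul_res, tmul_eq_smul_res, DMod.der_smul, h, map_add]
      simp only [on_smul_left, on_smul_right, on_res, DMod.der_smul, der_inr, der_inr_inl,
        b.der_right, h', zero_smul, zero_add]

/-- Bilinear maps over open subsets which are compatible with functions are determined by their
values on global sections. -/
theorem on_ext₂ {K : FinNEq} {Z : Type*} [AddCommGroup Z] [Module (SX f K) Z] (α : I ⟶ K)
    (β : J ⟶ K) (F G : M.on (I := I) → N.on (I := J) → Z)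
    (hF : ∀ x x' y, F (x + x') y = F x y + F x' y) (hF' : ∀ x y y', F x (y + y') = F x y + F x y')
    (hG : ∀ x x' y, G (x + x') y = G x y + G x' y) (hG' : ∀ x y y', G x (y + y') = G x y + G x y')
    (sF : ∀ (s : SX f I) x y, F (s • x) y = SX.map α s • F x y)
    (sF' : ∀ (s : SX f J) x y, F x (s • y) = SX.map β s • F x y)
    (sG : ∀ (s : SX f I) x y, G (s • x) y = SX.map α s • G x y)
    (sG' : ∀ (s : SX f J) x y, G x (s • y) = SX.map β s • G x y)
    (h : ∀ m n, F (res m) (res n) = G (res m) (res n)) (x : M.on (I := I)) (y : N.on (I := J)) :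
    F x y = G x y := by
  refine on_ext α (AddMonoidHom.mk' (F · y) fun x x' => hF x x' y)
    (AddMonoidHom.mk' (G · y) fun x x' => hG x x' y) (fun s x => sF s x y) (fun s x => sG s x y)
    (fun m => ?_) x
  exact on_ext β (AddMonoidHom.mk' (F (res m)) (hF' _))
    (AddMonoidHom.mk' (G (res m)) (hG' _)) (fun s y => sF' s _ y) (fun s y => sG' s _ y)
    (fun n => h m n) y

end Pairing

end DMod

end AHS

namespace AHS

variable {f : ℂ[X]}

/-! ## The singular multiplication on non-empty sets -/

theorem NFinSet.discrete_le {K : NFinSet} (r : Setoid K) : K.discrete ≤ r :=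
  fun k _ h => Eq.subst (motive := fun k' => r k k') h (r.refl' k)

namespace FactorizationData

variable (B : FactorizationData.{u} f) {I J : NFinSet}

/-- The maps `(b, c) ↦ d_α(b ⊠ c)` as a pairing. -/
noncomputable def pairing (I J : NFinSet) :
    DMod.Pairing (B.obj I) (B.obj J) (B.obj (NFinSet.sum I J)) where
  toFun := B.d₂Lin I J
  smul_left := B.d₂_smul_left
  smul_right := B.d₂_smul_right
  der_left := B.d₂_der_left
  der_right := B.d₂_der_right

theorem d₂_toOpen_smul_left (s : SX f I.toNEq) (b : B.obj I) (c : B.obj J) :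
    B.d₂ (s • b) c = SX.toOpen (NFinSet.sumRel I J)
      (SX.map (FinNEq.ofFun (J := (NFinSet.sum I J).toFinSet) Sum.inl) s) • B.d₂ b c := by
  rw [d₂_smul_left]
  refine congrArg (· • _) ?_
  exact (SX.map_map _ _ _ (fun _ => by rfl) s).symm

theorem d₂_toOpen_smul_right (s : SX f J.toNEq) (b : B.obj I) (c : B.obj J) :
    B.d₂ b (s • c) = SX.toOpen (NFinSet.sumRel I J)
      (SX.map (FinNEq.ofFun (J := (NFinSet.sum I J).toFinSet) Sum.inr) s) • B.d₂ b c := by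
  rw [d₂_smul_right]
  refine congrArg (· • _) ?_
  exact (SX.map_map _ _ _ (fun _ => by rfl) s).symm

/-- The product of sections over `U(I, r)` and `U(J, r')`. -/
noncomputable def mulOn (r : Setoid I) (r' : Setoid J) :
    (B.obj I).on (I := ⟨I.toFinSet, r⟩) →ₗ[ℂ] (B.obj J).on (I := ⟨J.toFinSet, r'⟩) →ₗ[ℂ]
      (B.obj (NFinSet.sum I J)).on (I := FinNEq.sum ⟨I.toFinSet, r⟩ ⟨J.toFinSet, r'⟩) :=
  DMod.Pairing.on (I := ⟨I.toFinSet, r⟩) (J := ⟨J.toFinSet, r'⟩) (B.pairing I J)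

variable {r : Setoid I} {r' : Setoid J}

/-- The relation on the disjoint union. -/
abbrev _root_.AHS.NFinSet.sumRel' (r : Setoid I) (r' : Setoid J) : Setoid (NFinSet.sum I J) :=
  (FinNEq.sum ⟨I.toFinSet, r⟩ ⟨J.toFinSet, r'⟩).rel

theorem mulOn_res (b : B.obj I) (c : B.obj J) :
    B.mulOn r r' (DMod.res b) (DMod.res c) =
      DMod.resTo (FinNEq.sum_rel_le ⟨I.toFinSet, r⟩ ⟨J.toFinSet, r'⟩) _ (B.d₂ b c) :=
  DMod.Pairing.on_res (I := ⟨I.toFinSet, r⟩) (J := ⟨J.toFinSet, r'⟩) (B.pairing I J) b c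

theorem mulOn_toOpen_smul_left (s : SX f I.toNEq) (x : (B.obj I).on (I := ⟨I.toFinSet, r⟩))
    (y : (B.obj J).on (I := ⟨J.toFinSet, r'⟩)) :
    B.mulOn r r' (SX.toOpen r s • x) y = SX.toOpen (NFinSet.sumRel' r r')
      (SX.map (FinNEq.ofFun (J := (NFinSet.sum I J).toFinSet) Sum.inl) s) • B.mulOn r r' x y := by
  refine (DMod.Pairing.on_smul_left (I := ⟨I.toFinSet, r⟩) (J := ⟨J.toFinSet, r'⟩)
    (B.pairing I J) _ x y).trans ?_
  refine congrArg (· • B.mulOn r r' x y) ?_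
  exact SX.map_square _ _ _ _ (fun _ => by rfl) s

theorem mulOn_toOpen_smul_right (s : SX f J.toNEq) (x : (B.obj I).on (I := ⟨I.toFinSet, r⟩))
    (y : (B.obj J).on (I := ⟨J.toFinSet, r'⟩)) :
    B.mulOn r r' x (SX.toOpen r' s • y) = SX.toOpen (NFinSet.sumRel' r r')
      (SX.map (FinNEq.ofFun (J := (NFinSet.sum I J).toFinSet) Sum.inr) s) • B.mulOn r r' x y := by
  refine (DMod.Pairing.on_smul_right (I := ⟨I.toFinSet, r⟩) (J := ⟨J.toFinSet, r'⟩)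
    (B.pairing I J) _ x y).trans ?_
  refine congrArg (· • B.mulOn r r' x y) ?_
  exact SX.map_square _ _ _ _ (fun _ => by rfl) s

end FactorizationData

namespace FactorizationAlgebra

variable (B : FactorizationAlgebra.{u} f) {I J K : NFinSet}

/-- The section `y` over `U(K, r)` restricts to `s • d_id(⊠_k m_k)` outside of all diagonals. -/
def IsPureOn (K : NFinSet) (r : Setoid K) (s : SX f K.toNEq) (m : K → B.obj NFinSet.one)
    (y : (B.obj K).on (I := ⟨K.toFinSet, r⟩)) : Prop :=
  DMod.resTo (NFinSet.discrete_le r) (B.obj K) y = SX.toOpen K.discrete s • B.gen K m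

variable {B}

theorem IsPure.isPureOn {r : Setoid K} {s : SX f K.toNEq} {m : K → B.obj NFinSet.one} {c : B.obj K}
    (h : B.IsPure K s m c) : B.IsPureOn K r s m (DMod.res c) := by
  unfold IsPureOn
  rw [DMod.resTo_res]
  exact h.symm

namespace IsPureOn

variable {r : Setoid K} {s t : SX f K.toNEq} {m n : K → B.obj NFinSet.one}
  {x y : (B.obj K).on (I := ⟨K.toFinSet, r⟩)}

theorem isPure {c : B.obj K} (h : B.IsPureOn K r s m (DMod.res c)) : B.IsPure K s m c := by
  unfold IsPureOn at h
  rw [DMod.resTo_res] at h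
  exact h.symm

theorem unique (h : B.IsPureOn K r s m x) (h' : B.IsPureOn K r t n y) (hs : s = t) (hm : m = n) :
    x = y := by
  subst hs hm
  exact (B.noDiagonal K).resTo_injective (NFinSet.discrete_le r) (h.trans h'.symm)

theorem smul (h : B.IsPureOn K r s m x) (q : SX f K.toNEq) :
    B.IsPureOn K r (q * s) m (SX.toOpen r q • x) := by
  unfold IsPureOn at *
  rw [DMod.resTo_toOpen_smul, h, smul_smul, map_mul]

theorem cancel {q : SX f K.toNEq} (hq : IsUnit (SX.toOpen K.discrete q))
    (h : B.IsPureOn K r (q * s) m (SX.toOpen r q • x)) : B.IsPureOn K r s m x := by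
  unfold IsPureOn at *
  rw [DMod.resTo_toOpen_smul, map_mul, mul_smul] at h
  exact hq.smul_left_cancel.1 h

theorem nuOn {σ : K → J} (hσ : Function.Bijective σ) {m : J → B.obj NFinSet.one} {r' : Setoid J}
    {h : ∀ i i', r' (σ i) (σ i') → r i i'} (hx : B.IsPureOn K r s (fun k => m (σ k)) x) :
    B.IsPureOn J r' (SX.map (FinNEq.ofFun σ) s) m (B.nuOn σ hσ.surjective r r' h x) := by
  unfold IsPureOn at *
  refine (B.resTo_nuOn (α := σ) (hα := hσ.surjective) (r := r) (r' := r') (h := h)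
    (r₁ := K.discrete) (r₁' := J.discrete) (fun i i' hi => hσ.injective hi)
    (NFinSet.discrete_le r) (NFinSet.discrete_le r') x).trans ?_
  rw [hx, B.nuOn_toOpen_smul, B.nuOn_gen hσ]

/-- Functions `q` and `q'` make both factors global, where `resTo_d₂` applies. They remain
invertible off the diagonals of `I ⊔ J`, so they cancel at the end. -/
theorem mulOn {r : Setoid I} {s : SX f I.toNEq} {m : I → B.obj NFinSet.one}
    {x : (B.obj I).on (I := ⟨I.toFinSet, r⟩)} (hx : B.IsPureOn I r s m x)
    {r' : Setoid J} {t : SX f J.toNEq} {n : J → B.obj NFinSet.one}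
    {y : (B.obj J).on (I := ⟨J.toFinSet, r'⟩)} (hy : B.IsPureOn J r' t n y) :
    B.IsPureOn (NFinSet.sum I J) (NFinSet.sumRel' r r')
      (SX.map (FinNEq.ofFun (J := (NFinSet.sum I J).toFinSet) Sum.inl) s *
        SX.map (FinNEq.ofFun (J := (NFinSet.sum I J).toFinSet) Sum.inr) t)
      (Sum.elim m n) (B.mulOn r r' x y) := by
  obtain ⟨q, hq, b, hb⟩ := DMod.exists_smul_eq_res x
  obtain ⟨q', hq', c, hc⟩ := DMod.exists_smul_eq_res y
  have h1 := hx.smul q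
  have h2 := hy.smul q'
  rw [hb] at h1
  rw [hc] at h2
  have h3 := B.resTo_d₂ h1.isPure h2.isPure
  have hu := isUnit_discrete_map (J := NFinSet.sum I J) (α := Sum.inl) Sum.inl_injective
    (SX.isUnit_toOpen_of_le (NFinSet.discrete_le r) hq)
  have hu' := isUnit_discrete_map (J := NFinSet.sum I J) (α := Sum.inr) Sum.inr_injective
    (SX.isUnit_toOpen_of_le (NFinSet.discrete_le r') hq')
  refine cancel hu (cancel hu' ?_)
  rw [← B.mulOn_toOpen_smul_left, ← B.mulOn_toOpen_smul_right, hb, hc, B.mulOn_res]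
  unfold IsPureOn
  rw [DMod.resTo_resTo, h3]
  simp only [map_mul]
  congr 1
  ring

end IsPureOn

end FactorizationAlgebra

namespace UnitalFactorizationAlgebra

open FactorizationAlgebra

variable (B : UnitalFactorizationAlgebra.{u} f) {I J K I' J' : NFinSet}

/-- The maps `B(X^I) → B(X^J)` on open subsets. -/
noncomputable def vmapOn (α : I → J) (r : Setoid I) (r' : Setoid J)
    (h : ∀ i i', r' (α i) (α i') → r i i') :
    DMod.SemiHom (I := ⟨I.toFinSet, r⟩) (J := ⟨J.toFinSet, r'⟩) (FinNEq.Hom.mk α h)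
      ((B.obj I).on (I := ⟨I.toFinSet, r⟩)) ((B.obj J).on (I := ⟨J.toFinSet, r'⟩)) :=
  DMod.SemiHom.on (I := ⟨I.toFinSet, r⟩) (J := ⟨J.toFinSet, r'⟩) (FinNEq.Hom.mk α h) (B.vmap α)

section vmapOn

variable {α : I → J} {r : Setoid I} {r' : Setoid J} {h : ∀ i i', r' (α i) (α i') → r i i'}

@[simp] theorem vmapOn_res (b : B.obj I) :
    B.vmapOn α r r' h (DMod.res b) = DMod.res (B.vmap α b) :=
  DMod.SemiHom.on_res _ _ _

theorem vmapOn_toOpen_smul (s : SX f I.toNEq) (x : (B.obj I).on (I := ⟨I.toFinSet, r⟩)) :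
    B.vmapOn α r r' h (SX.toOpen r s • x) =
      SX.toOpen r' (SX.map (FinNEq.ofFun α) s) • B.vmapOn α r r' h x :=
  DMod.SemiHom.map_toOpen_smul _ _ _ _

theorem vmapOn_of_surjective (hα : Function.Surjective α)
    (x : (B.obj I).on (I := ⟨I.toFinSet, r⟩)) :
    B.vmapOn α r r' h x = B.nuOn α hα r r' h x := by
  induction x using DMod.pull_induction with
  | zero => rw [map_zero, map_zero]
  | add x y hx hy => rw [map_add, map_add, hx, hy]
  | tmul s m =>
    rw [DMod.tmul_eq_smul_res, (B.vmapOn α r r' h).map_smul, (B.nuOn α hα r r' h).map_smul,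
      vmapOn_res, B.nuOn_res, B.vmap_of_surjective hα]

/-- An inclusion multiplies by the unit on the new points, also for sections over open subsets:
clear a denominator and use `vmap_inl`. -/
theorem isPureOn_vmapOn_inl {x : (B.obj I).on (I := ⟨I.toFinSet, r⟩)} {s : SX f I.toNEq}
    {m : I → B.obj NFinSet.one} (hx : B.IsPureOn I r s m x) {r' : Setoid (NFinSet.sum I J)}
    {h : ∀ i i', r' (Sum.inl i) (Sum.inl i') → r i i'} :
    B.IsPureOn (NFinSet.sum I J) r'
      (SX.map (FinNEq.ofFun (J := (NFinSet.sum I J).toFinSet) Sum.inl) s)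
      (Sum.elim m fun _ => B.vac NFinSet.one)
      (B.vmapOn (J := NFinSet.sum I J) Sum.inl r r' h x) := by
  obtain ⟨q, hq, b, hb⟩ := DMod.exists_smul_eq_res x
  have h1 := hx.smul q
  rw [hb] at h1
  have hu := isUnit_discrete_map (J := NFinSet.sum I J) (α := Sum.inl) Sum.inl_injective
    (SX.isUnit_toOpen_of_le (NFinSet.discrete_le r) hq)
  refine IsPureOn.cancel hu ?_
  rw [← vmapOn_toOpen_smul, hb, vmapOn_res, vmap_inl, ← map_mul]
  exact (B.isPure_extVac h1.isPure).isPureOn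

end vmapOn

theorem isPureOn_d₂ {s : SX f I.toNEq} {m : I → B.obj NFinSet.one} {b : B.obj I}
    (hb : B.IsPure I s m b) {t : SX f J.toNEq} {n : J → B.obj NFinSet.one} {c : B.obj J}
    (hc : B.IsPure J t n c) :
    B.IsPureOn (NFinSet.sum I J) (NFinSet.sumRel I J)
      (SX.map (FinNEq.ofFun (J := (NFinSet.sum I J).toFinSet) Sum.inl) s *
        SX.map (FinNEq.ofFun (J := (NFinSet.sum I J).toFinSet) Sum.inr) t)
      (Sum.elim m n) (B.d₂ b c) :=
  B.resTo_d₂ hb hc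

theorem sum_swap_bijective (I J : NFinSet) :
    Function.Bijective (Sum.swap : NFinSet.sum I J → NFinSet.sum J I) :=
  (Equiv.sumComm I J).bijective

/-- With `b` and then `c` reduced to pure sections, both sides have the family that is `n` on `J`
and `m` on `I`, and scalars that differ by the order of two factors. -/
theorem vmapOn_swap_d₂ (b : B.obj I) (c : B.obj J)
    (h : ∀ i i' : NFinSet.sum I J, NFinSet.sumRel J I i.swap i'.swap → NFinSet.sumRel I J i i') :
    B.vmapOn (I := NFinSet.sum I J) (J := NFinSet.sum J I) Sum.swap (NFinSet.sumRel I J)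
      (NFinSet.sumRel J I) h (B.d₂ b c) = B.d₂ c b := by
  refine B.pure_ext_on (J := NFinSet.sum J I) (α := Sum.inr) Sum.inr_injective
    (AddMonoidHom.mk' (fun b => B.vmapOn (I := NFinSet.sum I J) (J := NFinSet.sum J I) Sum.swap
      (NFinSet.sumRel I J) (NFinSet.sumRel J I) h (B.d₂ b c))
      (fun b b' => by rw [B.d₂_add_left, map_add]))
    (AddMonoidHom.mk' (fun b => B.d₂ c b) (B.d₂_add_right c)) ?_ ?_ ?_ b
  · intro s b
    change B.vmapOn _ _ _ h (B.d₂ (s • b) c) = _ • B.vmapOn _ _ _ h (B.d₂ b c)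
    rw [B.d₂_toOpen_smul_left, vmapOn_toOpen_smul]
    refine congrArg (SX.toOpen _ · • _) ?_
    exact SX.map_map _ _ _ (fun _ => by rfl) s
  · intro s b
    exact B.d₂_toOpen_smul_right s c b
  intro s m b hb
  refine B.pure_ext_on (J := NFinSet.sum J I) (α := Sum.inl) Sum.inl_injective
    (AddMonoidHom.mk' (fun c => B.vmapOn (I := NFinSet.sum I J) (J := NFinSet.sum J I) Sum.swap
      (NFinSet.sumRel I J) (NFinSet.sumRel J I) h (B.d₂ b c))
      (fun c c' => by rw [B.d₂_add_right, map_add]))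
    (AddMonoidHom.mk' (fun c => B.d₂ c b) (fun c c' => B.d₂_add_left c c' b)) ?_ ?_ ?_ c
  · intro s c
    change B.vmapOn _ _ _ h (B.d₂ b (s • c)) = _ • B.vmapOn _ _ _ h (B.d₂ b c)
    rw [B.d₂_toOpen_smul_right, vmapOn_toOpen_smul]
    refine congrArg (SX.toOpen _ · • _) ?_
    exact SX.map_map _ _ _ (fun _ => by rfl) s
  · intro s c
    exact B.d₂_toOpen_smul_left s c b
  intro t n c hc
  change B.vmapOn _ _ _ h (B.d₂ b c) = B.d₂ c b
  rw [B.vmapOn_of_surjective (sum_swap_bijective I J).surjective]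
  refine IsPureOn.unique (IsPureOn.nuOn (sum_swap_bijective I J) (m := Sum.elim n m)
    (s := SX.map (FinNEq.ofFun (J := (NFinSet.sum I J).toFinSet) Sum.inl) s *
        SX.map (FinNEq.ofFun (J := (NFinSet.sum I J).toFinSet) Sum.inr) t) ?_)
    (B.isPureOn_d₂ hc hb) ?_ rfl
  · convert B.isPureOn_d₂ hb hc using 1
    funext k
    rcases k with i | j <;> rfl
  · rw [map_mul, mul_comm]
    exact congrArg₂ (· * ·) (SX.map_map _ _ _ (fun _ => by rfl) t)
      (SX.map_map _ _ _ (fun _ => by rfl) s)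

end UnitalFactorizationAlgebra

end AHS

/-! ### Associativity, and naturality of the multiplication for all maps -/

namespace AHS

variable {f : ℂ[X]}

namespace UnitalFactorizationAlgebra

open FactorizationAlgebra

variable (B : UnitalFactorizationAlgebra.{u} f) {I J K I' J' : NFinSet}

/-- The three arguments are made pure one after the other. Then both sides are a product of three
scalars times the generator of the concatenation of three families. -/
theorem vmapOn_assoc_mulOn (b : B.obj I) (c : B.obj J) (e : B.obj K)
    (h : ∀ i i' : NFinSet.sum (NFinSet.sum I J) K,
      NFinSet.sumRel' (J := NFinSet.sum J K) (⊤ : Setoid I) (NFinSet.sumRel J K)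
        (Equiv.sumAssoc I J K i) (Equiv.sumAssoc I J K i') →
      NFinSet.sumRel' (I := NFinSet.sum I J) (NFinSet.sumRel I J) (⊤ : Setoid K) i i') :
    B.vmapOn (I := NFinSet.sum (NFinSet.sum I J) K) (J := NFinSet.sum I (NFinSet.sum J K))
      (Equiv.sumAssoc I J K)
      (NFinSet.sumRel' (I := NFinSet.sum I J) (NFinSet.sumRel I J) (⊤ : Setoid K))
      (NFinSet.sumRel' (J := NFinSet.sum J K) (⊤ : Setoid I) (NFinSet.sumRel J K)) h
      (B.mulOn (I := NFinSet.sum I J) (NFinSet.sumRel I J) ⊤ (B.d₂ b c) (DMod.res e)) =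
    B.mulOn (J := NFinSet.sum J K) ⊤ (NFinSet.sumRel J K) (DMod.res b) (B.d₂ c e) := by
  refine B.pure_ext_on (J := NFinSet.sum I (NFinSet.sum J K)) (α := Sum.inl) Sum.inl_injective
    (AddMonoidHom.mk' (fun b => B.vmapOn (I := NFinSet.sum (NFinSet.sum I J) K)
      (J := NFinSet.sum I (NFinSet.sum J K)) (Equiv.sumAssoc I J K)
      (NFinSet.sumRel' (I := NFinSet.sum I J) (NFinSet.sumRel I J) (⊤ : Setoid K))
      (NFinSet.sumRel' (J := NFinSet.sum J K) (⊤ : Setoid I) (NFinSet.sumRel J K)) h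
      (B.mulOn (I := NFinSet.sum I J) (NFinSet.sumRel I J) ⊤ (B.d₂ b c) (DMod.res e)))
      (fun b b' => by rw [B.d₂_add_left, map_add, LinearMap.add_apply, map_add]))
    (AddMonoidHom.mk' (fun b => B.mulOn (J := NFinSet.sum J K) ⊤ (NFinSet.sumRel J K) (DMod.res b)
      (B.d₂ c e)) (fun b b' => by rw [DMod.res_add, map_add, LinearMap.add_apply])) ?_ ?_ ?_ b
  · intro s b
    change B.vmapOn _ _ _ h (B.mulOn _ _ (B.d₂ (s • b) c) _) = _ • B.vmapOn _ _ _ h _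
    rw [B.d₂_toOpen_smul_left, B.mulOn_toOpen_smul_left, vmapOn_toOpen_smul]
    refine congrArg (SX.toOpen _ · • _) ?_
    exact SX.map_map₃ _ _ _ _ (fun _ => by rfl) s
  · intro s b
    change B.mulOn _ _ (DMod.res (s • b)) _ = _
    rw [DMod.res_smul (I := I.toFinSet), B.mulOn_toOpen_smul_left]
    rfl
  intro s m b hb
  refine B.pure_ext_on (J := NFinSet.sum I (NFinSet.sum J K)) (α := fun j => Sum.inr (Sum.inl j))
    (Sum.inr_injective.comp Sum.inl_injective)
    (AddMonoidHom.mk' (fun c => B.vmapOn (I := NFinSet.sum (NFinSet.sum I J) K)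
      (J := NFinSet.sum I (NFinSet.sum J K)) (Equiv.sumAssoc I J K)
      (NFinSet.sumRel' (I := NFinSet.sum I J) (NFinSet.sumRel I J) (⊤ : Setoid K))
      (NFinSet.sumRel' (J := NFinSet.sum J K) (⊤ : Setoid I) (NFinSet.sumRel J K)) h
      (B.mulOn (I := NFinSet.sum I J) (NFinSet.sumRel I J) ⊤ (B.d₂ b c) (DMod.res e)))
      (fun b b' => by rw [B.d₂_add_right, map_add, LinearMap.add_apply, map_add]))
    (AddMonoidHom.mk' (fun c => B.mulOn (J := NFinSet.sum J K) ⊤ (NFinSet.sumRel J K) (DMod.res b)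
      (B.d₂ c e)) (fun b b' => by rw [B.d₂_add_left, map_add])) ?_ ?_ ?_ c
  · intro s c
    change B.vmapOn _ _ _ h (B.mulOn _ _ (B.d₂ b (s • c)) _) = _ • B.vmapOn _ _ _ h _
    rw [B.d₂_toOpen_smul_right, B.mulOn_toOpen_smul_left, vmapOn_toOpen_smul]
    refine congrArg (SX.toOpen _ · • _) ?_
    exact SX.map_map₃ _ _ _ _ (fun _ => by rfl) s
  · intro s c
    change B.mulOn _ _ _ (B.d₂ (s • c) e) = _ • B.mulOn _ _ _ _
    rw [B.d₂_toOpen_smul_left, B.mulOn_toOpen_smul_right]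
    refine congrArg (SX.toOpen _ · • _) ?_
    exact SX.map_map _ _ _ (fun _ => by rfl) s
  intro t n c hc
  refine B.pure_ext_on (J := NFinSet.sum I (NFinSet.sum J K)) (α := fun j => Sum.inr (Sum.inr j))
    (Sum.inr_injective.comp Sum.inr_injective)
    (AddMonoidHom.mk' (fun e => B.vmapOn (I := NFinSet.sum (NFinSet.sum I J) K)
      (J := NFinSet.sum I (NFinSet.sum J K)) (Equiv.sumAssoc I J K)
      (NFinSet.sumRel' (I := NFinSet.sum I J) (NFinSet.sumRel I J) (⊤ : Setoid K))
      (NFinSet.sumRel' (J := NFinSet.sum J K) (⊤ : Setoid I) (NFinSet.sumRel J K)) h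
      (B.mulOn (I := NFinSet.sum I J) (NFinSet.sumRel I J) ⊤ (B.d₂ b c) (DMod.res e)))
      (fun b b' => by rw [DMod.res_add, map_add, map_add]))
    (AddMonoidHom.mk' (fun e => B.mulOn (J := NFinSet.sum J K) ⊤ (NFinSet.sumRel J K) (DMod.res b)
      (B.d₂ c e)) (fun b b' => by rw [B.d₂_add_right, map_add])) ?_ ?_ ?_ e
  · intro s e
    change B.vmapOn _ _ _ h (B.mulOn _ _ _ (DMod.res (s • e))) = _ • B.vmapOn _ _ _ h _
    rw [DMod.res_smul (I := K.toFinSet), B.mulOn_toOpen_smul_right, vmapOn_toOpen_smul]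
    refine congrArg (SX.toOpen _ · • _) ?_
    exact SX.map_map _ _ _ (fun _ => by rfl) s
  · intro s e
    change B.mulOn _ _ _ (B.d₂ c (s • e)) = _ • B.mulOn _ _ _ _
    rw [B.d₂_toOpen_smul_right, B.mulOn_toOpen_smul_right]
    refine congrArg (SX.toOpen _ · • _) ?_
    exact SX.map_map _ _ _ (fun _ => by rfl) s
  intro w p e he
  change B.vmapOn _ _ _ h _ = _
  rw [B.vmapOn_of_surjective (sum_assoc_bijective I J K).surjective]
  have h1 := IsPureOn.mulOn (I := NFinSet.sum I J) (B.isPureOn_d₂ hb hc)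
    (he.isPureOn (r := (⊤ : Setoid K)))
  have h2 := IsPureOn.mulOn (J := NFinSet.sum J K) (hb.isPureOn (r := (⊤ : Setoid I)))
    (B.isPureOn_d₂ hc he)
  refine IsPureOn.unique (IsPureOn.nuOn (sum_assoc_bijective I J K)
    (s := SX.map (FinNEq.ofFun (J := (NFinSet.sum (NFinSet.sum I J) K).toFinSet) Sum.inl)
      (SX.map (FinNEq.ofFun (J := (NFinSet.sum I J).toFinSet) Sum.inl) s *
        SX.map (FinNEq.ofFun (J := (NFinSet.sum I J).toFinSet) Sum.inr) t) *
      SX.map (FinNEq.ofFun (J := (NFinSet.sum (NFinSet.sum I J) K).toFinSet) Sum.inr) w)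
    (m := Sum.elim m (Sum.elim n p)) ?_) h2 ?_ rfl
  · convert h1 using 1
    funext k
    rcases k with (i | j) | k <;> rfl
  · simp only [map_mul, mul_assoc]
    refine congrArg₂ (· * ·) ?_ (congrArg₂ (· * ·) ?_ ?_)
    · exact SX.map_map₃ _ _ _ _ (fun _ => by rfl) s
    · refine (SX.map_map₃ _ _ _ (FinNEq.ofFun fun j => Sum.inr (Sum.inl j)) (fun _ => by rfl)
        t).trans (SX.map_map _ _ _ (fun _ => by rfl) t).symm
    · exact SX.map_square _ _ _ _ (fun _ => by rfl) w

/-- The middle-four interchange `(I ⊔ J) ⊔ (I' ⊔ J') → (I ⊔ I') ⊔ (J ⊔ J')`. -/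
def _root_.AHS.NFinSet.shuffle (I J I' J' : NFinSet) :
    NFinSet.sum (NFinSet.sum I J) (NFinSet.sum I' J') →
      NFinSet.sum (NFinSet.sum I I') (NFinSet.sum J J') :=
  Equiv.sumSumSumComm I J I' J'

theorem _root_.AHS.NFinSet.shuffle_bijective (I J I' J' : NFinSet) :
    Function.Bijective (NFinSet.shuffle I J I' J') :=
  (Equiv.sumSumSumComm I J I' J').bijective

theorem _root_.AHS.NFinSet.sumRel_shuffle_inl (k k' : NFinSet.sum I J)
    (h : NFinSet.sumRel (NFinSet.sum I I') (NFinSet.sum J J')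
      (NFinSet.shuffle I J I' J' (Sum.inl k)) (NFinSet.shuffle I J I' J' (Sum.inl k'))) :
    NFinSet.sumRel I J k k' := by
  rcases k with i | j <;> rcases k' with i' | j' <;> cases h
  · exact .inl trivial
  · exact .inr trivial

/-- Inserting units into a product is, up to a permutation of points, the product of the factors
with units inserted: on pure sections the families coincide. The relation on the middle set is
pulled back along the shuffle, so that the shuffle identifies the two open sets. -/
theorem nuOn_shuffle_d₂ (b : B.obj I) (c : B.obj J) :
    B.nuOn (NFinSet.shuffle I J I' J') (NFinSet.shuffle_bijective I J I' J').surjective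
      (Setoid.comap (NFinSet.shuffle I J I' J')
        (NFinSet.sumRel (NFinSet.sum I I') (NFinSet.sum J J')))
      (NFinSet.sumRel (NFinSet.sum I I') (NFinSet.sum J J')) (fun _ _ h => h)
      (B.vmapOn (J := NFinSet.sum (NFinSet.sum I J) (NFinSet.sum I' J')) Sum.inl
        (NFinSet.sumRel I J) _ NFinSet.sumRel_shuffle_inl (B.d₂ b c)) =
      B.d₂ (B.extVac I' b) (B.extVac J' c) := by
  refine B.pure_ext_on (J := NFinSet.sum (NFinSet.sum I I') (NFinSet.sum J J'))
    (α := fun i => Sum.inl (Sum.inl i)) (Sum.inl_injective.comp Sum.inl_injective)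
    (AddMonoidHom.mk' (fun b => B.nuOn (NFinSet.shuffle I J I' J')
      (NFinSet.shuffle_bijective I J I' J').surjective _
      (NFinSet.sumRel (NFinSet.sum I I') (NFinSet.sum J J')) (fun _ _ h => h)
      (B.vmapOn (J := NFinSet.sum (NFinSet.sum I J) (NFinSet.sum I' J')) Sum.inl
        (NFinSet.sumRel I J) _ NFinSet.sumRel_shuffle_inl (B.d₂ b c)))
      (fun b b' => by rw [B.d₂_add_left, map_add, map_add]))
    (AddMonoidHom.mk' (fun b => B.d₂ (B.extVac I' b) (B.extVac J' c))
      (fun b b' => by rw [B.extVac_add, B.d₂_add_left])) ?_ ?_ ?_ b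
  · intro s b
    change B.nuOn _ _ _ _ _ (B.vmapOn _ _ _ _ (B.d₂ (s • b) c)) = _ • B.nuOn _ _ _ _ _ _
    rw [B.d₂_toOpen_smul_left, vmapOn_toOpen_smul, B.nuOn_toOpen_smul]
    refine congrArg (SX.toOpen _ · • _) ?_
    exact SX.map_map₃ _ _ _ _ (fun _ => by rfl) s
  · intro s b
    change B.d₂ (B.extVac I' (s • b)) _ = _ • B.d₂ _ _
    rw [B.extVac_smul, B.d₂_toOpen_smul_left]
    refine congrArg (SX.toOpen _ · • _) ?_
    exact SX.map_map _ _ _ (fun _ => by rfl) s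
  intro s m b hb
  refine B.pure_ext_on (J := NFinSet.sum (NFinSet.sum I I') (NFinSet.sum J J'))
    (α := fun j => Sum.inr (Sum.inl j)) (Sum.inr_injective.comp Sum.inl_injective)
    (AddMonoidHom.mk' (fun c => B.nuOn (NFinSet.shuffle I J I' J')
      (NFinSet.shuffle_bijective I J I' J').surjective _
      (NFinSet.sumRel (NFinSet.sum I I') (NFinSet.sum J J')) (fun _ _ h => h)
      (B.vmapOn (J := NFinSet.sum (NFinSet.sum I J) (NFinSet.sum I' J')) Sum.inl
        (NFinSet.sumRel I J) _ NFinSet.sumRel_shuffle_inl (B.d₂ b c)))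
      (fun b b' => by rw [B.d₂_add_right, map_add, map_add]))
    (AddMonoidHom.mk' (fun c => B.d₂ (B.extVac I' b) (B.extVac J' c))
      (fun b b' => by rw [B.extVac_add, B.d₂_add_right])) ?_ ?_ ?_ c
  · intro s c
    change B.nuOn _ _ _ _ _ (B.vmapOn _ _ _ _ (B.d₂ b (s • c))) = _ • B.nuOn _ _ _ _ _ _
    rw [B.d₂_toOpen_smul_right, vmapOn_toOpen_smul, B.nuOn_toOpen_smul]
    refine congrArg (SX.toOpen _ · • _) ?_
    exact SX.map_map₃ _ _ _ _ (fun _ => by rfl) s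
  · intro s c
    change B.d₂ _ (B.extVac J' (s • c)) = _ • B.d₂ _ _
    rw [B.extVac_smul, B.d₂_toOpen_smul_right]
    refine congrArg (SX.toOpen _ · • _) ?_
    exact SX.map_map _ _ _ (fun _ => by rfl) s
  intro t n c hc
  change B.nuOn _ _ _ _ _ _ = B.d₂ _ _
  have h1 := B.isPureOn_vmapOn_inl (J := NFinSet.sum I' J') (B.isPureOn_d₂ hb hc)
    (r' := Setoid.comap (NFinSet.shuffle I J I' J')
      (NFinSet.sumRel (NFinSet.sum I I') (NFinSet.sum J J'))) (h := NFinSet.sumRel_shuffle_inl)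
  refine IsPureOn.unique (IsPureOn.nuOn (NFinSet.shuffle_bijective I J I' J')
    (m := Sum.elim (Sum.elim m fun _ => B.vac NFinSet.one)
      (Sum.elim n fun _ => B.vac NFinSet.one))
    (s := SX.map (FinNEq.ofFun
      (J := (NFinSet.sum (NFinSet.sum I J) (NFinSet.sum I' J')).toFinSet) Sum.inl)
      (SX.map (FinNEq.ofFun (J := (NFinSet.sum I J).toFinSet) Sum.inl) s *
        SX.map (FinNEq.ofFun (J := (NFinSet.sum I J).toFinSet) Sum.inr) t)) ?_)
    (B.isPureOn_d₂ (B.isPure_extVac hb) (B.isPure_extVac hc)) ?_ rfl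
  · convert h1 using 1
    funext k
    rcases k with (i | j) | (i | j) <;> rfl
  · simp only [map_mul]
    refine congrArg₂ (· * ·) ?_ ?_
    · exact (SX.map_map₃ _ _ _ (FinNEq.ofFun fun i => Sum.inl (Sum.inl i)) (fun _ => by rfl)
        s).trans (SX.map_map _ _ _ (fun _ => by rfl) s).symm
    · exact (SX.map_map₃ _ _ _ (FinNEq.ofFun fun i => Sum.inr (Sum.inl i)) (fun _ => by rfl)
        t).trans (SX.map_map _ _ _ (fun _ => by rfl) t).symm

/-- This factors `α ⊔ β` into the insertion of units, a permutation, and a surjection of the form `σ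
⊔ τ`, for each of which the effect on products is known. -/
theorem vmap_sum_map (α : I → I') (β : J → J') (y : B.obj (NFinSet.sum I J)) :
    B.vmap (J := NFinSet.sum I' J') (Sum.map α β) y =
      B.nu (I := NFinSet.sum (NFinSet.sum I I') (NFinSet.sum J J')) (J := NFinSet.sum I' J')
        (Sum.map (NFinSet.foldMap α) (NFinSet.foldMap β))
        (sum_map_surjective (NFinSet.foldMap_surjective α) (NFinSet.foldMap_surjective β))
        (B.nu (NFinSet.shuffle I J I' J') (NFinSet.shuffle_bijective I J I' J').surjective
          (B.vmap (J := NFinSet.sum (NFinSet.sum I J) (NFinSet.sum I' J')) Sum.inl y)) := by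
  rw [vmap_inl, vmap_apply, ← B.nu_comp]
  exact B.nu_congr _ (by rintro ((i | j) | (i | j)) <;> rfl) _ _

/-- On the right, `nuOn_d₂` extracts the surjections and `nuOn_shuffle_d₂` the units; what remains
is the factorization `vmap_sum_map` on open subsets. -/
theorem vmapOn_sum_map_d₂ (α : I → I') (β : J → J') (b : B.obj I) (c : B.obj J) :
    B.vmapOn (I := NFinSet.sum I J) (J := NFinSet.sum I' J') (Sum.map α β) (NFinSet.sumRel I J)
      (NFinSet.sumRel I' J') (sumRel_map α β) (B.d₂ b c) =
      B.d₂ (B.vmap α b) (B.vmap β c) := by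
  rw [vmap_apply, vmap_apply, ← B.nuOn_d₂ (NFinSet.foldMap_surjective α)
    (NFinSet.foldMap_surjective β), ← nuOn_shuffle_d₂]
  -- The two composites now agree on every section over the open subset, so the product can be
  -- replaced by an arbitrary one.
  induction B.d₂ b c using DMod.pull_induction with
  | zero => simp only [map_zero]
  | add x y hx hy => simp only [map_add, hx, hy]
  | tmul s m =>
    rw [DMod.tmul_eq_smul_res, (B.vmapOn (I := NFinSet.sum I J) _ _ _ _).map_smul,
      (B.vmapOn (I := NFinSet.sum I J) _ _ _ _).map_smul,
      (B.nuOn (I := NFinSet.sum (NFinSet.sum I J) (NFinSet.sum I' J')) _ _ _ _ _).map_smul,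
      (B.nuOn (I := NFinSet.sum (NFinSet.sum I I') (NFinSet.sum J J')) _ _ _ _ _).map_smul,
      vmapOn_res, vmapOn_res, B.nuOn_res, B.nuOn_res, vmap_sum_map]
    refine congrArg (· • _) ?_
    refine (SX.map_map₃ _ _ _ _ ?_ s).symm
    rintro (i | j) <;> rfl

theorem res_vmap_inl (b : B.obj I) :
    DMod.res (I := ⟨_, NFinSet.sumRel I J⟩) (B.vmap (J := NFinSet.sum I J) Sum.inl b) =
      B.d₂ b (B.vac J) := by
  rw [vmap_inl, res_extVac]

/-- This is `res_vmap_inl` transported by commutativity. -/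
theorem res_vmap_inr (c : B.obj J) :
    DMod.res (I := ⟨_, NFinSet.sumRel I J⟩) (B.vmap (J := NFinSet.sum I J) Sum.inr c) =
      B.d₂ (B.vac I) c := by
  refine Eq.trans ?_ (B.vmapOn_swap_d₂ c (B.vac I) (FinNEq.sumSwap J.toNEq I.toNEq).map_rel)
  rw [← res_vmap_inl]
  refine Eq.trans ?_ (B.vmapOn_res _).symm
  rw [← B.vmap_comp]
  rfl

end UnitalFactorizationAlgebra

end AHS

namespace AHS

variable {f : ℂ[X]}

/-! ## The structure sheaf, and multiplication by horizontal sections -/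

namespace DMod

/-- The `D`-module of functions on `U(I)`. -/
noncomputable def structureSheaf (f : ℂ[X]) (I : FinNEq) : DMod.{u} f I where
  carrier := ULift.{u} (SX f I)
  tower := ⟨fun a s t => congrArg ULift.up (smul_assoc a s t.down)⟩
  der i := ULift.moduleEquiv.symm.toLinearMap ∘ₗ (SX.der i : Derivation ℂ _ _).toLinearMap ∘ₗ
    ULift.moduleEquiv.toLinearMap
  der_smul i s m := by
    refine congrArg ULift.up (((SX.der i : Derivation ℂ _ _).leibniz s m.down).trans ?_)
    rw [add_comm, smul_eq_mul, smul_eq_mul, mul_comm m.down]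
    rfl
  der_comm i j m := congrArg ULift.up (SX.der_comm i j m.down)

/-- Pullback of functions along `φ_U(α) : U(J) → U(I)`. -/
noncomputable def pullFun {I J : FinNEq} (α : I ⟶ J) : structureSheaf.{u} f I →ₗ[ℂ] SX f J where
  toFun s := SX.map α s.down
  map_add' s t := map_add (SX.map α) s.down t.down
  map_smul' z s := map_smul (SX.map α) z s.down

theorem pullFun_smul {I J : FinNEq} (α : I ⟶ J) (s : SX f I) (t : structureSheaf.{u} f I) :
    pullFun α (s • t) = SX.map α s * pullFun α t := map_mul (SX.map α) s t.down

theorem der_pullFun {I J : FinNEq} (α : I ⟶ J) (j : J) (t : structureSheaf.{u} f I) :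
    SX.der j (pullFun α t) =
      pullFun α (∑ i ∈ FinNEq.preim α j, (structureSheaf.{u} f I).der i t) := by
  rw [map_sum]
  refine (SX.der_map α j t.down).trans ?_
  rw [map_sum]
  rfl

/-- The map `s ↦ α_*(s) • u` for a horizontal section `u`. -/
noncomputable def SemiHom.ofHorizontal {I J : FinNEq} (α : I ⟶ J) {N : DMod.{u} f J} (u : N)
    (hu : ∀ j, N.der j u = 0) : SemiHom α (structureSheaf.{u} f I) N where
  toFun :=
    { toFun := fun s => pullFun α s • u
      map_add' := fun s t => by rw [map_add, add_smul]
      map_smul' := fun z s => by rw [LinearMap.map_smul, RingHom.id_apply, smul_assoc] }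
  map_smul s t := by
    change pullFun α (s • t) • u = SX.map α s • pullFun α t • u
    rw [pullFun_smul, mul_smul]
  map_der j s := by
    change N.der j (pullFun (f := f) α s • u) = pullFun (f := f) α _ • u
    rw [N.der_smul, hu, smul_zero, add_zero, der_pullFun]

namespace Pairing

variable {I J : FinSet} {M : DMod.{u} f I.toNEq} {N : DMod.{u} f J.toNEq}
  {P : DMod.{u} f (I.toNEq.sum J.toNEq).set.toNEq}

/-- No element of `J` maps to `inl i`, so a section that comes from `J` is horizontal in the
direction `i`. -/
theorem der_inl_res_inr (n : SemiHom (FinNEq.ofFun (J := (I.toNEq.sum J.toNEq).set) Sum.inr) N P)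
    (i : I) (w : N) :
    (P.on (I := I.toNEq.sum J.toNEq)).der (Sum.inl i) (res (n w)) = 0 := by
  have e : FinNEq.preim (FinNEq.ofFun (I := J) (J := (I.toNEq.sum J.toNEq).set) Sum.inr)
      (Sum.inl i) = ∅ := by
    ext k
    rw [FinNEq.mem_preim]
    exact ⟨fun h => absurd h Sum.inr_ne_inl, fun h => absurd h (Finset.notMem_empty k)⟩
  refine (on_der_res (r := (I.toNEq.sum J.toNEq).rel) P (Sum.inl i) (n w)).trans ?_
  rw [n.map_der, e, Finset.sum_empty, map_zero, res_zero]

theorem der_inr_res_inr (n : SemiHom (FinNEq.ofFun (J := (I.toNEq.sum J.toNEq).set) Sum.inr) N P)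
    (j : J) (w : N) :
    (P.on (I := I.toNEq.sum J.toNEq)).der (Sum.inr j) (res (n w)) = res (n (N.der j w)) := by
  have e : FinNEq.preim (FinNEq.ofFun (I := J) (J := (I.toNEq.sum J.toNEq).set) Sum.inr)
      (Sum.inr j) = {j} := by
    ext k
    rw [FinNEq.mem_preim, Finset.mem_singleton]
    exact Sum.inr_injective.eq_iff
  refine (on_der_res (r := (I.toNEq.sum J.toNEq).rel) P (Sum.inr j) (n w)).trans ?_
  rw [n.map_der, e, Finset.sum_singleton]

theorem der_inr_res_inl (n : SemiHom (FinNEq.ofFun (J := (I.toNEq.sum J.toNEq).set) Sum.inl) M P)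
    (j : J) (v : M) :
    (P.on (I := I.toNEq.sum J.toNEq)).der (Sum.inr j) (res (n v)) = 0 := by
  have e : FinNEq.preim (FinNEq.ofFun (I := I) (J := (I.toNEq.sum J.toNEq).set) Sum.inl)
      (Sum.inr j) = ∅ := by
    ext k
    rw [FinNEq.mem_preim]
    exact ⟨fun h => absurd h Sum.inl_ne_inr, fun h => absurd h (Finset.notMem_empty k)⟩
  refine (on_der_res (r := (I.toNEq.sum J.toNEq).rel) P (Sum.inr j) (n v)).trans ?_
  rw [n.map_der, e, Finset.sum_empty, map_zero, res_zero]

theorem der_inl_res_inl (n : SemiHom (FinNEq.ofFun (J := (I.toNEq.sum J.toNEq).set) Sum.inl) M P)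
    (i : I) (v : M) :
    (P.on (I := I.toNEq.sum J.toNEq)).der (Sum.inl i) (res (n v)) = res (n (M.der i v)) := by
  have e : FinNEq.preim (FinNEq.ofFun (I := I) (J := (I.toNEq.sum J.toNEq).set) Sum.inl)
      (Sum.inl i) = {i} := by
    ext k
    rw [FinNEq.mem_preim, Finset.mem_singleton]
    exact Sum.inl_injective.eq_iff
  refine (on_der_res (r := (I.toNEq.sum J.toNEq).rel) P (Sum.inl i) (n v)).trans ?_
  rw [n.map_der, e, Finset.sum_singleton]

theorem res_semiHom_smul {K : FinSet} {N' : DMod.{u} f K.toNEq} {α : K → (I.toNEq.sum J.toNEq).set}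
    (n : SemiHom (FinNEq.ofFun α) N' P) (γ : K.toNEq ⟶ I.toNEq.sum J.toNEq)
    (h : ∀ k, γ.toFun k = α k) (s : SX f K.toNEq) (w : N') :
    (res (n (s • w)) : P.on (I := I.toNEq.sum J.toNEq)) = SX.map γ s • res (n w) := by
  rw [n.map_smul]
  refine (res_smul (r := (I.toNEq.sum J.toNEq).rel) _ _).trans ?_
  rw [← SX.map_map (FinNEq.ofFun α) (FinNEq.toSelf _) γ (fun k => h k) s]

theorem smul_eq_algebraMap_smul {K : FinNEq} {L : DMod.{u} f K} (z : ℂ) (x : L) :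
    z • x = algebraMap ℂ (SX f K) z • x := (algebraMap_smul (SX f K) z x).symm

theorem der_inl_pullFun_inl {I J : FinNEq} (i : I) (s : structureSheaf.{u} f I) :
    SX.der (I := I.sum J) (Sum.inl i) (pullFun (FinNEq.inl I J) s) =
      pullFun (FinNEq.inl I J) ((structureSheaf.{u} f I).der i s) := by
  change SX.der (I := I.sum J) (Sum.inl i) (SX.map (FinNEq.inl I J) s.down) = _
  rw [der_inl]
  rfl

theorem der_inr_pullFun_inr {I J : FinNEq} (j : J) (s : structureSheaf.{u} f J) :
    SX.der (I := I.sum J) (Sum.inr j) (pullFun (FinNEq.inr I J) s) =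
      pullFun (FinNEq.inr I J) ((structureSheaf.{u} f J).der j s) := by
  change SX.der (I := I.sum J) (Sum.inr j) (SX.map (FinNEq.inr I J) s.down) = _
  rw [der_inr]
  rfl

theorem der_inl_pullFun_inr {I J : FinNEq} (i : I) (s : structureSheaf.{u} f J) :
    SX.der (I := I.sum J) (Sum.inl i) (pullFun (FinNEq.inr I J) s) =
      0 := by
  change SX.der (I := I.sum J) (Sum.inl i) (SX.map (FinNEq.inr I J) s.down) = _
  rw [der_inl_inr]

theorem der_inr_pullFun_inl {I J : FinNEq} (j : J) (s : structureSheaf.{u} f I) :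
    SX.der (I := I.sum J) (Sum.inr j) (pullFun (FinNEq.inl I J) s) =
      0 := by
  change SX.der (I := I.sum J) (Sum.inr j) (SX.map (FinNEq.inl I J) s.down) = _
  rw [der_inr_inl]

/-- The pairing `(s, w) ↦ s • n(w)` of functions with sections. -/
noncomputable def ofRight
    (n : SemiHom (FinNEq.ofFun (J := (I.toNEq.sum J.toNEq).set) Sum.inr) N P) :
    Pairing (structureSheaf.{u} f I.toNEq) N P where
  toFun := LinearMap.mk₂ ℂ (fun s w => pullFun (FinNEq.inl I.toNEq J.toNEq) s • res (n w))
    (fun s t w => by rw [map_add, add_smul])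
    (fun z s w => by rw [LinearMap.map_smul, smul_assoc])
    (fun s w w' => by rw [map_add, res_add, smul_add])
    (fun z s w => by
      rw [smul_eq_algebraMap_smul z w, res_semiHom_smul n (FinNEq.inr I.toNEq J.toNEq)
        (fun _ => rfl), AlgHom.commutes, ← smul_eq_algebraMap_smul, smul_comm])
  smul_left s t w := by
    rw [LinearMap.mk₂_apply, LinearMap.mk₂_apply, pullFun_smul, mul_smul]
  smul_right s t w := by
    rw [LinearMap.mk₂_apply, LinearMap.mk₂_apply,
      res_semiHom_smul n (FinNEq.inr I.toNEq J.toNEq) (fun _ => rfl), smul_smul, smul_smul,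
      mul_comm]
  der_left i s w := by
    rw [LinearMap.mk₂_apply, LinearMap.mk₂_apply, DMod.der_smul, der_inl_res_inr, smul_zero,
      add_zero, der_inl_pullFun_inl (I := I.toNEq) (J := J.toNEq)]
  der_right j s w := by
    rw [LinearMap.mk₂_apply, LinearMap.mk₂_apply, DMod.der_smul, der_inr_res_inr,
      der_inr_pullFun_inl (I := I.toNEq) (J := J.toNEq), zero_smul, zero_add]

/-- The pairing `(v, t) ↦ t • n(v)` of sections with functions. -/
noncomputable def ofLeft
    (n : SemiHom (FinNEq.ofFun (J := (I.toNEq.sum J.toNEq).set) Sum.inl) M P) :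
    Pairing M (structureSheaf.{u} f J.toNEq) P where
  toFun := LinearMap.mk₂ ℂ (fun v t => pullFun (FinNEq.inr I.toNEq J.toNEq) t • res (n v))
    (fun w w' s => by rw [map_add, res_add, smul_add])
    (fun z w s => by
      rw [smul_eq_algebraMap_smul z w, res_semiHom_smul n (FinNEq.inl I.toNEq J.toNEq)
        (fun _ => rfl), AlgHom.commutes, ← smul_eq_algebraMap_smul, smul_comm])
    (fun w s t => by rw [map_add, add_smul])
    (fun z w s => by rw [map_smul, smul_assoc])
  smul_left s w t := by
    rw [LinearMap.mk₂_apply, LinearMap.mk₂_apply,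
      res_semiHom_smul n (FinNEq.inl I.toNEq J.toNEq) (fun _ => rfl), smul_smul, smul_smul,
      mul_comm]
  smul_right s w t := by
    rw [LinearMap.mk₂_apply, LinearMap.mk₂_apply, pullFun_smul, mul_smul]
  der_left i w s := by
    rw [LinearMap.mk₂_apply, LinearMap.mk₂_apply, DMod.der_smul, der_inl_res_inl,
      der_inl_pullFun_inr (I := I.toNEq) (J := J.toNEq), zero_smul, zero_add]
  der_right j w s := by
    rw [LinearMap.mk₂_apply, LinearMap.mk₂_apply, DMod.der_smul, der_inr_res_inl, smul_zero,
      add_zero, der_inr_pullFun_inr (I := I.toNEq) (J := J.toNEq)]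

end Pairing

end DMod

end AHS

namespace AHS

variable {f : ℂ[X]}

/-! ## Vertex algebras from singular multiplications of global sections -/

theorem DMod.SemiHom.on_resTo {I J : FinSet} {M : DMod.{u} f I.toNEq} {N : DMod.{u} f J.toNEq}
    {α : I → J} (n : DMod.SemiHom (FinNEq.ofFun α) M N) {r r₁ : Setoid I} {r' r₁' : Setoid J}
    (h : ∀ i i', r' (α i) (α i') → r i i') (h₁ : ∀ i i', r₁' (α i) (α i') → r₁ i i')
    (hr : r₁ ≤ r) (hr' : r₁' ≤ r') (x : M.on (I := ⟨I, r⟩)) :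
    DMod.SemiHom.on (I := ⟨I, r₁⟩) (J := ⟨J, r₁'⟩) (FinNEq.Hom.mk α h₁) n (DMod.resTo hr M x) =
      DMod.resTo hr' N (DMod.SemiHom.on (I := ⟨I, r⟩) (J := ⟨J, r'⟩) (FinNEq.Hom.mk α h) n x) :=
  DMod.SemiHom.on_square (I := ⟨I, r⟩) (J := ⟨I, r₁⟩) (J' := ⟨J, r'⟩) (K := ⟨J, r₁'⟩)
    (fun _ => rfl) (fun _ => rfl) x

namespace SFunFin

variable (V : SFunFin.{u} f)

theorem ext_map_res {I J : FinNEq} (α : I ⟶ J) (v : V.obj I.set) :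
    V.ext.map α (V.extRes v) = V.extRes (V.map α.toFun v) :=
  DMod.SemiHom.on_res α (V.map α.toFun) v

theorem ext_map_map {I J K : FinNEq} {α : I ⟶ J} {β : J ⟶ K} {γ : I ⟶ K}
    (h : ∀ i, γ.toFun i = β.toFun (α.toFun i)) (v : V.ext.obj I) :
    V.ext.map β (V.ext.map α v) = V.ext.map γ v := by
  rw [← V.ext.map_comp, FinNEq.hom_ext (α := α ≫ β) (β := γ) fun i => (h i).symm]

/-- A commutative multiplication with values in sections that may have poles on the diagonals
between two disjoint sets of points, with a unit, given on global sections. -/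
structure SingularMul where
  pairing (I J : FinSet) :
    DMod.Pairing (V.obj I) (V.obj J) (V.obj (I.toNEq.sum J.toNEq).set)
  natural {I J I' J' : FinSet} (α : I → I') (β : J → J') (v : V.obj I) (w : V.obj J) :
    DMod.SemiHom.on (FinNEq.sumMap (FinNEq.ofFun α) (FinNEq.ofFun β))
      (V.map (I := (I.toNEq.sum J.toNEq).set) (J := (I'.toNEq.sum J'.toNEq).set) (Sum.map α β))
      ((pairing I J).toFun v w) = (pairing I' J').toFun (V.map α v) (V.map β w)
  comm {I J : FinSet} (v : V.obj I) (w : V.obj J) :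
    DMod.SemiHom.on (FinNEq.sumSwap I.toNEq J.toNEq)
      (V.map (I := (I.toNEq.sum J.toNEq).set) (J := (J.toNEq.sum I.toNEq).set) Sum.swap)
      ((pairing I J).toFun v w) = (pairing J I).toFun w v
  unit (I : FinSet) : V.obj I
  unit_mul {I J : FinSet} (w : V.obj J) : (pairing I J).toFun (unit I) w =
    DMod.res (I := I.toNEq.sum J.toNEq) (V.map (J := (I.toNEq.sum J.toNEq).set) Sum.inr w)
  -- Over the empty set every section is a multiple of the unit, so the unit law settles all cases
  -- of associativity with an empty factor; `assoc` is only required for non-empty sets.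
  span {I : FinSet} (hI : IsEmpty I) (v : V.obj I) : ∃ s : SX f I.toNEq, v = s • unit I
  assoc {I J K : FinSet} (hI : Nonempty I) (hJ : Nonempty J) (hK : Nonempty K) (v : V.obj I)
    (w : V.obj J) (z : V.obj K) :
    DMod.SemiHom.on (FinNEq.sumAssoc I.toNEq J.toNEq K.toNEq)
      (V.map (I := ((I.toNEq.sum J.toNEq).sum K.toNEq).set)
        (J := (I.toNEq.sum (J.toNEq.sum K.toNEq)).set) (Equiv.sumAssoc I J K))
      (DMod.Pairing.on (I := I.toNEq.sum J.toNEq) (J := K.toNEq)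
        (pairing (I.toNEq.sum J.toNEq).set K) ((pairing I J).toFun v w) (DMod.res z)) =
    DMod.Pairing.on (I := I.toNEq) (J := J.toNEq.sum K.toNEq)
        (pairing I (J.toNEq.sum K.toNEq).set) (DMod.res v) ((pairing J K).toFun w z)

namespace SingularMul

variable {V} (m : V.SingularMul)

/-- The multiplication of sections over open subsets. -/
noncomputable def singMap : SingMap V.ext V.ext V.ext where
  toFun I J := DMod.Pairing.on (I := I) (J := J) (m.pairing I.set J.set)
  smul_left {I J} := DMod.Pairing.on_smul_left (I := I) (J := J) (m.pairing I.set J.set)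
  smul_right {I J} := DMod.Pairing.on_smul_right (I := I) (J := J) (m.pairing I.set J.set)
  der_left {I J} := DMod.Pairing.on_der_left (I := I) (J := J) (m.pairing I.set J.set)
  der_right {I J} := DMod.Pairing.on_der_right (I := I) (J := J) (m.pairing I.set J.set)
  natural {I J I' J'} α β v w := by
    refine DMod.Pairing.on_ext₂ (I := I) (J := J) (M := V.obj I.set) (N := V.obj J.set)
      (α ≫ FinNEq.inl I' J') (β ≫ FinNEq.inr I' J')
      (fun v w => V.ext.map (FinNEq.sumMap α β)
        (DMod.Pairing.on (I := I) (J := J) (m.pairing I.set J.set) v w))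
      (fun v w => DMod.Pairing.on (I := I') (J := J') (m.pairing I'.set J'.set) (V.ext.map α v)
        (V.ext.map β w)) ?_ ?_ ?_ ?_ ?_ ?_ ?_ ?_ ?_ v w
    · intro x x' y
      exact (congrArg _ (LinearMap.map_add₂ _ _ _ _)).trans (map_add _ _ _)
    · intro x y y'
      exact (congrArg _ (map_add _ _ _)).trans (map_add _ _ _)
    · intro x x' y
      exact (congrArg (DMod.Pairing.on (I := I') (J := J') (m.pairing I'.set J'.set) · _)
        (map_add _ x x')).trans (LinearMap.map_add₂ _ _ _ _)
    · intro x y y'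
      exact (congrArg _ (map_add _ y y')).trans (map_add _ _ _)
    · intro s x y
      refine (congrArg _ (DMod.Pairing.on_smul_left _ s x y)).trans
        (((V.ext.map _).map_smul _ _).trans ?_)
      refine congrArg (· • _) ?_
      exact SX.map_map _ _ _ (fun _ => rfl) s
    · intro s x y
      refine (congrArg _ (DMod.Pairing.on_smul_right _ s x y)).trans
        (((V.ext.map _).map_smul _ _).trans ?_)
      refine congrArg (· • _) ?_
      exact SX.map_map _ _ _ (fun _ => rfl) s
    · intro s x y
      refine (congrArg (DMod.Pairing.on (I := I') (J := J') (m.pairing I'.set J'.set) · _)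
        ((V.ext.map _).map_smul s x)).trans ?_
      refine (DMod.Pairing.on_smul_left _ _ _ _).trans ?_
      rw [SX.map_comp]
      rfl
    · intro s x y
      refine (congrArg _ ((V.ext.map _).map_smul s y)).trans ?_
      refine (DMod.Pairing.on_smul_right _ _ _ _).trans ?_
      rw [SX.map_comp]
      rfl
    · intro x y
      refine (congrArg _ (DMod.Pairing.on_res (I := I) (J := J) _ x y)).trans ?_
      refine Eq.trans ?_ (congrArg₂ (fun a b => DMod.Pairing.on (I := I') (J := J')
        (m.pairing I'.set J'.set) a b) (V.ext_map_res α x) (V.ext_map_res β y)).symm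
      refine Eq.trans ?_ (DMod.Pairing.on_res (I := I') (J := J') _ _ _).symm
      rw [← m.natural]
      exact DMod.SemiHom.on_resTo _ (FinNEq.sumMap (FinNEq.ofFun _) (FinNEq.ofFun _)).map_rel
        (FinNEq.sumMap α β).map_rel _ _ _

theorem singMap_res {I J : FinNEq} (v : V.obj I.set) (w : V.obj J.set) :
    m.singMap.toFun I J (V.extRes v) (V.extRes w) =
      DMod.resTo (FinNEq.sum_rel_le I J) _ ((m.pairing I.set J.set).toFun v w) :=
  DMod.Pairing.on_res (I := I) (J := J) _ v w

theorem singMap_res_toNEq {I J : FinSet} (v : V.obj I) (w : V.obj J) :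
    m.singMap.toFun I.toNEq J.toNEq (V.extRes v) (V.extRes w) = (m.pairing I J).toFun v w :=
  (m.singMap_res (I := I.toNEq) (J := J.toNEq) v w).trans (DMod.resTo_self _ _)

theorem singMap_comm {I J : FinNEq} (v : V.ext.obj I) (w : V.ext.obj J) :
    V.ext.map (FinNEq.sumSwap I J) (m.singMap.toFun I J v w) = m.singMap.toFun J I w v := by
  refine DMod.Pairing.on_ext₂ (I := I) (J := J) (M := V.obj I.set) (N := V.obj J.set)
      (FinNEq.inr J I) (FinNEq.inl J I)
      (fun v w => V.ext.map (FinNEq.sumSwap I J) (m.singMap.toFun I J v w))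
      (fun v w => m.singMap.toFun J I w v) ?_ ?_ ?_ ?_ ?_ ?_ ?_ ?_ ?_ v w
  · intro x x' y
    exact (congrArg _ (LinearMap.map_add₂ _ _ _ _)).trans (map_add _ _ _)
  · intro x y y'
    exact (congrArg _ (map_add _ _ _)).trans (map_add _ _ _)
  · intro x x' y
    exact map_add _ _ _
  · intro x y y'
    exact LinearMap.map_add₂ _ _ _ _
  · intro s x y
    refine (congrArg _ (m.singMap.smul_left s x y)).trans (((V.ext.map _).map_smul _ _).trans ?_)
    refine congrArg (· • _) ?_
    exact SX.map_map _ _ _ (fun _ => rfl) s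
  · intro s x y
    refine (congrArg _ (m.singMap.smul_right s x y)).trans (((V.ext.map _).map_smul _ _).trans ?_)
    refine congrArg (· • _) ?_
    exact SX.map_map _ _ _ (fun _ => rfl) s
  · intro s x y
    exact m.singMap.smul_right s y x
  · intro s x y
    exact m.singMap.smul_left s y x
  · intro x y
    refine (congrArg _ (m.singMap_res x y)).trans (Eq.trans ?_ (m.singMap_res y x).symm)
    rw [← m.comm x y]
    exact DMod.SemiHom.on_resTo _ (FinNEq.sumSwap I.set.toNEq J.set.toNEq).map_rel
      (FinNEq.sumSwap I J).map_rel _ _ _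

theorem unit_singMap {I J : FinNEq} (w : V.ext.obj J) :
    m.singMap.toFun I J (V.extRes (m.unit I.set)) w = V.ext.map (FinNEq.inr I J) w := by
  refine DMod.on_ext (I := J) (M := V.obj J.set) (FinNEq.inr I J)
    (AddMonoidHom.mk' (fun w => m.singMap.toFun I J (V.extRes (m.unit I.set)) w)
      (fun _ _ => map_add _ _ _))
    (AddMonoidHom.mk' (fun w => V.ext.map (FinNEq.inr I J) w) (fun _ _ => map_add _ _ _)) ?_ ?_ ?_ w
  · intro s x
    exact m.singMap.smul_right s _ x
  · intro s x
    exact (V.ext.map (FinNEq.inr I J)).map_smul s x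
  · intro x
    refine (m.singMap_res _ x).trans (Eq.trans ?_ (V.ext_map_res (FinNEq.inr I J) x).symm)
    rw [m.unit_mul]
    exact DMod.resTo_res _ _

theorem singMap_unit {I J : FinNEq} (v : V.ext.obj I) :
    m.singMap.toFun I J v (V.extRes (m.unit J.set)) = V.ext.map (FinNEq.inl I J) v := by
  rw [← m.singMap_comm, m.unit_singMap]
  exact V.ext_map_map (fun _ => rfl) v

/-- Restrictions to `U(I)`, `U(J)`, `U(K)` are functorial images of global sections along the
identity maps, so by naturality the identity is the image of `assoc`. -/
theorem singMap_assoc_of_nonempty {I J K : FinNEq} (hI : Nonempty I) (hJ : Nonempty J)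
    (hK : Nonempty K) (v : V.obj I.set) (w : V.obj J.set) (z : V.obj K.set) :
    V.ext.map (FinNEq.sumAssoc I J K) (m.singMap.toFun (I.sum J) K
      (m.singMap.toFun I J (V.extRes v) (V.extRes w)) (V.extRes z)) =
      m.singMap.toFun I (J.sum K) (V.extRes v)
        (m.singMap.toFun J K (V.extRes w) (V.extRes z)) := by
  have e : ∀ {L : FinNEq} (x : V.obj L.set),
      V.extRes (I := L) x = V.ext.map L.toSelf (V.extRes (I := L.set.toNEq) x) := by
    intro L x
    rw [ext_map_res]
    exact congrArg _ (V.map_id _ x).symm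
  rw [e v, e w, e z]
  simp only [← m.singMap.natural]
  rw [V.ext_map_map (γ := FinNEq.sumAssoc I.set.toNEq J.set.toNEq K.set.toNEq ≫
    FinNEq.sumMap I.toSelf (FinNEq.sumMap J.toSelf K.toSelf)), V.ext.map_comp]
  · refine congrArg _ ?_
    rw [singMap_res_toNEq, singMap_res_toNEq]
    exact m.assoc hI hJ hK v w z
  · rintro ((i | j) | k) <;> rfl

/-- Multiplication by a unit is the map of an inclusion, so associativity with one unit factor
becomes naturality for that inclusion together with an equality of maps. The next two lemmas use the
same argument. -/
theorem singMap_assoc_unit_left {I J K : FinNEq} (w : V.ext.obj J) (z : V.ext.obj K) :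
    V.ext.map (FinNEq.sumAssoc I J K) (m.singMap.toFun (I.sum J) K
      (m.singMap.toFun I J (V.extRes (m.unit I.set)) w) z) =
      m.singMap.toFun I (J.sum K) (V.extRes (m.unit I.set)) (m.singMap.toFun J K w z) := by
  have h := m.singMap.natural (FinNEq.inr I J) (𝟙 K) w z
  rw [V.ext.map_id] at h
  rw [unit_singMap, unit_singMap, ← h]
  exact V.ext_map_map (by rintro (j | k) <;> rfl) _

theorem singMap_assoc_unit_middle {I J K : FinNEq} (v : V.ext.obj I) (z : V.ext.obj K) :
    V.ext.map (FinNEq.sumAssoc I J K) (m.singMap.toFun (I.sum J) K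
      (m.singMap.toFun I J v (V.extRes (m.unit J.set))) z) =
      m.singMap.toFun I (J.sum K) v (m.singMap.toFun J K (V.extRes (m.unit J.set)) z) := by
  have h := m.singMap.natural (FinNEq.inl I J) (𝟙 K) v z
  have h' := m.singMap.natural (𝟙 I) (FinNEq.inr J K) v z
  rw [V.ext.map_id] at h h'
  rw [unit_singMap, singMap_unit, ← h, ← h']
  exact V.ext_map_map (by rintro (j | k) <;> rfl) _

theorem singMap_assoc_unit_right {I J K : FinNEq} (v : V.ext.obj I) (w : V.ext.obj J) :
    V.ext.map (FinNEq.sumAssoc I J K) (m.singMap.toFun (I.sum J) K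
      (m.singMap.toFun I J v w) (V.extRes (m.unit K.set))) =
      m.singMap.toFun I (J.sum K) v (m.singMap.toFun J K w (V.extRes (m.unit K.set))) := by
  have h := m.singMap.natural (𝟙 I) (FinNEq.inl J K) v w
  rw [V.ext.map_id] at h
  rw [singMap_unit, singMap_unit, ← h]
  exact V.ext_map_map (by rintro (j | k) <;> rfl) _

theorem extRes_smul {I : FinNEq} (s : SX f I.set.toNEq) (v : V.obj I.set) :
    V.extRes (I := I) (s • v) = SX.map I.toSelf s • V.extRes v :=
  DMod.res_smul (I := I.set) (r := I.rel) s v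

/-- If one of the sets is empty, the corresponding factor is a multiple of the unit. The scalar is
pulled out on both sides and the unit case applies. -/
theorem singMap_assoc_res {I J K : FinNEq} (v : V.obj I.set) (w : V.obj J.set) (z : V.obj K.set) :
    V.ext.map (FinNEq.sumAssoc I J K) (m.singMap.toFun (I.sum J) K
      (m.singMap.toFun I J (V.extRes v) (V.extRes w)) (V.extRes z)) =
      m.singMap.toFun I (J.sum K) (V.extRes v)
        (m.singMap.toFun J K (V.extRes w) (V.extRes z)) := by
  rcases isEmpty_or_nonempty I with hI | hI
  · obtain ⟨s, rfl⟩ := m.span hI v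
    rw [extRes_smul, m.singMap.smul_left, m.singMap.smul_left, m.singMap.smul_left,
      (V.ext.map _).map_smul, singMap_assoc_unit_left]
    refine congrArg (· • _) ?_
    exact SX.map_map₃ _ _ _ _ (fun _ => rfl) _
  rcases isEmpty_or_nonempty J with hJ | hJ
  · obtain ⟨s, rfl⟩ := m.span hJ w
    rw [extRes_smul, m.singMap.smul_right, m.singMap.smul_left, m.singMap.smul_left,
      m.singMap.smul_right, (V.ext.map _).map_smul, singMap_assoc_unit_middle]
    refine congrArg (· • _) ?_
    refine (SX.map_map₃ _ _ _ (FinNEq.inl J K ≫ FinNEq.inr I (J.sum K)) (fun _ => rfl) _).trans ?_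
    exact (SX.map_map _ _ _ (fun _ => rfl) _).symm
  rcases isEmpty_or_nonempty K with hK | hK
  · obtain ⟨s, rfl⟩ := m.span hK z
    rw [extRes_smul, m.singMap.smul_right, m.singMap.smul_right, m.singMap.smul_right,
      (V.ext.map _).map_smul, singMap_assoc_unit_right]
    refine congrArg (· • _) ?_
    rw [SX.map_map (FinNEq.inr (I.sum J) K) (FinNEq.sumAssoc I J K)
      (FinNEq.inr J K ≫ FinNEq.inr I (J.sum K)) (fun _ => rfl), SX.map_comp]
  exact m.singMap_assoc_of_nonempty hI hJ hK v w z

theorem singMap_assoc {I J K : FinNEq} (v : V.ext.obj I) (w : V.ext.obj J) (z : V.ext.obj K) :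
    V.ext.map (FinNEq.sumAssoc I J K) (m.singMap.toFun (I.sum J) K
      (m.singMap.toFun I J v w) z) =
      m.singMap.toFun I (J.sum K) v (m.singMap.toFun J K w z) := by
  refine DMod.on_ext (I := K) (M := V.obj K.set) (FinNEq.inr J K ≫ FinNEq.inr I (J.sum K))
    ((V.ext.map (FinNEq.sumAssoc I J K)).toFun ∘ₗ
      m.singMap.toFun (I.sum J) K (m.singMap.toFun I J v w)).toAddMonoidHom
    (m.singMap.toFun I (J.sum K) v ∘ₗ m.singMap.toFun J K w).toAddMonoidHom ?_ ?_ (fun z => ?_) z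
  · intro s z
    refine (congrArg _ (m.singMap.smul_right s _ z)).trans (((V.ext.map _).map_smul _ _).trans ?_)
    refine congrArg (· • _) ?_
    exact SX.map_map _ _ _ (fun _ => rfl) s
  · intro s z
    refine (congrArg _ (m.singMap.smul_right s w z)).trans ((m.singMap.smul_right _ _ _).trans ?_)
    refine congrArg (· • _) ?_
    exact SX.map_map _ _ _ (fun _ => rfl) s
  refine DMod.Pairing.on_ext₂ (I := I) (J := J) (M := V.obj I.set) (N := V.obj J.set)
    (FinNEq.inl I (J.sum K)) (FinNEq.inl J K ≫ FinNEq.inr I (J.sum K))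
    (fun v w => V.ext.map (FinNEq.sumAssoc I J K) (m.singMap.toFun (I.sum J) K
      (m.singMap.toFun I J v w) (V.extRes z)))
    (fun v w => m.singMap.toFun I (J.sum K) v (m.singMap.toFun J K w (V.extRes z)))
    ?_ ?_ ?_ ?_ ?_ ?_ ?_ ?_ (fun v w => m.singMap_assoc_res v w z) v w
  · intro x x' y
    refine (congrArg _ ((congrArg (m.singMap.toFun (I.sum J) K · _)
      (LinearMap.map_add₂ _ _ _ _)).trans (LinearMap.map_add₂ _ _ _ _))).trans (map_add _ _ _)
  · intro x y y'
    refine (congrArg _ ((congrArg (m.singMap.toFun (I.sum J) K · _)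
      (map_add _ _ _)).trans (LinearMap.map_add₂ _ _ _ _))).trans (map_add _ _ _)
  · intro x x' y
    exact LinearMap.map_add₂ _ _ _ _
  · intro x y y'
    exact (congrArg _ (LinearMap.map_add₂ _ _ _ _)).trans (map_add _ _ _)
  · intro s x y
    refine (congrArg _ ((congrArg (m.singMap.toFun (I.sum J) K · _)
      (m.singMap.smul_left s x y)).trans (m.singMap.smul_left _ _ _))).trans
      (((V.ext.map _).map_smul _ _).trans ?_)
    refine congrArg (· • _) ?_
    exact SX.map_map₃ _ _ _ _ (fun _ => rfl) s
  · intro s x y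
    refine (congrArg _ ((congrArg (m.singMap.toFun (I.sum J) K · _)
      (m.singMap.smul_right s x y)).trans (m.singMap.smul_left _ _ _))).trans
      (((V.ext.map _).map_smul _ _).trans ?_)
    refine congrArg (· • _) ?_
    exact SX.map_map₃ _ _ _ _ (fun _ => rfl) s
  · intro s x y
    exact m.singMap.smul_left _ _ _
  · intro s x y
    refine (congrArg _ (m.singMap.smul_left s y _)).trans ((m.singMap.smul_right _ _ _).trans ?_)
    refine congrArg (· • _) ?_
    exact SX.map_map _ _ _ (fun _ => rfl) s

end SingularMul

/-- The vertex algebra with a given multiplication. -/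
noncomputable def SingularMul.vertexAlgebra {V : SFunFin.{u} f} (m : V.SingularMul) : AHSVertexAlgebra.{u} f where
  toSFunFin := V
  mul := m.singMap
  mul_comm := m.singMap_comm
  mul_assoc := m.singMap_assoc
  one := m.unit FinSet.empty
  one_mul := m.unit_singMap

end SFunFin

end AHS

namespace AHS

variable {f : ℂ[X]}

/-! ## Morphisms of unital factorization algebras -/

namespace UnitalFactorizationAlgebra.Hom

variable {B C : UnitalFactorizationAlgebra.{u} f} (φ : B ⟶ C) {I J : NFinSet}

theorem _root_.AHS.DMod.onMap_res {I : FinNEq} {M N : DMod.{u} f I.set.toNEq} (h : M ⟶ N) (m : M) :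
    DMod.onMap (I := I) h (DMod.res m) = DMod.res (h.toLin m) :=
  DMod.onMap_tmul h 1 m

theorem _root_.AHS.DMod.onMap_resTo {I : FinSet} {M N : DMod.{u} f I.toNEq} (g : M ⟶ N) {r r' : Setoid I}
    (h : r' ≤ r) (x : M.on (I := ⟨I, r⟩)) :
    DMod.onMap (I := ⟨I, r'⟩) g (DMod.resTo h M x) =
      DMod.resTo h N (DMod.onMap (I := ⟨I, r⟩) g x) :=
  DMod.SemiHom.on_square (I := ⟨I, r⟩) (J := ⟨I, r'⟩) (J' := ⟨I, r⟩) (K := ⟨I, r'⟩)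
    (fun _ => rfl) (fun _ => rfl) x

theorem app_vac : (φ.app I).toLin (B.vac I) = C.vac I := φ.unit I 1

theorem app_d₂ (b : B.obj I) (c : B.obj J) :
    DMod.onMap (I := I.toNEq.sum J.toNEq) (φ.app (NFinSet.sum I J)) (B.d₂ b c) =
      C.d₂ ((φ.app I).toLin b) ((φ.app J).toLin c) := by
  unfold FactorizationData.d₂
  refine (DMod.onMap_resTo (φ.app (NFinSet.sum I J)) (NFinSet.sum_rel_le I J) _).trans ?_
  rw [φ.d]
  refine congrArg _ (congrArg (C.d _ _) (funext (NFinSet.two_cases ?_ ?_)))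
  · exact φ.nu _ (NFinSet.toPart₀_surjective I J) b
  · exact φ.nu _ (NFinSet.toPart₁_surjective I J) c

/-- A morphism preserves `d₂` and the unit, so the image restricts to the right section; extensions
are unique. -/
theorem app_extVac (b : B.obj I) :
    (φ.app (NFinSet.sum I J)).toLin (B.extVac J b) = C.extVac J ((φ.app I).toLin b) := by
  refine C.eq_extVac ((DMod.onMap_res (I := ⟨_, NFinSet.sumRel I J⟩) _ _).symm.trans ?_)
  rw [B.res_extVac, ← φ.app_vac]
  exact φ.app_d₂ b _

theorem app_vmap (α : I → J) (b : B.obj I) :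
    (φ.app J).toLin (B.vmap α b) = C.vmap α ((φ.app I).toLin b) := by
  rw [vmap_apply, vmap_apply, φ.nu, app_extVac]

end UnitalFactorizationAlgebra.Hom

/-! ## Extension to the empty set -/

/-- A finite set is empty or non-empty. -/
inductive FinSet.Cases (I : FinSet) : Type
  | empty (h : IsEmpty I)
  | nonempty (h : Nonempty I)

/-- The decision whether a finite set is empty. -/
noncomputable def FinSet.cases (I : FinSet) : I.Cases :=
  open Classical in
  if h : Nonempty I then .nonempty h else .empty (not_nonempty_iff.1 h)

namespace UnitalFactorizationAlgebra

variable (B C D : UnitalFactorizationAlgebra.{u} f) {I J K : FinSet}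

/-- The `D`-module `B(X^I)` for `I ≠ ∅`, and `ℂ = S_X(∅)` for `I = ∅`. -/
noncomputable def vobj : I.Cases → DMod.{u} f I.toNEq
  | .empty _ => DMod.structureSheaf f I.toNEq
  | .nonempty _ => B.obj { toFinSet := I }

/-- The image of the unit. -/
noncomputable def vunit : (c : I.Cases) → B.vobj c
  | .empty _ => (ULift.up 1 : ULift (SX f I.toNEq))
  | .nonempty _ => B.vac { toFinSet := I }

theorem der_vunit (c : I.Cases) (i : I) : (B.vobj c).der i (B.vunit c) = 0 := by
  cases c with
  | empty h => exact (h.false i).elim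
  | nonempty h => exact B.der_vac (K := { toFinSet := I }) i

/-- The maps on global sections for all maps of finite sets. -/
noncomputable def vhom (α : I → J) : (c : I.Cases) → (c' : J.Cases) →
    DMod.SemiHom (FinNEq.ofFun α) (B.vobj c) (B.vobj c')
  | .empty _, c' => DMod.SemiHom.ofHorizontal _ (B.vunit c') (B.der_vunit c')
  | .nonempty _, .nonempty _ => B.vmap (I := { toFinSet := I }) (J := { toFinSet := J }) α
  | .nonempty h, .empty h' => (h'.false (α h.some)).elim

variable {c : I.Cases} {c' : J.Cases} {c'' : K.Cases}

/-- Every later statement that involves an empty set is reduced by this to the unit section, for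
which the maps and products are known. -/
theorem exists_eq_smul_vunit (h : IsEmpty I) (v : B.vobj c) :
    ∃ s : SX f I.toNEq, v = s • B.vunit c := by
  cases c with
  | nonempty h' => exact (h.false h'.some).elim
  | empty _ => exact ⟨v.down, congrArg ULift.up (mul_one v.down).symm⟩

theorem vhom_vunit (α : I → J) : B.vhom α c c' (B.vunit c) = B.vunit c' := by
  cases c with
  | empty h =>
    change SX.map (FinNEq.ofFun α) (1 : SX f I.toNEq) • B.vunit c' = _
    rw [map_one, one_smul]
  | nonempty h =>
    cases c' with
    | empty h' => exact (h'.false (α h.some)).elim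
    | nonempty h' => exact B.vmap_vac (I := { toFinSet := I }) (J := { toFinSet := J }) α

theorem vhom_id (v : B.vobj c) : B.vhom (id : I → I) c c v = v := by
  cases c with
  | empty h =>
    obtain ⟨s, rfl⟩ := B.exists_eq_smul_vunit h v
    rw [(B.vhom _ _ _).map_smul, vhom_vunit, SX.map_eq_self _ fun _ => rfl]
  | nonempty h => exact B.vmap_id (I := { toFinSet := I }) v

theorem vhom_comp (α : I → J) (β : J → K) (v : B.vobj c) :
    B.vhom (β ∘ α) c c'' v = B.vhom β c' c'' (B.vhom α c c' v) := by
  rcases isEmpty_or_nonempty I with h | h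
  · obtain ⟨s, rfl⟩ := B.exists_eq_smul_vunit h v
    simp only [(B.vhom _ _ _).map_smul, vhom_vunit]
    rw [SX.map_map (FinNEq.ofFun α) (FinNEq.ofFun β) (FinNEq.ofFun (β ∘ α)) fun _ => rfl]
  · cases c with
    | empty h' => exact (h'.false h.some).elim
    | nonempty _ =>
    cases c' with
    | empty h' => exact (h'.false (α h.some)).elim
    | nonempty _ =>
    cases c'' with
    | empty h' => exact (h'.false (β (α h.some))).elim
    | nonempty _ =>
      exact B.vmap_comp (I := { toFinSet := I }) (J := { toFinSet := J })
        (K := { toFinSet := K }) α β v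

/-- The singular multiplication, including the empty set. -/
noncomputable def vpairing : (c : I.Cases) → (c' : J.Cases) →
    (c'' : (I.toNEq.sum J.toNEq).set.Cases) →
    DMod.Pairing (B.vobj c) (B.vobj c') (B.vobj c'')
  | .empty _, c', c'' => DMod.Pairing.ofRight (B.vhom Sum.inr c' c'')
  | .nonempty h, .empty _, c'' => DMod.Pairing.ofLeft (B.vhom Sum.inl (.nonempty h) c'')
  | .nonempty _, .nonempty _, .nonempty _ => B.pairing { toFinSet := I } { toFinSet := J }
  | .nonempty h, .nonempty _, .empty h' => (h'.false (Sum.inl h.some)).elim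

section vpairing

variable {d : (I.toNEq.sum J.toNEq).set.Cases}

/-- The pairing has different definitions according to which side is empty. The case of two units is
settled first, so that either unit law below may replace a section over an empty set by a multiple
of the unit. -/
theorem vunit_vpairing_vunit : (B.vpairing c c' d).toFun (B.vunit c) (B.vunit c') =
    DMod.res (I := I.toNEq.sum J.toNEq) (B.vunit d) := by
  cases c with
  | empty h =>
    change SX.map (FinNEq.inl I.toNEq J.toNEq) (1 : SX f I.toNEq) •
      DMod.res (I := I.toNEq.sum J.toNEq) (B.vhom Sum.inr c' d (B.vunit c')) = _
    rw [map_one, one_smul, vhom_vunit]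
  | nonempty h =>
    cases c' with
    | empty h' =>
      change SX.map (FinNEq.inr I.toNEq J.toNEq) (1 : SX f J.toNEq) •
        DMod.res (I := I.toNEq.sum J.toNEq) (B.vhom Sum.inl _ d (B.vunit (.nonempty h))) = _
      rw [map_one, one_smul, vhom_vunit]
    | nonempty h' =>
      cases d with
      | empty h'' => exact (h''.false (Sum.inl h.some)).elim
      | nonempty _ =>
        refine (B.res_vmap_inr (I := { toFinSet := I }) (J := { toFinSet := J })
          (B.vac _)).symm.trans ?_
        rw [vmap_vac]
        rfl

theorem vunit_vpairing (w : B.vobj c') : (B.vpairing c c' d).toFun (B.vunit c) w =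
    DMod.res (I := I.toNEq.sum J.toNEq) (B.vhom Sum.inr c' d w) := by
  rcases isEmpty_or_nonempty J with h' | h'
  · obtain ⟨s, rfl⟩ := B.exists_eq_smul_vunit h' w
    refine (DMod.Pairing.smul_right _ _ _ _).trans (Eq.trans ?_
      (DMod.Pairing.res_semiHom_smul (B.vhom (J := (I.toNEq.sum J.toNEq).set) Sum.inr c' d)
        (FinNEq.inr I.toNEq J.toNEq) (fun _ => rfl) s _).symm)
    rw [vhom_vunit, vunit_vpairing_vunit]
  cases c with
  | empty h =>
    change SX.map (FinNEq.inl I.toNEq J.toNEq) (1 : SX f I.toNEq) •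
      DMod.res (I := I.toNEq.sum J.toNEq) (B.vhom Sum.inr c' d w) = _
    rw [map_one, one_smul]
  | nonempty h =>
    cases c' with
    | empty h => exact (h.false h'.some).elim
    | nonempty _ =>
      cases d with
      | empty h'' => exact (h''.false (Sum.inl h.some)).elim
      | nonempty _ =>
        exact (B.res_vmap_inr (I := { toFinSet := I }) (J := { toFinSet := J }) w).symm

theorem vpairing_vunit (v : B.vobj c) : (B.vpairing c c' d).toFun v (B.vunit c') =
    DMod.res (I := I.toNEq.sum J.toNEq) (B.vhom Sum.inl c d v) := by
  rcases isEmpty_or_nonempty I with h' | h'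
  · obtain ⟨s, rfl⟩ := B.exists_eq_smul_vunit h' v
    refine (DMod.Pairing.smul_left _ _ _ _).trans (Eq.trans ?_
      (DMod.Pairing.res_semiHom_smul (B.vhom (J := (I.toNEq.sum J.toNEq).set) Sum.inl c d)
        (FinNEq.inl I.toNEq J.toNEq) (fun _ => rfl) s _).symm)
    rw [vhom_vunit, vunit_vpairing_vunit]
  cases c with
  | empty h => exact (h.false h'.some).elim
  | nonempty h =>
    cases c' with
    | empty _ =>
      change SX.map (FinNEq.inr I.toNEq J.toNEq) (1 : SX f J.toNEq) •
        DMod.res (I := I.toNEq.sum J.toNEq) (B.vhom Sum.inl _ d v) = _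
      rw [map_one, one_smul]
    | nonempty _ =>
      cases d with
      | empty h'' => exact (h''.false (Sum.inl h.some)).elim
      | nonempty _ =>
        exact (B.res_vmap_inl (I := { toFinSet := I }) (J := { toFinSet := J }) v).symm

/-- If `I` or `J` is empty, the unit laws turn the claim into functoriality of `vhom`. Otherwise the
target sets are non-empty too, and the claim is `vmapOn_sum_map_d₂`. -/
theorem vpairing_natural {I' J' : FinSet} {e : I'.Cases} {e' : J'.Cases}
    {d' : (I'.toNEq.sum J'.toNEq).set.Cases} (α : I → I') (β : J → J') (v : B.vobj c)
    (w : B.vobj c') :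
    DMod.SemiHom.on (FinNEq.sumMap (FinNEq.ofFun α) (FinNEq.ofFun β))
      (B.vhom (I := (I.toNEq.sum J.toNEq).set) (J := (I'.toNEq.sum J'.toNEq).set) (Sum.map α β)
        d d') ((B.vpairing c c' d).toFun v w) =
      (B.vpairing e e' d').toFun (B.vhom α c e v) (B.vhom β c' e' w) := by
  rcases isEmpty_or_nonempty I with h | h
  · obtain ⟨s, rfl⟩ := B.exists_eq_smul_vunit h v
    rw [DMod.Pairing.smul_left, vunit_vpairing, (B.vhom _ _ _).map_smul, vhom_vunit,
      DMod.Pairing.smul_left, vunit_vpairing, DMod.SemiHom.map_smul]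
    refine congrArg₂ (· • ·) (SX.map_square _ _ _ _ (fun _ => by rfl) s)
      ((DMod.SemiHom.on_res _ _ _).trans
        (congrArg (fun x => DMod.res (I := I'.toNEq.sum J'.toNEq) x) ?_))
    exact (B.vhom_comp _ _ _).symm.trans (B.vhom_comp _ _ _)
  rcases isEmpty_or_nonempty J with h' | h'
  · obtain ⟨s, rfl⟩ := B.exists_eq_smul_vunit h' w
    rw [DMod.Pairing.smul_right, vpairing_vunit, (B.vhom _ _ _).map_smul, vhom_vunit,
      DMod.Pairing.smul_right, vpairing_vunit, DMod.SemiHom.map_smul]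
    refine congrArg₂ (· • ·) (SX.map_square _ _ _ _ (fun _ => by rfl) s)
      ((DMod.SemiHom.on_res _ _ _).trans
        (congrArg (fun x => DMod.res (I := I'.toNEq.sum J'.toNEq) x) ?_))
    exact (B.vhom_comp _ _ _).symm.trans (B.vhom_comp _ _ _)
  cases c with
  | empty g => exact (g.false h.some).elim
  | nonempty _ =>
  cases c' with
  | empty g => exact (g.false h'.some).elim
  | nonempty _ =>
  cases d with
  | empty g => exact (g.false (Sum.inl h.some)).elim
  | nonempty _ =>
  cases e with
  | empty g => exact (g.false (α h.some)).elim
  | nonempty _ =>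
  cases e' with
  | empty g => exact (g.false (β h'.some)).elim
  | nonempty _ =>
  cases d' with
  | empty g => exact (g.false (Sum.inl (α h.some))).elim
  | nonempty _ =>
    exact B.vmapOn_sum_map_d₂ (I := { toFinSet := I }) (J := { toFinSet := J })
      (I' := { toFinSet := I' }) (J' := { toFinSet := J' }) α β v w

theorem vpairing_comm {d' : (J.toNEq.sum I.toNEq).set.Cases} (v : B.vobj c) (w : B.vobj c') :
    DMod.SemiHom.on (FinNEq.sumSwap I.toNEq J.toNEq)
      (B.vhom (I := (I.toNEq.sum J.toNEq).set) (J := (J.toNEq.sum I.toNEq).set) Sum.swap d d')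
      ((B.vpairing c c' d).toFun v w) = (B.vpairing c' c d').toFun w v := by
  rcases isEmpty_or_nonempty I with h | h
  · obtain ⟨s, rfl⟩ := B.exists_eq_smul_vunit h v
    rw [DMod.Pairing.smul_left, vunit_vpairing, DMod.Pairing.smul_right, vpairing_vunit,
      DMod.SemiHom.map_smul]
    refine congrArg₂ (· • ·) (SX.map_map _ _ _ (fun _ => rfl) s)
      ((DMod.SemiHom.on_res _ _ _).trans
        (congrArg (fun x => DMod.res (I := J.toNEq.sum I.toNEq) x) ?_))
    exact (B.vhom_comp _ _ _).symm
  rcases isEmpty_or_nonempty J with h' | h'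
  · obtain ⟨s, rfl⟩ := B.exists_eq_smul_vunit h' w
    rw [DMod.Pairing.smul_right, vpairing_vunit, DMod.Pairing.smul_left, vunit_vpairing,
      DMod.SemiHom.map_smul]
    refine congrArg₂ (· • ·) (SX.map_map _ _ _ (fun _ => rfl) s)
      ((DMod.SemiHom.on_res _ _ _).trans
        (congrArg (fun x => DMod.res (I := J.toNEq.sum I.toNEq) x) ?_))
    exact (B.vhom_comp _ _ _).symm
  cases c with
  | empty g => exact (g.false h.some).elim
  | nonempty _ =>
  cases c' with
  | empty g => exact (g.false h'.some).elim
  | nonempty _ =>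
  cases d with
  | empty g => exact (g.false (Sum.inl h.some)).elim
  | nonempty _ =>
  cases d' with
  | empty g => exact (g.false (Sum.inr h.some)).elim
  | nonempty _ =>
    exact B.vmapOn_swap_d₂ (I := { toFinSet := I }) (J := { toFinSet := J }) v w
      (FinNEq.sumSwap I.toNEq J.toNEq).map_rel

theorem vpairing_assoc (hI : Nonempty I) (hJ : Nonempty J) (hK : Nonempty K)
    {e : ((I.toNEq.sum J.toNEq).sum K.toNEq).set.Cases} {d' : (J.toNEq.sum K.toNEq).set.Cases}
    {e' : (I.toNEq.sum (J.toNEq.sum K.toNEq)).set.Cases} (v : B.vobj c) (w : B.vobj c')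
    (z : B.vobj c'') :
    DMod.SemiHom.on (FinNEq.sumAssoc I.toNEq J.toNEq K.toNEq)
      (B.vhom (I := ((I.toNEq.sum J.toNEq).sum K.toNEq).set)
        (J := (I.toNEq.sum (J.toNEq.sum K.toNEq)).set) (Equiv.sumAssoc I J K) e e')
      (DMod.Pairing.on (I := I.toNEq.sum J.toNEq) (J := K.toNEq)
        (B.vpairing d c'' e) ((B.vpairing c c' d).toFun v w) (DMod.res z)) =
    DMod.Pairing.on (I := I.toNEq) (J := J.toNEq.sum K.toNEq)
        (B.vpairing c d' e') (DMod.res v) ((B.vpairing c' c'' d').toFun w z) := by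
  cases c with
  | empty g => exact (g.false hI.some).elim
  | nonempty _ =>
  cases c' with
  | empty g => exact (g.false hJ.some).elim
  | nonempty _ =>
  cases c'' with
  | empty g => exact (g.false hK.some).elim
  | nonempty _ =>
  cases d with
  | empty g => exact (g.false (Sum.inl hI.some)).elim
  | nonempty _ =>
  cases d' with
  | empty g => exact (g.false (Sum.inl hJ.some)).elim
  | nonempty _ =>
  cases e with
  | empty g => exact (g.false (Sum.inr hK.some)).elim
  | nonempty _ =>
  cases e' with
  | empty g => exact (g.false (Sum.inl hI.some)).elim
  | nonempty _ =>
    exact B.vmapOn_assoc_mulOn (I := { toFinSet := I }) (J := { toFinSet := J })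
      (K := { toFinSet := K }) v w z (FinNEq.sumAssoc I.toNEq J.toNEq K.toNEq).map_rel

end vpairing

end UnitalFactorizationAlgebra

end AHS

namespace AHS

variable {f : ℂ[X]}

namespace UnitalFactorizationAlgebra

variable (B C D : UnitalFactorizationAlgebra.{u} f) {I J K : FinSet}

/-! ## The functor from factorization algebras to vertex algebras -/

/-- The global sections, for all finite sets. -/
noncomputable def sections : SFunFin.{u} f where
  obj I := B.vobj I.cases
  map {I J} α := B.vhom α I.cases J.cases
  map_id _ v := B.vhom_id v
  map_comp α β v := B.vhom_comp α β v

/-- The singular multiplication of global sections. -/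
noncomputable def singularMul : B.sections.SingularMul where
  pairing I J := B.vpairing I.cases J.cases (I.toNEq.sum J.toNEq).set.cases
  natural α β v w := B.vpairing_natural α β v w
  comm v w := B.vpairing_comm v w
  unit I := B.vunit I.cases
  unit_mul w := B.vunit_vpairing w
  span hI v := B.exists_eq_smul_vunit hI v
  assoc hI hJ hK v w z := B.vpairing_assoc hI hJ hK v w z

variable {B C D} (φ : B ⟶ C) (ψ : C ⟶ D) {c : I.Cases} {c' : J.Cases} {c'' : K.Cases}

/-- The effect of morphisms on global sections. -/
noncomputable def vapp : (c : I.Cases) → (B.vobj c ⟶ C.vobj c)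
  | .empty _ => 𝟙 (DMod.structureSheaf f I.toNEq)
  | .nonempty _ => φ.app { toFinSet := I }

theorem vapp_id : vapp (𝟙 B) c = 𝟙 _ := by
  cases c <;> rfl

theorem vapp_comp : vapp (φ ≫ ψ) c = vapp φ c ≫ vapp ψ c := by
  cases c <;> rfl

theorem vapp_vunit : (vapp φ c).toLin (B.vunit c) = C.vunit c := by
  cases c with
  | empty _ => rfl
  | nonempty _ => exact Hom.app_vac φ

theorem vapp_vhom (α : I → J) (v : B.vobj c) :
    (vapp φ c').toLin (B.vhom α c c' v) = C.vhom α c c' ((vapp φ c).toLin v) := by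
  rcases isEmpty_or_nonempty I with h | h
  · obtain ⟨s, rfl⟩ := B.exists_eq_smul_vunit h v
    simp only [(B.vhom _ _ _).map_smul, (C.vhom _ _ _).map_smul, vhom_vunit,
      LinearMap.map_smul, vapp_vunit]
  cases c with
  | empty g => exact (g.false h.some).elim
  | nonempty _ =>
  cases c' with
  | empty g => exact (g.false (α h.some)).elim
  | nonempty _ =>
    exact Hom.app_vmap φ (I := { toFinSet := I }) (J := { toFinSet := J }) α v

theorem _root_.AHS.DMod.onMap_smul {I : FinNEq} {M N : DMod.{u} f I.set.toNEq} (h : M ⟶ N)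
    (s : SX f I) (x : M.on (I := I)) :
    DMod.onMap h (s • x) = s • DMod.onMap h x :=
  ((DMod.SemiHom.on (𝟙 I) (DMod.SemiHom.ofHom h)).map_smul s x).trans (by rw [SX.map_id]; rfl)

theorem vapp_vpairing {d : (I.toNEq.sum J.toNEq).set.Cases} (v : B.vobj c) (w : B.vobj c') :
    DMod.onMap (I := I.toNEq.sum J.toNEq) (vapp φ d) ((B.vpairing c c' d).toFun v w) =
      (C.vpairing c c' d).toFun ((vapp φ c).toLin v) ((vapp φ c').toLin w) := by
  rcases isEmpty_or_nonempty I with h | h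
  · obtain ⟨s, rfl⟩ := B.exists_eq_smul_vunit h v
    rw [DMod.Pairing.smul_left, DMod.onMap_smul, LinearMap.map_smul, DMod.Pairing.smul_left,
      vapp_vunit, vunit_vpairing, vunit_vpairing]
    refine congrArg (_ • ·) ((DMod.onMap_res _ _).trans ?_)
    rw [vapp_vhom]
  rcases isEmpty_or_nonempty J with h' | h'
  · obtain ⟨s, rfl⟩ := B.exists_eq_smul_vunit h' w
    rw [DMod.Pairing.smul_right, DMod.onMap_smul, LinearMap.map_smul, DMod.Pairing.smul_right,
      vapp_vunit, vpairing_vunit, vpairing_vunit]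
    refine congrArg (_ • ·) ((DMod.onMap_res _ _).trans ?_)
    rw [vapp_vhom]
  cases c with
  | empty g => exact (g.false h.some).elim
  | nonempty _ =>
  cases c' with
  | empty g => exact (g.false h'.some).elim
  | nonempty _ =>
  cases d with
  | empty g => exact (g.false (Sum.inl h.some)).elim
  | nonempty _ =>
    exact Hom.app_d₂ φ (I := { toFinSet := I }) (J := { toFinSet := J }) v w

/-- Both sides are bilinear over functions on the open subsets, so compatibility with products need
only be known on global sections. -/
theorem _root_.AHS.SFunFin.SingularMul.extMap_singMap {V W : SFunFin.{u} f} (m : V.SingularMul)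
    (n : W.SingularMul) (h : ∀ I, V.obj I ⟶ W.obj I)
    (hm : ∀ {I J : FinSet} (v : V.obj I) (w : V.obj J),
      DMod.onMap (I := I.toNEq.sum J.toNEq) (h _) ((m.pairing I J).toFun v w) =
        (n.pairing I J).toFun ((h I).toLin v) ((h J).toLin w)) {I J : FinNEq}
    (v : V.ext.obj I) (w : V.ext.obj J) :
    SFunFin.extMap (h (I.sum J).set) (m.singMap.toFun I J v w) =
      n.singMap.toFun I J (SFunFin.extMap (h I.set) v) (SFunFin.extMap (h J.set) w) := by
  refine DMod.Pairing.on_ext₂ (I := I) (J := J) (M := V.obj I.set) (N := V.obj J.set)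
    (FinNEq.inl I J) (FinNEq.inr I J)
    (fun v w => SFunFin.extMap (I := I.sum J) (h (I.sum J).set) (m.singMap.toFun I J v w))
    (fun v w => n.singMap.toFun I J (SFunFin.extMap (h I.set) v) (SFunFin.extMap (h J.set) w))
    ?_ ?_ ?_ ?_ ?_ ?_ ?_ ?_ ?_ v w
  · intro x x' y
    exact (congrArg _ (LinearMap.map_add₂ _ _ _ _)).trans (map_add _ _ _)
  · intro x y y'
    exact (congrArg _ (map_add _ _ _)).trans (map_add _ _ _)
  · intro x x' y
    exact (congrArg (n.singMap.toFun I J · _) (map_add (SFunFin.extMap _) x x')).trans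
      (LinearMap.map_add₂ _ _ _ _)
  · intro x y y'
    exact (congrArg _ (map_add (SFunFin.extMap _) y y')).trans (map_add _ _ _)
  · intro s x y
    exact (congrArg _ (m.singMap.smul_left s x y)).trans (DMod.onMap_smul _ _ _)
  · intro s x y
    exact (congrArg _ (m.singMap.smul_right s x y)).trans (DMod.onMap_smul _ _ _)
  · intro s x y
    exact (congrArg (n.singMap.toFun I J · _) (DMod.onMap_smul (h I.set) s x)).trans
      (n.singMap.smul_left _ _ _)
  · intro s x y
    exact (congrArg _ (DMod.onMap_smul (h J.set) s y)).trans (n.singMap.smul_right _ _ _)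
  · intro x y
    refine (congrArg _ (m.singMap_res x y)).trans ?_
    refine Eq.trans ?_ (congrArg₂ (fun a b => n.singMap.toFun I J a b)
      (DMod.onMap_res (h I.set) x) (DMod.onMap_res (h J.set) y)).symm
    refine Eq.trans ?_ (n.singMap_res _ _).symm
    rw [← hm]
    exact DMod.onMap_resTo (I := (I.sum J).set) _ _ _

/-- The functor `Γ_X`. -/
noncomputable def vertexAlgebra : UnitalFactorizationAlgebra.{u} f ⥤ AHSVertexAlgebra.{u} f where
  obj B := B.singularMul.vertexAlgebra
  map {B C} φ :=
    { app := fun I => vapp φ I.cases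
      natural := fun α v => vapp_vhom φ α v
      mul := fun v w => B.singularMul.extMap_singMap C.singularMul (fun I => vapp φ I.cases)
        (fun v w => vapp_vpairing φ v w) v w
      one := vapp_vunit φ }
  map_id _ := AHSVertexAlgebra.Hom.ext (funext fun _ => vapp_id)
  map_comp φ ψ := AHSVertexAlgebra.Hom.ext (funext fun _ => vapp_comp φ ψ)

/-- The identification of the sections of the vertex algebra over `I ≠ ∅` with `B(X^I)`. -/
noncomputable def iso (B : UnitalFactorizationAlgebra.{u} f) {I : NFinSet} :
    (c : I.toFinSet.Cases) → (B.obj I ≅ B.vobj c)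
  | .empty h => (h.false (Classical.arbitrary I)).elim
  | .nonempty _ => Iso.refl _

section iso

variable {I J : NFinSet} {c : I.toFinSet.Cases} {c' : J.toFinSet.Cases}
  {d : (I.toNEq.sum J.toNEq).set.Cases}

theorem vhom_iso {α : I → J} (hα : Function.Surjective α) (b : B.obj I) :
    B.vhom α c c' ((B.iso c).hom.toLin b) = (B.iso c').hom.toLin (B.nu α hα b) := by
  cases c with
  | empty g => exact (g.false (Classical.arbitrary I)).elim
  | nonempty _ =>
  cases c' with
  | empty g => exact (g.false (Classical.arbitrary J)).elim
  | nonempty _ => exact B.vmap_of_surjective hα b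

theorem iso_unit : (B.iso c).hom.toLin (B.unit I 1) = B.vunit c := by
  cases c with
  | empty g => exact (g.false (Classical.arbitrary I)).elim
  | nonempty _ => rfl

theorem vpairing_iso (b : B.obj I) (b' : B.obj J) :
    (B.vpairing c c' d).toFun ((B.iso c).hom.toLin b) ((B.iso c').hom.toLin b') =
      DMod.onMap (I := I.toNEq.sum J.toNEq) (B.iso (I := NFinSet.sum I J) d).hom (B.d₂ b b') := by
  cases c with
  | empty g => exact (g.false (Classical.arbitrary I)).elim
  | nonempty _ =>
  cases c' with
  | empty g => exact (g.false (Classical.arbitrary J)).elim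
  | nonempty _ =>
  cases d with
  | empty g => exact (g.false (Sum.inl (Classical.arbitrary I))).elim
  | nonempty _ => exact (DMod.onMap_id (I := I.toNEq.sum J.toNEq) _ _).symm

theorem vapp_iso (b : B.obj I) :
    (vapp φ c).toLin ((B.iso c).hom.toLin b) = (C.iso c).hom.toLin ((φ.app I).toLin b) := by
  cases c with
  | empty g => exact (g.false (Classical.arbitrary I)).elim
  | nonempty _ => rfl

end iso

/-- Without points there are no generating denominators, so the localization changes nothing, and a
polynomial ring in no variables is `ℂ`. -/
theorem bijective_algebraMap_of_isEmpty {I : FinNEq} (hI : IsEmpty I) :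
    Function.Bijective (algebraMap ℂ (SX f I)) := by
  have h : denominators f I ≤ IsUnit.submonoid (MvPolynomial I ℂ) := by
    refine Submonoid.closure_le.2 ?_
    rintro p (⟨i, rfl⟩ | ⟨i, j, h, rfl⟩) <;> exact (hI.false i).elim
  have h1 : Function.Bijective (algebraMap (MvPolynomial I ℂ) (SX f I)) := by
    have e := IsLocalization.atUnits (MvPolynomial I ℂ) (denominators f I) (S := SX f I) h
    convert e.bijective
    ext p
    exact (e.commutes p).symm
  have h2 : Function.Bijective (algebraMap ℂ (MvPolynomial I ℂ)) :=
    (MvPolynomial.isEmptyAlgEquiv ℂ I).symm.bijective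
  convert h1.comp h2
  exact funext (IsScalarTower.algebraMap_apply ℂ (MvPolynomial I ℂ) (SX f I))

theorem bijective_smul_vunit {c : FinSet.empty.Cases} :
    Function.Bijective fun z : ℂ => z • B.vunit c := by
  cases c with
  | nonempty h => exact h.some.elim
  | empty h =>
    have h1 := ULift.up_bijective.comp (bijective_algebraMap_of_isEmpty (f := f)
      (I := FinSet.empty.toNEq) h)
    have e : (fun z : ℂ => z • B.vunit (.empty h)) =
        ULift.up ∘ algebraMap ℂ (SX f FinSet.empty.toNEq) := by
      funext z
      exact congrArg ULift.up (Algebra.algebraMap_eq_smul_one (A := SX f FinSet.empty.toNEq) z).symm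
    rw [e]
    exact h1

end UnitalFactorizationAlgebra

end AHS
theorem mainTheorem4 (f : ℂ[X]) :
    ∃ (Γ : UnitalFactorizationAlgebra.{u} f ⥤ AHSVertexAlgebra.{u} f)
      (e : ∀ (B : UnitalFactorizationAlgebra.{u} f) (I : NFinSet),
        B.obj I ≅ (Γ.obj B).obj I.toFinSet),
      (∀ B : UnitalFactorizationAlgebra.{u} f,
        Function.Bijective (fun c : ℂ => c • (Γ.obj B).one)) ∧
      (∀ (B : UnitalFactorizationAlgebra.{u} f) (I J : NFinSet) (α : I → J)
        (hα : Function.Surjective α) (b : B.obj I),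
        (Γ.obj B).map α ((e B I).hom.toLin b) = (e B J).hom.toLin (B.nu α hα b)) ∧
      (∀ (B : UnitalFactorizationAlgebra.{u} f) (I : NFinSet),
        (Γ.obj B).map (I := FinSet.empty) (J := I.toFinSet) Empty.elim (Γ.obj B).one =
          (e B I).hom.toLin (B.unit I 1)) ∧
      (∀ (B : UnitalFactorizationAlgebra.{u} f) (I J : NFinSet) (b : B.obj I),
        (Γ.obj B).extRes (I := FinNEq.sum I.toNEq J.toNEq)
            ((Γ.obj B).map (J := (NFinSet.sum I J).toFinSet) Sum.inl ((e B I).hom.toLin b)) =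
          DMod.onMap (e B (NFinSet.sum I J)).hom (B.d₂ b (B.unit J 1))) ∧
      (∀ (B : UnitalFactorizationAlgebra.{u} f) (I J : NFinSet) (b : B.obj I) (c : B.obj J),
        (Γ.obj B).mul.toFun I.toNEq J.toNEq ((Γ.obj B).extRes ((e B I).hom.toLin b))
            ((Γ.obj B).extRes ((e B J).hom.toLin c)) =
          DMod.onMap (e B (NFinSet.sum I J)).hom (B.d₂ b c)) ∧
      (∀ (B C : UnitalFactorizationAlgebra.{u} f) (φ : B ⟶ C) (I : NFinSet) (b : B.obj I),
        ((Γ.map φ).app I.toFinSet).toLin ((e B I).hom.toLin b) =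
          (e C I).hom.toLin ((φ.app I).toLin b)) := by
  refine ⟨UnitalFactorizationAlgebra.vertexAlgebra, fun B I => B.iso I.toFinSet.cases,
    fun B => B.bijective_smul_vunit, ?_, ?_, ?_, ?_, ?_⟩
  · intro B I J α hα b
    exact B.vhom_iso hα b
  · intro B I
    exact (B.vhom_vunit _).trans B.iso_unit.symm
  · intro B I J b
    -- The description of inclusions is that of the multiplication with `c = 1`, combined with the
    -- unit law `vpairing_vunit`.
    refine Eq.trans ?_ (B.vpairing_iso (c := I.cases) (c' := J.cases) b (B.unit J 1))
    rw [B.iso_unit, B.vpairing_vunit]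
    rfl
  · intro B I J b c
    exact (B.singularMul.singMap_res_toNEq _ _).trans (B.vpairing_iso b c)
  · intro B C φ I b
    exact UnitalFactorizationAlgebra.vapp_iso φ b
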